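/- Let $(M^2,g_M)$ be a smooth Riemannian surface whose Gauss curvature satisfies $K_M\ge\lambda^{-2}>1$ for some $0<\lambda<1$ (this is $\mathrm{Scal}_M\ge\lambda^{-2}$ if the scalar curvature of a surface is normalized so that $\mathrm{Scal}_M=\mathrm{Ric}_M=K_M$). Let $C(M)$ be the $3$-dimensional cone over $M$ with vertex $O$ and metric $g=dt^2+t^2g_M$ on $C(M)\setminus\{O\}=(0,\infty)\times M$. Let $\Sigma^1\subset M$ be a nonempty closed (compact, without boundary) embedded minimal hypersurface, i.e. a finite disjoint union of simple closed geodesics, and assume that $\Sigma$ is two-sided, i.e. has a smooth unit normal field (automatic if $M$ is orientable). Then the $2$-dimensional minimal hypercone $C(\Sigma)$ is not stable in $C(M)$: there is a smooth variation of $C(\Sigma)\setminus\{O\}$ in $C(M)\setminus\{O\}$, with compact support, for which the second variation of area is negative. Moreover, $C(\Sigma)$ is not area-minimizing in $C(M)$: there are a compact set $K\subset C(M)$ and a $2$-dimensional integer multiplicity rectifiable current $S$ in $C(M)$ with $\partial S=\partial C(\Sigma)$ and $\operatorname{spt}(S-C(\Sigma))\subset K$ whose mass in $K$ is strictly less than that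 of $C(\Sigma)$, where $C(\Sigma)$ is taken with multiplicity one. -/

import Mathlib

open Set MeasureTheory
open scoped Manifold ContDiff Bundle

noncomputable section

namespace MinCone

/-- The model plane. -/
abbrev Plane : Type := EuclideanSpace ℝ (Fin 2)

/-- A smooth Riemannian metric on a smooth surface `M` (without boundary). -/
abbrev SurfaceMetric (M : Type*) [TopologicalSpace M] [ChartedSpace Plane M]
    [IsManifold 𝓘(ℝ, Plane) ∞ M] : Type _ :=
  Bundle.ContMDiffRiemannianMetric 𝓘(ℝ, Plane) ∞ Plane
    (fun x : M => TangentSpace 𝓘(ℝ, Plane) x)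

variable {M : Type*} [TopologicalSpace M] [ChartedSpace Plane M] [IsManifold 𝓘(ℝ, Plane) ∞ M]

section Curvature

/-- The partial derivative `∂ᵢ h` of a function of the coordinates of a chart. -/
def partialD (i : Fin 2) (h : Plane → ℝ) (u : Plane) : ℝ :=
  fderiv ℝ h u (EuclideanSpace.single i 1)

/-- The coordinate vector field `∂ᵢ` of the chart `e`, at the point with coordinates `u`. -/
def coordVec (e : OpenPartialHomeomorph M Plane) (i : Fin 2) (u : Plane) :
    TangentSpace 𝓘(ℝ, Plane) (e.symm u) :=
  mfderiv 𝓘(ℝ, Plane) 𝓘(ℝ, Plane) e.symm u (EuclideanSpace.single i (1 : ℝ) : Plane)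

/-- The matrix `(gᵢⱼ)` of the metric in the chart `e`, at the point with coordinates `u`. -/
def metricMatrix (g : SurfaceMetric M) (e : OpenPartialHomeomorph M Plane) (u : Plane) :
    Matrix (Fin 2) (Fin 2) ℝ :=
  Matrix.of fun i j => g.inner (e.symm u) (coordVec e i u) (coordVec e j u)

/-- The Christoffel symbol `Γᵏᵢⱼ = ½ ∑ₗ gᵏˡ (∂ᵢ gⱼₗ + ∂ⱼ gᵢₗ - ∂ₗ gᵢⱼ)` in the chart `e`. -/
def christoffel (g : SurfaceMetric M) (e : OpenPartialHomeomorph M Plane) (k i j : Fin 2)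
    (u : Plane) : ℝ :=
  (1 / 2) * ∑ l : Fin 2, (metricMatrix g e u)⁻¹ k l *
    (partialD i (fun w => metricMatrix g e w j l) u
      + partialD j (fun w => metricMatrix g e w i l) u
      - partialD l (fun w => metricMatrix g e w i j) u)

/-- The coefficient `Rˡₖᵢⱼ` of the curvature tensor in the chart `e`:
`(∇ᵢ ∇ⱼ - ∇ⱼ ∇ᵢ) ∂ₖ = ∑ₗ Rˡₖᵢⱼ ∂ₗ`. -/
def riemannCoeff (g : SurfaceMetric M) (e : OpenPartialHomeomorph M Plane) (l k i j : Fin 2)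
    (u : Plane) : ℝ :=
  partialD i (christoffel g e l j k) u - partialD j (christoffel g e l i k) u
    + ∑ r : Fin 2, (christoffel g e l i r u * christoffel g e r j k u
      - christoffel g e l j r u * christoffel g e r i k u)

/-- The Gauss curvature `K = ⟨R(∂₀, ∂₁) ∂₁, ∂₀⟩ / det (gᵢⱼ)` at `x`, computed in a chart `e`
around `x` (it does not depend on the chart). On a surface it is also the Ricci curvature
`Ric(v, v)` of every unit vector `v`. -/
def gaussCurvature (g : SurfaceMetric M) (e : OpenPartialHomeomorph M Plane) (x : M) : ℝ :=
  (∑ l : Fin 2, metricMatrix g e (e x) l 0 * riemannCoeff g e l 1 0 1 (e x))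
    / (metricMatrix g e (e x)).det

/-- The Gauss curvature of `(M, g)` is everywhere at least `k`. -/
def GaussCurvatureGE (g : SurfaceMetric M) (k : ℝ) : Prop :=
  ∀ e ∈ atlas Plane M, ∀ x ∈ e.source, k ≤ gaussCurvature g e x

end Curvature

section CrossSection

/-- The velocity of a curve in `M`. -/
def velocity (c : ℝ → M) (θ : ℝ) : TangentSpace 𝓘(ℝ, Plane) (c θ) :=
  mfderiv 𝓘(ℝ, ℝ) 𝓘(ℝ, Plane) c θ (1 : ℝ)

/-- A closed (that is, compact and without boundary) embedded one-dimensional submanifold of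
`(M, g)`: finitely many, `m`, pairwise disjoint simple closed curves, each parametrized by arc
length. The `j`-th component has length `len j`. -/
structure ClosedCurves (g : SurfaceMetric M) (m : ℕ) where
  /-- the arc length parametrizations, as periodic curves -/
  curve : Fin m → ℝ → M
  /-- the lengths of the components -/
  len : Fin m → ℝ
  len_pos : ∀ j, 0 < len j
  smooth : ∀ j, ContMDiff 𝓘(ℝ, ℝ) 𝓘(ℝ, Plane) ∞ (curve j)
  periodic : ∀ j θ, curve j (θ + len j) = curve j θ
  unit_speed : ∀ j θ, g.inner (curve j θ) (velocity (curve j) θ) (velocity (curve j) θ) = 1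
  embedded : ∀ i j θ θ', curve i θ = curve j θ' → i = j ∧ ∃ k : ℤ, θ' = θ + k * len j

variable {g : SurfaceMetric M} {m : ℕ}

/-- The `k`-th coordinate, in the chart `e`, of the covariant derivative `∇_{c'} c'`. -/
def covAccel (g : SurfaceMetric M) (e : OpenPartialHomeomorph M Plane) (c : ℝ → M) (k : Fin 2)
    (θ : ℝ) : ℝ :=
  deriv (deriv fun τ => e (c τ) k) θ
    + ∑ i : Fin 2, ∑ j : Fin 2, christoffel g e k i j (e (c θ))
      * deriv (fun τ => e (c τ) i) θ * deriv (fun τ => e (c τ) j) θ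

/-- `Σ` is a minimal hypersurface of `(M, g)`: its mean curvature vector, which is `∇_{c'} c'` for
the arc length parametrization `c`, vanishes. -/
def ClosedCurves.IsMinimal (S : ClosedCurves g m) : Prop :=
  ∀ j, ∀ e ∈ atlas Plane M, ∀ θ, S.curve j θ ∈ e.source → ∀ k, covAccel g e (S.curve j) k θ = 0

/-- `Σ` is two-sided: it has a smooth unit normal vector field. -/
def ClosedCurves.IsTwoSided (S : ClosedCurves g m) : Prop :=
  ∀ j, ∃ ν : ∀ θ : ℝ, TangentSpace 𝓘(ℝ, Plane) (S.curve j θ),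
    ContMDiff 𝓘(ℝ, ℝ) 𝓘(ℝ, Plane).tangent ∞
      (fun θ => (⟨S.curve j θ, ν θ⟩ : TangentBundle 𝓘(ℝ, Plane) M)) ∧
    (∀ θ, (⟨S.curve j (θ + S.len j), ν (θ + S.len j)⟩ : TangentBundle 𝓘(ℝ, Plane) M)
      = ⟨S.curve j θ, ν θ⟩) ∧
    ∀ θ, g.inner (S.curve j θ) (ν θ) (ν θ) = 1 ∧
      g.inner (S.curve j θ) (ν θ) (velocity (S.curve j) θ) = 0

end CrossSection

section Cone

/-- The model with corners of `ℝ × M`. The cone `C(M)` without its vertex is the part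
`{(t, x) | 0 < t}` of `ℝ × M`. -/
abbrev coneModel : ModelWithCorners ℝ (ℝ × Plane) (ModelProd ℝ Plane) :=
  𝓘(ℝ, ℝ).prod 𝓘(ℝ, Plane)

/-- The regular part `C(M) \ {O}` of the cone, as a subset of `ℝ × M`. -/
def regularPart (M : Type*) : Set (ℝ × M) := {p | 0 < p.1}

/-- The cone metric `dt² + t² g`. -/
def coneInner (g : SurfaceMetric M) (p : ℝ × M) (v w : TangentSpace coneModel p) : ℝ :=
  (show ℝ × Plane from v).1 * (show ℝ × Plane from w).1
    + p.1 ^ 2 * g.inner p.2 (show ℝ × Plane from v).2 (show ℝ × Plane from w).2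

/-- The partial derivative at `q` of a map from (an open part of) `ℝ × ℝ` to the cone,
in the direction `a`. -/
def tangentVec (F : ℝ × ℝ → ℝ × M) (q a : ℝ × ℝ) : TangentSpace coneModel (F q) :=
  mfderiv 𝓘(ℝ, ℝ × ℝ) coneModel F q a

/-- The area element (the two-dimensional Jacobian with respect to the cone metric) of a
parametrized surface in the cone. -/
def areaElement (g : SurfaceMetric M) (F : ℝ × ℝ → ℝ × M) (q : ℝ × ℝ) : ℝ :=
  Real.sqrt (coneInner g (F q) (tangentVec F q (1, 0)) (tangentVec F q (1, 0))
      * coneInner g (F q) (tangentVec F q (0, 1)) (tangentVec F q (0, 1))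
    - coneInner g (F q) (tangentVec F q (1, 0)) (tangentVec F q (0, 1)) ^ 2)

variable {g : SurfaceMetric M} {m : ℕ}

/-- The parametrization `(t, θ) ↦ (t, c(θ))` of the cone over a curve. -/
def coneMap (c : ℝ → M) (q : ℝ × ℝ) : ℝ × M := (q.1, c q.2)

/-! ### Stability -/

/-- A smooth variation of `C(Σ) \ {O}` inside `C(M) \ {O}` with compact support: it fixes all the
points at a distance `t` outside `[a, b] ⊆ (0, ∞)` from the vertex. -/
structure ConeVariation (S : ClosedCurves g m) where
  /-- the parameter of the variation runs through `(-δ, δ)` -/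
  δ : ℝ
  /-- lower bound of the support -/
  a : ℝ
  /-- upper bound of the support -/
  b : ℝ
  /-- `X s j (t, θ)` is the position at time `s` of the point `(t, c_j(θ))` of `C(Σ)` -/
  X : ℝ → Fin m → ℝ × ℝ → ℝ × M
  δ_pos : 0 < δ
  a_pos : 0 < a
  a_le_b : a ≤ b
  smooth : ∀ j, ContMDiffOn 𝓘(ℝ, ℝ × (ℝ × ℝ)) coneModel ∞
    (fun z : ℝ × (ℝ × ℝ) => X z.1 j z.2) (Ioo (-δ) δ ×ˢ (Ioi 0 ×ˢ univ))
  mem_regularPart : ∀ s ∈ Ioo (-δ) δ, ∀ j t θ, 0 < t → X s j (t, θ) ∈ regularPart M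
  periodic : ∀ s ∈ Ioo (-δ) δ, ∀ j t θ, 0 < t → X s j (t, θ + S.len j) = X s j (t, θ)
  at_zero : ∀ j t θ, 0 < t → X 0 j (t, θ) = coneMap (S.curve j) (t, θ)
  fixed : ∀ s ∈ Ioo (-δ) δ, ∀ j t θ, 0 < t → t ∉ Icc a b →
    X s j (t, θ) = coneMap (S.curve j) (t, θ)

/-- The area at time `s` of the part of the surface that the variation moves. -/
def ConeVariation.area {S : ClosedCurves g m} (V : ConeVariation S) (s : ℝ) : ℝ :=
  ∑ j : Fin m, ∫ q in Icc V.a V.b ×ˢ Icc 0 (S.len j), areaElement g (V.X s j) q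

/-- The minimal cone `C(Σ)` is stable in `C(M)`: the second variation of area is nonnegative for
every smooth variation with compact support away from the vertex. -/
def IsStableCone (S : ClosedCurves g m) : Prop :=
  ∀ V : ConeVariation S, 0 ≤ deriv (deriv V.area) 0

/-! ### Two-dimensional integer multiplicity currents in the cone -/

/-- The trace `K` on the regular part of a compact subset `K` or `K ∪ {O}` of the cone. -/
def ConeCompact (K : Set (ℝ × M)) : Prop :=
  K ⊆ regularPart M ∧ (∃ R : ℝ, ∀ p ∈ K, p.1 ≤ R) ∧
    ∀ ε : ℝ, 0 < ε → IsCompact (K ∩ {p | ε ≤ p.1})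

/-- Functions on the cone that are smooth away from the vertex and have a bounded gradient with
respect to the cone metric. -/
def IsConeSmooth (g : SurfaceMetric M) (f : ℝ × M → ℝ) : Prop :=
  ContMDiffOn coneModel 𝓘(ℝ, ℝ) ∞ f (regularPart M) ∧
    ∃ C : ℝ, ∀ p ∈ regularPart M, ∀ v : TangentSpace coneModel p,
      (show ℝ from mfderiv coneModel 𝓘(ℝ, ℝ) f p v) ^ 2 ≤ C * coneInner g p v v

/-- `f` vanishes outside `K` (on the cone without its vertex, which is a null set for
two-dimensional currents). -/
def VanishesOff (f : ℝ × M → ℝ) (K : Set (ℝ × M)) : Prop :=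
  ∀ p ∈ regularPart M, p ∉ K → f p = 0

/-- The data of a two-dimensional integer multiplicity current `∑ᵢ θᵢ (Fᵢ)_# ⟦Aᵢ⟧` in the cone. -/
structure ChainData (M : Type*) where
  /-- the index set -/
  ι : Type
  /-- the parametrizations `Fᵢ` -/
  map : ι → ℝ × ℝ → ℝ × M
  /-- the parameter domains `Aᵢ` -/
  dom : ι → Set (ℝ × ℝ)
  /-- the multiplicities `θᵢ`, their signs taking care of the orientation -/
  mult : ι → ℤ

/-- The mass `𝐌(T ⌞ K)`. (The pieces of a current are disjoint, see `IsIntegerRectifiable`.) -/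
def ChainData.mass (g : SurfaceMetric M) (T : ChainData M) (K : Set (ℝ × M)) : ENNReal :=
  ∑' i : T.ι, ((T.mult i).natAbs : ENNReal)
    * ∫⁻ q in T.dom i ∩ T.map i ⁻¹' K, ENNReal.ofReal (areaElement g (T.map i) q)

/-- The determinant `d(f ∘ F) ∧ d(h ∘ F) (∂₁, ∂₂)`. -/
def wedge (F : ℝ × ℝ → ℝ × M) (f h : ℝ × M → ℝ) (q : ℝ × ℝ) : ℝ :=
  fderiv ℝ (f ∘ F) q (1, 0) * fderiv ℝ (h ∘ F) q (0, 1)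
    - fderiv ℝ (f ∘ F) q (0, 1) * fderiv ℝ (h ∘ F) q (1, 0)

/-- The value `T(φ df ∧ dh)` of the current on a `2`-form. -/
def ChainData.eval (T : ChainData M) (φ f h : ℝ × M → ℝ) : ℝ :=
  ∑' i : T.ι, (T.mult i : ℝ) * ∫ q in T.dom i, φ (T.map i q) * wedge (T.map i) f h q

/-- `T` is a locally rectifiable current with integer multiplicities, in the cone: it is carried,
up to a null set, by countably many disjoint measurable pieces of `C¹` surfaces, each with a
constant integer multiplicity, and it has finite mass on compact sets. -/
structure ChainData.IsIntegerRectifiable (g : SurfaceMetric M) (T : ChainData M) : Prop where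
  countable : Countable T.ι
  measurable : ∀ i, MeasurableSet (T.dom i)
  c1 : ∀ i, ∃ U : Set (ℝ × ℝ), IsOpen U ∧ T.dom i ⊆ U ∧
    ContMDiffOn 𝓘(ℝ, ℝ × ℝ) coneModel 1 (T.map i) U
  mem_regularPart : ∀ i, ∀ q ∈ T.dom i, T.map i q ∈ regularPart M
  injective : ∀ i, InjOn (T.map i) (T.dom i)
  disjoint : ∀ i j, i ≠ j → Disjoint (T.map i '' T.dom i) (T.map j '' T.dom j)
  finite_mass : ∀ K : Set (ℝ × M), ConeCompact K → T.mass g K < ⊤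

/-- `∂S = ∂T`, tested on the `1`-forms `f dh`, where `f` has compact support in the cone. -/
def SameBoundary (g : SurfaceMetric M) (S T : ChainData M) : Prop :=
  ∀ f h : ℝ × M → ℝ, IsConeSmooth g f → IsConeSmooth g h →
    (∃ K, ConeCompact K ∧ VanishesOff f K) →
    S.eval (fun _ => 1) f h = T.eval (fun _ => 1) f h

/-- `spt (S - T) ⊆ K` (up to the vertex): the two currents agree on the `2`-forms `φ df ∧ dh`
where `φ` has compact support in the cone, disjoint from `K`. -/
def AgreeOff (g : SurfaceMetric M) (S T : ChainData M) (K : Set (ℝ × M)) : Prop :=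
  ∀ φ f h : ℝ × M → ℝ, IsConeSmooth g φ → IsConeSmooth g f → IsConeSmooth g h →
    (∃ K', ConeCompact K' ∧ Disjoint K' K ∧ VanishesOff φ K') →
    S.eval φ f h = T.eval φ f h

/-- `T` is area-minimizing in the cone: its mass is at most that of every integer rectifiable
current `S` with the same boundary that differs from `T` only in a compact set. As `S` and `T`
agree off `K`, it is enough to compare the masses on `K`. -/
def ChainData.IsAreaMinimizing (g : SurfaceMetric M) (T : ChainData M) : Prop :=
  ∀ K : Set (ℝ × M), ConeCompact K → ∀ S : ChainData M, S.IsIntegerRectifiable g →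
    SameBoundary g S T → AgreeOff g S T K → T.mass g K ≤ S.mass g K

/-- The hypercone `C(Σ)` as a current of multiplicity one. -/
def coneCurrent (S : ClosedCurves g m) : ChainData M where
  ι := Fin m
  map j := coneMap (S.curve j)
  dom j := Ioi 0 ×ˢ Ico 0 (S.len j)
  mult _ := 1

end Cone

end MinCone

end

/-!
The cone over `Σ` is deformed by moving its point `(t, θ)` to `(t, E (s φ(t), θ))`, where
`E (r, θ)` is a smooth family of closed curves in `M` such that `E (0, ·)` is the arc length
parametrization of a component of `Σ` and `∂_r E (0, ·)` is a unit normal field along it, and where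
`φ` is a cutoff with compact support in `(0, ∞)`. Only the first derivative of `E` at `r = 0` is
prescribed, so no exponential map is needed: `E` is composed of small moves in single charts,
weighted by a partition of unity on the circle (`exists_isFamily`).

Let `A = ⟨∂_r E, ∂_r E⟩`, `B = ⟨∂_r E, ∂_θ E⟩`, `C = ⟨∂_θ E, ∂_θ E⟩` be the coefficients of the
metric pulled back by `E`. At `r = 0` one has `A = C = 1` and `B = 0`, and as the components of `Σ`
are geodesics, also `∂_r C = 0` and `½ ∂_r² C = -K + ∂_θ ∂_r B` (`curvature_equation`). The last
term integrates to zero by periodicity, so that the integral of `½ ∂_r² C` over a component of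
length `L` is `-∫ K ≤ -κ L`, where `κ = lam⁻²`. Consequently the second derivative of the area at
`s = 0` is at most `L ∫ (t³ φ'(t)² - κ t φ(t)²) dt` (`second_variation`). With
`φ(t) = ψ(ε log t) / t` for a bump function `ψ` this is `L (ε ∫ ψ'² - (κ - 1) ε⁻¹ ∫ ψ²)`, by the
substitution `u = ε log t`. It is negative for small `ε`, because `κ > 1` (`exists_radial_cutoff`),
and this is the instability (`Deformation.not_isStableCone`).

The deformed cone itself, at a small time `s`, is the competitor that shows that the cone is not
area-minimizing. It has less area (`Deformation.exists_area_lt`). It is embedded, since `E` is an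
immersion in `θ` along `r = 0` and `Σ` is compact and embedded (`Deformation.exists_embedded`), so
that it is an integer rectifiable current (`Deformation.isIntegerRectifiable`). It has the same
boundary as the cone by Green's formula on the rectangle of parameters outside of which the two
surfaces agree (`Deformation.sameBoundary`).
-/

noncomputable section

namespace MinCone

variable {M : Type*} [TopologicalSpace M] [ChartedSpace Plane M] [IsManifold 𝓘(ℝ, Plane) ∞ M]

section MetricInChart

/-! ### The metric in a chart -/

/-- The metric at `x` as a function of two vectors of the model plane. Every tangent space is the
model plane by definition, so that with this form the base point can be rewritten freely. -/
def metricAt (g : SurfaceMetric M) (x : M) (v w : Plane) : ℝ := g.inner x v w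

lemma contMDiffOn_tangent_symm {e : OpenPartialHomeomorph M Plane} (he : e ∈ atlas Plane M)
    (v : Plane) :
    ContMDiffOn 𝓘(ℝ, Plane) 𝓘(ℝ, Plane).tangent ∞
      (fun u => (⟨e.symm u, mfderiv 𝓘(ℝ, Plane) 𝓘(ℝ, Plane) e.symm u v⟩ :
        TangentBundle 𝓘(ℝ, Plane) M)) e.target := by
  have h1 : ContMDiffOn 𝓘(ℝ, Plane) 𝓘(ℝ, Plane) ∞ e.symm e.target :=
    contMDiffOn_symm_of_mem_maximalAtlas (IsManifold.subset_maximalAtlas he)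
  have h2 := h1.contMDiffOn_tangentMapWithin (m := ∞) (by simp) e.open_target.uniqueMDiffOn
  have h3 : ContMDiffOn 𝓘(ℝ, Plane) 𝓘(ℝ, Plane).tangent ∞
      (fun u : Plane => (⟨u, v⟩ : TangentBundle 𝓘(ℝ, Plane) Plane)) e.target := by
    intro u hu
    rw [contMDiffWithinAt_vectorSpace_iff_contDiffWithinAt (V := fun _ => v)]
    exact contDiffWithinAt_const
  refine (h2.comp h3 (fun u hu => hu)).congr ?_
  intro u hu
  simp only [Function.comp, tangentMapWithin]
  rw [mfderivWithin_of_isOpen e.open_target hu]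

lemma contDiffOn_metricMatrix (g : SurfaceMetric M) {e : OpenPartialHomeomorph M Plane}
    (he : e ∈ atlas Plane M) (i j : Fin 2) :
    ContDiffOn ℝ ∞ (fun u => metricMatrix g e u i j) e.target := by
  intro u hu
  have hi := contMDiffOn_tangent_symm he (EuclideanSpace.single i (1 : ℝ)) u hu
  have hj := contMDiffOn_tangent_symm he (EuclideanSpace.single j (1 : ℝ)) u hu
  have hb : ContMDiffWithinAt 𝓘(ℝ, Plane) 𝓘(ℝ, Plane) ∞ e.symm e.target u :=
    contMDiffOn_symm_of_mem_maximalAtlas (IsManifold.subset_maximalAtlas he) u hu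
  have : ContMDiffWithinAt 𝓘(ℝ, Plane) (𝓘(ℝ, Plane).prod 𝓘(ℝ, ℝ)) ∞
      (fun m ↦ Bundle.TotalSpace.mk' ℝ (E := Bundle.Trivial M ℝ) (e.symm m)
        (g.inner (e.symm m) (coordVec e i m) (coordVec e j m))) e.target u := by
    apply ContMDiffWithinAt.clm_bundle_apply₂ (F₁ := Plane) (F₂ := Plane)
    · exact ContMDiffAt.comp_contMDiffWithinAt u g.contMDiff.contMDiffAt hb
    · exact hi
    · exact hj
  simp only [Bundle.contMDiffWithinAt_totalSpace] at this
  exact this.2.contDiffWithinAt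

lemma metricMatrix_symm (g : SurfaceMetric M) (e : OpenPartialHomeomorph M Plane) (u : Plane)
    (i j : Fin 2) : metricMatrix g e u i j = metricMatrix g e u j i :=
  g.symm _ _ _

lemma metricAt_symm_mfderiv (g : SurfaceMetric M) (e : OpenPartialHomeomorph M Plane)
    (u v w : Plane) :
    metricAt g (e.symm u) (mfderiv 𝓘(ℝ, Plane) 𝓘(ℝ, Plane) e.symm u v)
      (mfderiv 𝓘(ℝ, Plane) 𝓘(ℝ, Plane) e.symm u w)
      = ∑ i, ∑ j, metricMatrix g e u i j * v i * w j := by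
  have hv : ∀ v : Plane, v = ∑ i, v i • (EuclideanSpace.single i (1 : ℝ) : Plane) := by
    intro v; ext k; simp [Fin.sum_univ_two]; fin_cases k <;> simp
  have key : ∀ v : Plane, (mfderiv 𝓘(ℝ, Plane) 𝓘(ℝ, Plane) e.symm u) v
      = v 0 • coordVec e 0 u + v 1 • coordVec e 1 u := by
    intro v
    conv_lhs => rw [hv v, Fin.sum_univ_two]
    exact ((mfderiv 𝓘(ℝ, Plane) 𝓘(ℝ, Plane) e.symm u).map_add _ _).trans
      (congrArg₂ _ ((mfderiv 𝓘(ℝ, Plane) 𝓘(ℝ, Plane) e.symm u).map_smul _ _)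
        ((mfderiv 𝓘(ℝ, Plane) 𝓘(ℝ, Plane) e.symm u).map_smul _ _))
  unfold metricAt
  erw [key v, key w]
  simp only [map_add, map_smul, add_apply, smul_apply,
    smul_eq_mul, Fin.sum_univ_two, metricMatrix, Matrix.of_apply]
  ring

lemma mfderiv_symm_mfderiv {e : OpenPartialHomeomorph M Plane} (he : e ∈ atlas Plane M)
    {x : M} (hx : x ∈ e.source) (v : Plane) :
    (mfderiv 𝓘(ℝ, Plane) 𝓘(ℝ, Plane) e.symm (e x)
      (mfderiv 𝓘(ℝ, Plane) 𝓘(ℝ, Plane) e x v) : Plane) = v := by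
  have := (mdifferentiable_of_mem_atlas (I := 𝓘(ℝ, Plane)) he).symm_comp_deriv hx
  exact DFunLike.congr_fun this v

lemma mfderiv_mfderiv_symm {e : OpenPartialHomeomorph M Plane} (he : e ∈ atlas Plane M)
    {u : Plane} (hu : u ∈ e.target) (v : Plane) :
    (mfderiv 𝓘(ℝ, Plane) 𝓘(ℝ, Plane) e (e.symm u)
      (mfderiv 𝓘(ℝ, Plane) 𝓘(ℝ, Plane) e.symm u v) : Plane) = v := by
  have := (mdifferentiable_of_mem_atlas (I := 𝓘(ℝ, Plane)) he).comp_symm_deriv hu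
  exact DFunLike.congr_fun this v

lemma metricAt_eq_sum (g : SurfaceMetric M) {e : OpenPartialHomeomorph M Plane}
    (he : e ∈ atlas Plane M) {x : M} (hx : x ∈ e.source) (v w : Plane) :
    metricAt g x v w = ∑ i, ∑ j, metricMatrix g e (e x) i j
      * (show Plane from mfderiv 𝓘(ℝ, Plane) 𝓘(ℝ, Plane) e x v) i
      * (show Plane from mfderiv 𝓘(ℝ, Plane) 𝓘(ℝ, Plane) e x w) j := by
  have := metricAt_symm_mfderiv g e (e x) (mfderiv 𝓘(ℝ, Plane) 𝓘(ℝ, Plane) e x v)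
    (mfderiv 𝓘(ℝ, Plane) 𝓘(ℝ, Plane) e x w)
  rw [mfderiv_symm_mfderiv he hx, mfderiv_symm_mfderiv he hx, e.left_inv hx] at this
  exact this

/-- The chart expression of the metric on the image of a differential. -/
lemma metricAt_mfderiv {V : Type*} [NormedAddCommGroup V] [NormedSpace ℝ V] (g : SurfaceMetric M)
    {e : OpenPartialHomeomorph M Plane} (he : e ∈ atlas Plane M) {F : V → M} {p : V}
    (hF : MDifferentiableAt 𝓘(ℝ, V) 𝓘(ℝ, Plane) F p) (hx : F p ∈ e.source) (a b : V) :
    metricAt g (F p) (mfderiv 𝓘(ℝ, V) 𝓘(ℝ, Plane) F p a) (mfderiv 𝓘(ℝ, V) 𝓘(ℝ, Plane) F p b)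
      = ∑ i, ∑ j, metricMatrix g e (e (F p)) i j * (fderiv ℝ (fun q => e (F q)) p a) i
        * (fderiv ℝ (fun q => e (F q)) p b) j := by
  have h := mfderiv_comp p (I'' := 𝓘(ℝ, Plane)) (mdifferentiableAt_atlas he hx) hF
  rw [mfderiv_eq_fderiv] at h
  have h' : ∀ a, fderiv ℝ (fun q => e (F q)) p a
      = mfderiv 𝓘(ℝ, Plane) 𝓘(ℝ, Plane) e (F p) (mfderiv 𝓘(ℝ, V) 𝓘(ℝ, Plane) F p a) :=
    fun a => DFunLike.congr_fun h a
  simp only [h']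
  exact metricAt_eq_sum g he hx _ _

lemma metricMatrix_det_pos (g : SurfaceMetric M) {e : OpenPartialHomeomorph M Plane}
    (he : e ∈ atlas Plane M) {u : Plane} (hu : u ∈ e.target) :
    0 < (metricMatrix g e u).det := by
  have hpos : ∀ v : Plane, v ≠ 0 → 0 < ∑ i, ∑ j, metricMatrix g e u i j * v i * v j := by
    intro v hv
    rw [← metricAt_symm_mfderiv]
    apply g.pos
    intro h
    apply hv
    have h2 := mfderiv_mfderiv_symm he hu v
    erw [h, map_zero] at h2
    exact h2.symm
  have h1 := hpos (EuclideanSpace.single 0 1) (by simp)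
  have h2 := hpos (!₂[-metricMatrix g e u 0 1, metricMatrix g e u 0 0]) (by
    intro h
    have h3 := congrFun (congrArg (WithLp.ofLp) h) 1
    simp at h1 h3
    linarith)
  simp [Fin.sum_univ_two] at h1 h2
  rw [metricMatrix_symm g e u 1 0] at h2
  rw [Matrix.det_fin_two, metricMatrix_symm g e u 1 0]
  by_contra hn
  nlinarith [mul_nonneg h1.le (not_lt.1 hn |> neg_nonneg.2)]

end MetricInChart

section GaussCurvature

/-! ### Christoffel symbols and the Gauss curvature in a chart -/

lemma partialD_mul {f h : Plane → ℝ} {u : Plane} (hf : DifferentiableAt ℝ f u)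
    (hh : DifferentiableAt ℝ h u) (i : Fin 2) :
    partialD i (fun w => f w * h w) u = f u * partialD i h u + h u * partialD i f u := by
  unfold partialD
  rw [fderiv_fun_mul hf hh]
  simp

lemma partialD_add {f h : Plane → ℝ} {u : Plane} (hf : DifferentiableAt ℝ f u)
    (hh : DifferentiableAt ℝ h u) (i : Fin 2) :
    partialD i (fun w => f w + h w) u = partialD i f u + partialD i h u := by
  unfold partialD
  rw [fderiv_fun_add hf hh]
  simp

lemma partialD_sub {f h : Plane → ℝ} {u : Plane} (hf : DifferentiableAt ℝ f u)
    (hh : DifferentiableAt ℝ h u) (i : Fin 2) :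
    partialD i (fun w => f w - h w) u = partialD i f u - partialD i h u := by
  unfold partialD
  rw [fderiv_fun_sub hf hh]
  simp

lemma partialD_const_mul {f : Plane → ℝ} {u : Plane} (hf : DifferentiableAt ℝ f u) (c : ℝ)
    (i : Fin 2) : partialD i (fun w => c * f w) u = c * partialD i f u := by
  unfold partialD
  rw [fderiv_const_mul hf]
  simp

lemma partialD_congr {f h : Plane → ℝ} {U : Set Plane} (hU : IsOpen U) (hfh : EqOn f h U)
    {u : Plane} (hu : u ∈ U) (i : Fin 2) : partialD i f u = partialD i h u := by
  unfold partialD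
  rw [Filter.EventuallyEq.fderiv_eq (hfh.eventuallyEq_of_mem (hU.mem_nhds hu))]

lemma contDiffOn_partialD {f : Plane → ℝ} {U : Set Plane} (hU : IsOpen U)
    (hf : ContDiffOn ℝ ∞ f U) (i : Fin 2) : ContDiffOn ℝ ∞ (partialD i f) U :=
  (hf.fderiv_of_isOpen hU (m := ∞) (by simp)).clm_apply contDiffOn_const

lemma _root_.ContDiffOn.differentiableAt_of_isOpen {V W : Type*} [NormedAddCommGroup V]
    [NormedSpace ℝ V] [NormedAddCommGroup W] [NormedSpace ℝ W] {f : V → W} {U : Set V}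
    (hf : ContDiffOn ℝ ∞ f U) (hU : IsOpen U) {u : V} (hu : u ∈ U) : DifferentiableAt ℝ f u :=
  (hf.contDiffAt (hU.mem_nhds hu)).differentiableAt (by simp)

lemma fderiv_fderiv_comm {V : Type*} [NormedAddCommGroup V] [NormedSpace ℝ V] {f : V → ℝ}
    {U : Set V} (hU : IsOpen U) (hf : ContDiffOn ℝ ∞ f U) {u : V} (hu : u ∈ U) (a b : V) :
    fderiv ℝ (fun w => fderiv ℝ f w a) u b = fderiv ℝ (fun w => fderiv ℝ f w b) u a := by
  have h1 : ContDiffAt ℝ ∞ f u := hf.contDiffAt (hU.mem_nhds hu)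
  have h2 : IsSymmSndFDerivAt ℝ f u := h1.isSymmSndFDerivAt (by
    simpa using WithTop.coe_le_coe.2 (le_top : (2 : ℕ∞) ≤ ⊤))
  have h3 : DifferentiableAt ℝ (fderiv ℝ f) u :=
    (hf.fderiv_of_isOpen hU (m := ∞) (by simp)).differentiableAt_of_isOpen hU hu
  rw [fderiv_clm_apply h3 (differentiableAt_const a),
    fderiv_clm_apply h3 (differentiableAt_const b)]
  simpa using h2.eq b a

lemma partialD_comm {f : Plane → ℝ} {U : Set Plane} (hU : IsOpen U)
    (hf : ContDiffOn ℝ ∞ f U) {u : Plane} (hu : u ∈ U) (i j : Fin 2) :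
    partialD i (partialD j f) u = partialD j (partialD i f) u :=
  fderiv_fderiv_comm hU hf hu _ _

section

variable (g : SurfaceMetric M) {e : OpenPartialHomeomorph M Plane}

lemma metricMatrix_fun_symm (e : OpenPartialHomeomorph M Plane) (i j : Fin 2) :
    (fun u => metricMatrix g e u i j) = fun u => metricMatrix g e u j i :=
  funext fun u => metricMatrix_symm g e u i j

lemma christoffel_symm (e : OpenPartialHomeomorph M Plane) (k i j : Fin 2) :
    christoffel g e k i j = christoffel g e k j i := by
  funext u
  unfold christoffel
  congr 1
  refine Finset.sum_congr rfl fun l _ => ?_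
  rw [metricMatrix_fun_symm g e i j]
  ring

/-- Lowering the index of a Christoffel symbol. -/
lemma sum_metricMatrix_mul_christoffel (he : e ∈ atlas Plane M) {u : Plane} (hu : u ∈ e.target)
    (l i j : Fin 2) :
    ∑ k, metricMatrix g e u l k * christoffel g e k i j u
      = (1 / 2) * (partialD i (fun w => metricMatrix g e w j l) u
        + partialD j (fun w => metricMatrix g e w i l) u
        - partialD l (fun w => metricMatrix g e w i j) u) := by
  have hdet : IsUnit (metricMatrix g e u).det := (metricMatrix_det_pos g he hu).ne'.isUnit
  have h1 : ∀ n, ∑ k, metricMatrix g e u l k * (metricMatrix g e u)⁻¹ k n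
      = if l = n then 1 else 0 := by
    intro n
    rw [← Matrix.mul_apply, Matrix.mul_nonsing_inv _ hdet, Matrix.one_apply]
  have h0 := h1 0
  have h2 := h1 1
  unfold christoffel
  simp only [Fin.sum_univ_two] at h0 h2 ⊢
  generalize (metricMatrix g e u)⁻¹ 0 0 = a at *
  generalize (metricMatrix g e u)⁻¹ 0 1 = b at *
  generalize (metricMatrix g e u)⁻¹ 1 0 = c at *
  generalize (metricMatrix g e u)⁻¹ 1 1 = d at *
  fin_cases l <;> simp at h0 h2 ⊢
  · linear_combination (1 / 2) * (partialD i (fun w => metricMatrix g e w j 0) u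
        + partialD j (fun w => metricMatrix g e w i 0) u
        - partialD 0 (fun w => metricMatrix g e w i j) u) * h0
        + (1 / 2) * (partialD i (fun w => metricMatrix g e w j 1) u
        + partialD j (fun w => metricMatrix g e w i 1) u
        - partialD 1 (fun w => metricMatrix g e w i j) u) * h2
  · linear_combination (1 / 2) * (partialD i (fun w => metricMatrix g e w j 0) u
        + partialD j (fun w => metricMatrix g e w i 0) u
        - partialD 0 (fun w => metricMatrix g e w i j) u) * h0
        + (1 / 2) * (partialD i (fun w => metricMatrix g e w j 1) u
        + partialD j (fun w => metricMatrix g e w i 1) u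
        - partialD 1 (fun w => metricMatrix g e w i j) u) * h2

/-- The Levi-Civita connection is metric. -/
lemma partialD_metricMatrix (he : e ∈ atlas Plane M) {u : Plane} (hu : u ∈ e.target)
    (k i j : Fin 2) :
    partialD k (fun w => metricMatrix g e w i j) u
      = ∑ l, (metricMatrix g e u i l * christoffel g e l k j u
        + metricMatrix g e u j l * christoffel g e l k i u) := by
  rw [Finset.sum_add_distrib, sum_metricMatrix_mul_christoffel g he hu,
    sum_metricMatrix_mul_christoffel g he hu, metricMatrix_fun_symm g e j i,
    metricMatrix_fun_symm g e k j, metricMatrix_fun_symm g e k i]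
  ring

lemma contDiffOn_christoffel (he : e ∈ atlas Plane M) (k i j : Fin 2) :
    ContDiffOn ℝ ∞ (christoffel g e k i j) e.target := by
  have hm := fun i j => contDiffOn_metricMatrix g he i j
  have hdet : ContDiffOn ℝ ∞ (fun u => (metricMatrix g e u).det) e.target := by
    simp only [Matrix.det_fin_two]
    exact ((hm 0 0).mul (hm 1 1)).sub ((hm 0 1).mul (hm 1 0))
  have hadj : ∀ k l, ContDiffOn ℝ ∞ (fun u => (metricMatrix g e u).adjugate k l) e.target := by
    intro k l
    simp only [Matrix.adjugate_fin_two]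
    fin_cases k <;> fin_cases l <;> simp
    exacts [hm 1 1, (hm 0 1).neg, (hm 1 0).neg, hm 0 0]
  have hinv : ∀ k l, ContDiffOn ℝ ∞ (fun u => (metricMatrix g e u)⁻¹ k l) e.target := by
    intro k l
    simp only [Matrix.inv_def, Ring.inverse_eq_inv', Matrix.smul_apply, smul_eq_mul]
    exact (hdet.inv fun u hu => (metricMatrix_det_pos g he hu).ne').mul (hadj k l)
  unfold christoffel
  refine contDiffOn_const.mul (ContDiffOn.sum fun l _ => (hinv k l).mul ?_)
  exact ((contDiffOn_partialD e.open_target (hm j l) i).add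
    (contDiffOn_partialD e.open_target (hm i l) j)).sub
    (contDiffOn_partialD e.open_target (hm i j) l)

/-- The Gauss curvature in terms of the second derivatives of the metric coefficients and the
Christoffel symbols. -/
lemma gaussCurvature_mul_det (he : e ∈ atlas Plane M) {x : M} (hx : x ∈ e.source) :
    gaussCurvature g e x * (metricMatrix g e (e x)).det
      = partialD 0 (partialD 1 fun w => metricMatrix g e w 0 1) (e x)
        - (1 / 2) * partialD 0 (partialD 0 fun w => metricMatrix g e w 1 1) (e x)
        - (1 / 2) * partialD 1 (partialD 1 fun w => metricMatrix g e w 0 0) (e x)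
        + ∑ k, ∑ l, metricMatrix g e (e x) k l
          * (christoffel g e k 0 1 (e x) * christoffel g e l 0 1 (e x)
            - christoffel g e k 0 0 (e x) * christoffel g e l 1 1 (e x)) := by
  have hu : e x ∈ e.target := e.map_source hx
  rw [gaussCurvature, div_mul_cancel₀ _ (metricMatrix_det_pos g he hu).ne']
  set u := e x
  have hm : ∀ i j, DifferentiableAt ℝ (fun w => metricMatrix g e w i j) u := fun i j =>
    (contDiffOn_metricMatrix g he i j).differentiableAt_of_isOpen e.open_target hu
  have hΓ : ∀ k i j, DifferentiableAt ℝ (christoffel g e k i j) u := fun k i j =>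
    (contDiffOn_christoffel g he k i j).differentiableAt_of_isOpen e.open_target hu
  have hdm : ∀ i j k, DifferentiableAt ℝ (partialD k fun w => metricMatrix g e w i j) u :=
    fun i j k => (contDiffOn_partialD e.open_target
      (contDiffOn_metricMatrix g he i j) k).differentiableAt_of_isOpen e.open_target hu
  -- differentiate the formula for the lowered Christoffel symbols
  have key : ∀ n i j, ∑ k, (metricMatrix g e u 0 k * partialD n (christoffel g e k i j) u
      + christoffel g e k i j u * partialD n (fun w => metricMatrix g e w 0 k) u)
      = (1 / 2) * (partialD n (partialD i fun w => metricMatrix g e w j 0) u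
        + partialD n (partialD j fun w => metricMatrix g e w i 0) u
        - partialD n (partialD 0 fun w => metricMatrix g e w i j) u) := by
    intro n i j
    have h := partialD_congr e.open_target
      (fun v hv => sum_metricMatrix_mul_christoffel g he hv 0 i j) hu n
    rw [partialD_const_mul (((hdm _ _ _).fun_add (hdm _ _ _)).fun_sub (hdm _ _ _)),
      partialD_sub ((hdm _ _ _).fun_add (hdm _ _ _)) (hdm _ _ _),
      partialD_add (hdm _ _ _) (hdm _ _ _)] at h
    rw [← h]
    simp only [Fin.sum_univ_two]
    rw [partialD_add ((hm _ _).fun_mul (hΓ _ _ _)) ((hm _ _).fun_mul (hΓ _ _ _)),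
      partialD_mul (hm _ _) (hΓ _ _ _), partialD_mul (hm _ _) (hΓ _ _ _)]
  have k1 := key 0 1 1
  have k2 := key 1 0 1
  have hcomm := partialD_comm e.open_target (contDiffOn_metricMatrix g he 0 1) hu 1 0
  have c := fun k i j => partialD_metricMatrix g he hu k i j
  unfold riemannCoeff
  simp only [Fin.sum_univ_two, c] at k1 k2 ⊢
  rw [metricMatrix_fun_symm g e 1 0] at k1 k2
  simp only [metricMatrix_symm g e u 1 0, christoffel_symm g e _ 1 0, hcomm] at k1 k2 ⊢
  linear_combination k1 - k2

end

end GaussCurvature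

section DirectionalDerivative

/-! ### Derivatives of functions of two variables -/

/-- The symmetric bilinear form with matrix `(e f; f h)` on the vectors `(a0, a1)` and
`(b0, b1)`. -/
def bil (e f h a0 a1 b0 b1 : ℝ) : ℝ := e * a0 * b0 + f * (a0 * b1 + a1 * b0) + h * a1 * b1

/-- The derivative of `f` in the direction `a`, as a function of the point. -/
def dirD (a : ℝ × ℝ) (f : ℝ × ℝ → ℝ) (p : ℝ × ℝ) : ℝ := fderiv ℝ f p a

section
variable {W : Set (ℝ × ℝ)} {p : ℝ × ℝ}

lemma contDiffOn_dirD (hW : IsOpen W) {f : ℝ × ℝ → ℝ} (hf : ContDiffOn ℝ ∞ f W) (a : ℝ × ℝ) :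
    ContDiffOn ℝ ∞ (dirD a f) W :=
  (hf.fderiv_of_isOpen hW (m := ∞) (by simp)).clm_apply contDiffOn_const

lemma dirD_congr (hW : IsOpen W) {f h : ℝ × ℝ → ℝ} (hfh : EqOn f h W) (hp : p ∈ W) (a : ℝ × ℝ) :
    dirD a f p = dirD a h p := by
  unfold dirD
  rw [Filter.EventuallyEq.fderiv_eq (hfh.eventuallyEq_of_mem (hW.mem_nhds hp))]

lemma dirD_comm (hW : IsOpen W) {f : ℝ × ℝ → ℝ} (hf : ContDiffOn ℝ ∞ f W) (hp : p ∈ W)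
    (a b : ℝ × ℝ) : dirD a (dirD b f) p = dirD b (dirD a f) p :=
  fderiv_fderiv_comm hW hf hp _ _

lemma dirD_add {f h : ℝ × ℝ → ℝ} (hf : DifferentiableAt ℝ f p) (hh : DifferentiableAt ℝ h p)
    (a : ℝ × ℝ) : dirD a (fun q => f q + h q) p = dirD a f p + dirD a h p := by
  unfold dirD
  rw [fderiv_fun_add hf hh]
  simp

lemma dirD_mul {f h : ℝ × ℝ → ℝ} (hf : DifferentiableAt ℝ f p) (hh : DifferentiableAt ℝ h p)
    (a : ℝ × ℝ) : dirD a (fun q => f q * h q) p = dirD a f p * h p + f p * dirD a h p := by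
  unfold dirD
  rw [fderiv_fun_mul hf hh]
  simp; ring

lemma dirD_bil {e f h a0 a1 b0 b1 : ℝ × ℝ → ℝ} (he : DifferentiableAt ℝ e p)
    (hf : DifferentiableAt ℝ f p) (hh : DifferentiableAt ℝ h p)
    (ha0 : DifferentiableAt ℝ a0 p) (ha1 : DifferentiableAt ℝ a1 p)
    (hb0 : DifferentiableAt ℝ b0 p) (hb1 : DifferentiableAt ℝ b1 p) (a : ℝ × ℝ) :
    dirD a (fun q => bil (e q) (f q) (h q) (a0 q) (a1 q) (b0 q) (b1 q)) p
      = bil (dirD a e p) (dirD a f p) (dirD a h p) (a0 p) (a1 p) (b0 p) (b1 p)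
        + bil (e p) (f p) (h p) (dirD a a0 p) (dirD a a1 p) (b0 p) (b1 p)
        + bil (e p) (f p) (h p) (a0 p) (a1 p) (dirD a b0 p) (dirD a b1 p) := by
  unfold bil
  have hab := (ha0.fun_mul hb1).fun_add (ha1.fun_mul hb0)
  rw [dirD_add (((he.fun_mul ha0).fun_mul hb0).fun_add (hf.fun_mul hab))
    ((hh.fun_mul ha1).fun_mul hb1), dirD_add ((he.fun_mul ha0).fun_mul hb0) (hf.fun_mul hab),
    dirD_mul (he.fun_mul ha0) hb0, dirD_mul he ha0, dirD_mul hf hab,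
    dirD_add (ha0.fun_mul hb1) (ha1.fun_mul hb0), dirD_mul ha0 hb1, dirD_mul ha1 hb0,
    dirD_mul (hh.fun_mul ha1) hb1, dirD_mul hh ha1]
  ring

lemma contDiffOn_bil {e f h a0 a1 b0 b1 : ℝ × ℝ → ℝ} (he : ContDiffOn ℝ ∞ e W)
    (hf : ContDiffOn ℝ ∞ f W) (hh : ContDiffOn ℝ ∞ h W)
    (ha0 : ContDiffOn ℝ ∞ a0 W) (ha1 : ContDiffOn ℝ ∞ a1 W)
    (hb0 : ContDiffOn ℝ ∞ b0 W) (hb1 : ContDiffOn ℝ ∞ b1 W) :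
    ContDiffOn ℝ ∞ (fun q => bil (e q) (f q) (h q) (a0 q) (a1 q) (b0 q) (b1 q)) W :=
  (((he.mul ha0).mul hb0).add (hf.mul ((ha0.mul hb1).add (ha1.mul hb0)))).add ((hh.mul ha1).mul hb1)

lemma dirD_dirD_bil (hW : IsOpen W) (hp : p ∈ W) {e f h a0 a1 b0 b1 : ℝ × ℝ → ℝ}
    (he : ContDiffOn ℝ ∞ e W)
    (hf : ContDiffOn ℝ ∞ f W) (hh : ContDiffOn ℝ ∞ h W)
    (ha0 : ContDiffOn ℝ ∞ a0 W) (ha1 : ContDiffOn ℝ ∞ a1 W)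
    (hb0 : ContDiffOn ℝ ∞ b0 W) (hb1 : ContDiffOn ℝ ∞ b1 W) (a b : ℝ × ℝ) :
    dirD b (dirD a (fun q => bil (e q) (f q) (h q) (a0 q) (a1 q) (b0 q) (b1 q))) p
      = bil (dirD b (dirD a e) p) (dirD b (dirD a f) p) (dirD b (dirD a h) p)
          (a0 p) (a1 p) (b0 p) (b1 p)
        + bil (dirD a e p) (dirD a f p) (dirD a h p) (dirD b a0 p) (dirD b a1 p) (b0 p) (b1 p)
        + bil (dirD a e p) (dirD a f p) (dirD a h p) (a0 p) (a1 p) (dirD b b0 p) (dirD b b1 p)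
        + (bil (dirD b e p) (dirD b f p) (dirD b h p) (dirD a a0 p) (dirD a a1 p) (b0 p) (b1 p)
        + bil (e p) (f p) (h p) (dirD b (dirD a a0) p) (dirD b (dirD a a1) p) (b0 p) (b1 p)
        + bil (e p) (f p) (h p) (dirD a a0 p) (dirD a a1 p) (dirD b b0 p) (dirD b b1 p))
        + (bil (dirD b e p) (dirD b f p) (dirD b h p) (a0 p) (a1 p) (dirD a b0 p) (dirD a b1 p)
        + bil (e p) (f p) (h p) (dirD b a0 p) (dirD b a1 p) (dirD a b0 p) (dirD a b1 p)
        + bil (e p) (f p) (h p) (a0 p) (a1 p) (dirD b (dirD a b0) p) (dirD b (dirD a b1) p)) := by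
  have d : ∀ {f : ℝ × ℝ → ℝ}, ContDiffOn ℝ ∞ f W → ∀ {q}, q ∈ W → DifferentiableAt ℝ f q :=
    fun hf _ hq => hf.differentiableAt_of_isOpen hW hq
  have dd : ∀ {f : ℝ × ℝ → ℝ}, ContDiffOn ℝ ∞ f W → ∀ a, ContDiffOn ℝ ∞ (dirD a f) W :=
    fun hf a => contDiffOn_dirD hW hf a
  rw [dirD_congr hW (fun q hq => dirD_bil (d he hq) (d hf hq) (d hh hq) (d ha0 hq) (d ha1 hq)
    (d hb0 hq) (d hb1 hq) a) hp,
    dirD_add (d ((contDiffOn_bil (dd he a) (dd hf a) (dd hh a) ha0 ha1 hb0 hb1).add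
      (contDiffOn_bil he hf hh (dd ha0 a) (dd ha1 a) hb0 hb1)) hp)
      (d (contDiffOn_bil he hf hh ha0 ha1 (dd hb0 a) (dd hb1 a)) hp),
    dirD_add (d (contDiffOn_bil (dd he a) (dd hf a) (dd hh a) ha0 ha1 hb0 hb1) hp)
      (d (contDiffOn_bil he hf hh (dd ha0 a) (dd ha1 a) hb0 hb1) hp),
    dirD_bil (d (dd he a) hp) (d (dd hf a) hp) (d (dd hh a) hp) (d ha0 hp) (d ha1 hp)
      (d hb0 hp) (d hb1 hp),
    dirD_bil (d he hp) (d hf hp) (d hh hp) (d (dd ha0 a) hp) (d (dd ha1 a) hp)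
      (d hb0 hp) (d hb1 hp),
    dirD_bil (d he hp) (d hf hp) (d hh hp) (d ha0 hp) (d ha1 hp)
      (d (dd hb0 a) hp) (d (dd hb1 a) hp)]

variable {y : ℝ × ℝ → Plane} {T : Set Plane} {m : Plane → ℝ}

lemma contDiffOn_coord (hy : ContDiffOn ℝ ∞ y W) (k : Fin 2) : ContDiffOn ℝ ∞ (fun q => y q k) W :=
  (EuclideanSpace.proj (𝕜 := ℝ) k).contDiff.comp_contDiffOn hy

lemma fderiv_coord {V : Type*} [NormedAddCommGroup V] [NormedSpace ℝ V] {y : V → Plane} {p : V}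
    (hy : DifferentiableAt ℝ y p) (a : V) (k : Fin 2) :
    (fderiv ℝ y p a) k = fderiv ℝ (fun q => y q k) p a := by
  have := ((EuclideanSpace.proj (𝕜 := ℝ) k).hasFDerivAt.comp p hy.hasFDerivAt).fderiv
  have h2 := DFunLike.congr_fun this a
  exact h2.symm

lemma dirD_comp (hm : DifferentiableAt ℝ m (y p)) (hy : DifferentiableAt ℝ y p) (a : ℝ × ℝ) :
    dirD a (fun q => m (y q)) p = partialD 0 m (y p) * dirD a (fun q => y q 0) p
      + partialD 1 m (y p) * dirD a (fun q => y q 1) p := by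
  have h1 : fderiv ℝ (fun q => m (y q)) p = (fderiv ℝ m (y p)).comp (fderiv ℝ y p) :=
    fderiv_comp p hm hy
  unfold dirD partialD
  rw [h1, ← fderiv_coord hy, ← fderiv_coord hy]
  have hv : fderiv ℝ y p a = (fderiv ℝ y p a) 0 • (EuclideanSpace.single 0 (1 : ℝ) : Plane)
      + (fderiv ℝ y p a) 1 • (EuclideanSpace.single 1 (1 : ℝ) : Plane) := by
    ext k; fin_cases k <;> simp
  rw [ContinuousLinearMap.comp_apply]
  conv_lhs => rw [hv]
  rw [map_add, map_smul, map_smul, smul_eq_mul, smul_eq_mul]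
  ring

lemma dirD_dirD_comp (hW : IsOpen W) (hT : IsOpen T) (hm : ContDiffOn ℝ ∞ m T)
    (hy : ContDiffOn ℝ ∞ y W) (hyT : MapsTo y W T) (hp : p ∈ W) (a b : ℝ × ℝ) :
    dirD b (dirD a (fun q => m (y q))) p
      = partialD 0 (partialD 0 m) (y p) * dirD a (fun q => y q 0) p * dirD b (fun q => y q 0) p
        + partialD 0 (partialD 1 m) (y p) * (dirD a (fun q => y q 0) p * dirD b (fun q => y q 1) p
          + dirD a (fun q => y q 1) p * dirD b (fun q => y q 0) p)
        + partialD 1 (partialD 1 m) (y p) * dirD a (fun q => y q 1) p * dirD b (fun q => y q 1) p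
        + partialD 0 m (y p) * dirD b (dirD a (fun q => y q 0)) p
        + partialD 1 m (y p) * dirD b (dirD a (fun q => y q 1)) p := by
  have d : ∀ {f : ℝ × ℝ → ℝ}, ContDiffOn ℝ ∞ f W → DifferentiableAt ℝ f p :=
    fun hf => hf.differentiableAt_of_isOpen hW hp
  have hmd : ∀ k, ContDiffOn ℝ ∞ (fun q => partialD k m (y q)) W := fun k =>
    (contDiffOn_partialD hT hm k).comp hy hyT
  have hyd : ∀ k, ContDiffOn ℝ ∞ (dirD a fun q => y q k) W := fun k =>
    contDiffOn_dirD hW (contDiffOn_coord hy k) a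
  have hdd : ∀ k, DifferentiableAt ℝ (partialD k m) (y p) := fun k =>
    (contDiffOn_partialD hT hm k).differentiableAt_of_isOpen hT (hyT hp)
  have hyp := hy.differentiableAt_of_isOpen hW hp
  rw [dirD_congr hW (fun q hq => dirD_comp (hm.differentiableAt_of_isOpen hT (hyT hq))
    (hy.differentiableAt_of_isOpen hW hq) a) hp,
    dirD_add ((d (hmd 0)).fun_mul (d (hyd 0))) ((d (hmd 1)).fun_mul (d (hyd 1))),
    dirD_mul (d (hmd 0)) (d (hyd 0)), dirD_mul (d (hmd 1)) (d (hyd 1)),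
    dirD_comp (hdd 0) hyp, dirD_comp (hdd 1) hyp, partialD_comm hT hm (hyT hp) 1 0]
  ring

lemma hasDerivAt_vertical {f : ℝ × ℝ → ℝ} {r θ : ℝ} (hf : DifferentiableAt ℝ f (r, θ)) :
    HasDerivAt (fun τ => f (r, τ)) (dirD (0, 1) f (r, θ)) θ := by
  have h : HasDerivAt (fun τ : ℝ => (r, τ)) ((0 : ℝ), (1 : ℝ)) θ :=
    (hasDerivAt_const θ r).prodMk (hasDerivAt_id θ)
  exact hf.hasFDerivAt.comp_hasDerivAt θ h

lemma hasDerivAt_horizontal {f : ℝ × ℝ → ℝ} {r θ : ℝ} (hf : DifferentiableAt ℝ f (r, θ)) :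
    HasDerivAt (fun τ => f (τ, θ)) (dirD (1, 0) f (r, θ)) r := by
  have h : HasDerivAt (fun τ : ℝ => (τ, θ)) ((1 : ℝ), (0 : ℝ)) r :=
    (hasDerivAt_id r).prodMk (hasDerivAt_const r θ)
  exact hf.hasFDerivAt.comp_hasDerivAt r h

lemma dirD_eq_zero_of_const (hW : IsOpen W) {f : ℝ × ℝ → ℝ} (hf : ContDiffOn ℝ ∞ f W) {r k : ℝ}
    (hc : ∀ θ, (r, θ) ∈ W → f (r, θ) = k) {θ : ℝ} (hθ : (r, θ) ∈ W) :
    dirD (0, 1) f (r, θ) = 0 := by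
  have h := hasDerivAt_vertical (hf.differentiableAt_of_isOpen hW hθ)
  have h2 : (fun τ => f (r, τ)) =ᶠ[nhds θ] fun _ => k := by
    have : ∀ᶠ τ in nhds θ, (r, τ) ∈ W :=
      (by fun_prop : Continuous fun τ : ℝ => (r, τ)).continuousAt.eventually (hW.mem_nhds hθ)
    filter_upwards [this] with τ hτ using hc τ hτ
  exact h.unique ((hasDerivAt_const θ k).congr_of_eventuallyEq h2)

end

end DirectionalDerivative

section CurvatureEquation

/-! ### The curvature equation for a geodesic with a parallel normal field -/

/-- The pointwise algebra behind `curvature_equation`. The metric coefficients `a, b, c` have first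
and second derivatives `e_k, f_k, h_k` and `e_kl, f_kl, h_kl`, the Christoffel symbols are `G`, and
the family of curves has the derivatives `P = ∂_r`, `Q = ∂_θ`, `S = ∂_r∂_θ`, `T = ∂_θ∂_θ`,
`U = ∂_r∂_r`, `X = ∂_r∂_r∂_θ`, `Y = ∂_r∂_θ∂_θ`. -/
lemma curvature_algebra {k K a b c G000 G001 G011 G100 G101 G111 e0 e1 f0 f1 h0 h1
    e00 e01 e11 f00 f01 f11 h00 h01 h11 P0 P1 Q0 Q1 S0 S1 T0 T1 U0 U1 X0 X1 Y0 Y1 : ℝ}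
    (he0 : e0 = a * G000 + a * G000 + (b * G100 + b * G100))
    (he1 : e1 = a * G001 + a * G001 + (b * G101 + b * G101))
    (hf0 : f0 = a * G001 + b * G000 + (b * G101 + c * G100))
    (hf1 : f1 = a * G011 + b * G001 + (b * G111 + c * G101))
    (hh0 : h0 = b * G001 + b * G001 + (c * G101 + c * G101))
    (hh1 : h1 = b * G011 + b * G011 + (c * G111 + c * G111))
    (hT0 : T0 + (G000 * Q0 * Q0 + G001 * Q0 * Q1 + (G001 * Q1 * Q0 + G011 * Q1 * Q1)) = 0)
    (hT1 : T1 + (G100 * Q0 * Q0 + G101 * Q0 * Q1 + (G101 * Q1 * Q0 + G111 * Q1 * Q1)) = 0)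
    (hA : bil a b c P0 P1 P0 P1 = 1) (hB : bil a b c P0 P1 Q0 Q1 = 0)
    (hC : bil a b c Q0 Q1 Q0 Q1 = 1)
    (hAθ : bil (e0 * Q0 + e1 * Q1) (f0 * Q0 + f1 * Q1) (h0 * Q0 + h1 * Q1) P0 P1 P0 P1
      + bil a b c S0 S1 P0 P1 + bil a b c P0 P1 S0 S1 = 0)
    (hBθ : bil (e0 * Q0 + e1 * Q1) (f0 * Q0 + f1 * Q1) (h0 * Q0 + h1 * Q1) P0 P1 Q0 Q1
      + bil a b c S0 S1 Q0 Q1 + bil a b c P0 P1 T0 T1 = 0)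
    (hAθθ : bil (e00 * Q0 * Q0 + e01 * (Q0 * Q1 + Q1 * Q0) + e11 * Q1 * Q1 + e0 * T0 + e1 * T1)
        (f00 * Q0 * Q0 + f01 * (Q0 * Q1 + Q1 * Q0) + f11 * Q1 * Q1 + f0 * T0 + f1 * T1)
        (h00 * Q0 * Q0 + h01 * (Q0 * Q1 + Q1 * Q0) + h11 * Q1 * Q1 + h0 * T0 + h1 * T1) P0 P1 P0 P1
      + bil (e0 * Q0 + e1 * Q1) (f0 * Q0 + f1 * Q1) (h0 * Q0 + h1 * Q1) S0 S1 P0 P1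
      + bil (e0 * Q0 + e1 * Q1) (f0 * Q0 + f1 * Q1) (h0 * Q0 + h1 * Q1) P0 P1 S0 S1
      + (bil (e0 * Q0 + e1 * Q1) (f0 * Q0 + f1 * Q1) (h0 * Q0 + h1 * Q1) S0 S1 P0 P1
        + bil a b c Y0 Y1 P0 P1 + bil a b c S0 S1 S0 S1)
      + (bil (e0 * Q0 + e1 * Q1) (f0 * Q0 + f1 * Q1) (h0 * Q0 + h1 * Q1) P0 P1 S0 S1
        + bil a b c S0 S1 S0 S1 + bil a b c P0 P1 Y0 Y1) = 0)
    (hK : K * (a * c - b * b) = f01 - 1 / 2 * h00 - 1 / 2 * e11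
      + (a * (G001 * G001 - G000 * G011) + b * (G001 * G101 - G000 * G111)
        + (b * (G101 * G001 - G100 * G011) + c * (G101 * G101 - G100 * G111))))
    (hk : k ≤ K) :
    bil (e0 * P0 + e1 * P1) (f0 * P0 + f1 * P1) (h0 * P0 + h1 * P1) Q0 Q1 Q0 Q1
      + bil a b c S0 S1 Q0 Q1 + bil a b c Q0 Q1 S0 S1 = 0 ∧
    (bil (e00 * P0 * P0 + e01 * (P0 * P1 + P1 * P0) + e11 * P1 * P1 + e0 * U0 + e1 * U1)
        (f00 * P0 * P0 + f01 * (P0 * P1 + P1 * P0) + f11 * P1 * P1 + f0 * U0 + f1 * U1)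
        (h00 * P0 * P0 + h01 * (P0 * P1 + P1 * P0) + h11 * P1 * P1 + h0 * U0 + h1 * U1) Q0 Q1 Q0 Q1
      + bil (e0 * P0 + e1 * P1) (f0 * P0 + f1 * P1) (h0 * P0 + h1 * P1) S0 S1 Q0 Q1
      + bil (e0 * P0 + e1 * P1) (f0 * P0 + f1 * P1) (h0 * P0 + h1 * P1) Q0 Q1 S0 S1
      + (bil (e0 * P0 + e1 * P1) (f0 * P0 + f1 * P1) (h0 * P0 + h1 * P1) S0 S1 Q0 Q1
        + bil a b c X0 X1 Q0 Q1 + bil a b c S0 S1 S0 S1)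
      + (bil (e0 * P0 + e1 * P1) (f0 * P0 + f1 * P1) (h0 * P0 + h1 * P1) Q0 Q1 S0 S1
        + bil a b c S0 S1 S0 S1 + bil a b c Q0 Q1 X0 X1)) / 2
      ≤ -k + (bil (e00 * P0 * Q0 + e01 * (P0 * Q1 + P1 * Q0) + e11 * P1 * Q1 + e0 * S0 + e1 * S1)
        (f00 * P0 * Q0 + f01 * (P0 * Q1 + P1 * Q0) + f11 * P1 * Q1 + f0 * S0 + f1 * S1)
        (h00 * P0 * Q0 + h01 * (P0 * Q1 + P1 * Q0) + h11 * P1 * Q1 + h0 * S0 + h1 * S1) P0 P1 Q0 Q1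
      + bil (e0 * P0 + e1 * P1) (f0 * P0 + f1 * P1) (h0 * P0 + h1 * P1) S0 S1 Q0 Q1
      + bil (e0 * P0 + e1 * P1) (f0 * P0 + f1 * P1) (h0 * P0 + h1 * P1) P0 P1 T0 T1
      + (bil (e0 * Q0 + e1 * Q1) (f0 * Q0 + f1 * Q1) (h0 * Q0 + h1 * Q1) U0 U1 Q0 Q1
        + bil a b c X0 X1 Q0 Q1 + bil a b c U0 U1 T0 T1)
      + (bil (e0 * Q0 + e1 * Q1) (f0 * Q0 + f1 * Q1) (h0 * Q0 + h1 * Q1) P0 P1 S0 S1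
        + bil a b c S0 S1 S0 S1 + bil a b c P0 P1 Y0 Y1)) := by
  subst he0 he1 hf0 hf1 hh0 hh1
  -- `Q` is parallel along the geodesic, so the length element is stationary
  have hCr : bil ((a * G000 + a * G000 + (b * G100 + b * G100)) * P0
        + (a * G001 + a * G001 + (b * G101 + b * G101)) * P1)
      ((a * G001 + b * G000 + (b * G101 + c * G100)) * P0
        + (a * G011 + b * G001 + (b * G111 + c * G101)) * P1)
      ((b * G001 + b * G001 + (c * G101 + c * G101)) * P0
        + (b * G011 + b * G011 + (c * G111 + c * G111)) * P1) Q0 Q1 Q0 Q1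
      + bil a b c S0 S1 Q0 Q1 + bil a b c Q0 Q1 S0 S1 = 0 := by
    unfold bil at *
    linear_combination 2 * hBθ - 2 * (a * P0 + b * P1) * hT0 - 2 * (b * P0 + c * P1) * hT1
  refine ⟨hCr, ?_⟩
  -- `P` and `Q` are an orthonormal frame
  have hD : (a * c - b ^ 2) * (P0 * Q1 - P1 * Q0) ^ 2 = 1 := by
    unfold bil at hA hB hC
    linear_combination (a * Q0 * Q0 + b * (Q0 * Q1 + Q1 * Q0) + c * Q1 * Q1) * hA + hC
      - (a * P0 * Q0 + b * (P0 * Q1 + P1 * Q0) + c * P1 * Q1) * hB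
  -- the covariant derivative `Z = ∇_θ P` is orthogonal to both `P` and `Q`, hence vanishes
  obtain ⟨Z0, hZ0⟩ : ∃ Z0,
      Z0 = S0 + (G000 * P0 * Q0 + G001 * (P0 * Q1 + P1 * Q0) + G011 * P1 * Q1) := ⟨_, rfl⟩
  obtain ⟨Z1, hZ1⟩ : ∃ Z1,
      Z1 = S1 + (G100 * P0 * Q0 + G101 * (P0 * Q1 + P1 * Q0) + G111 * P1 * Q1) := ⟨_, rfl⟩
  obtain rfl : S0 = Z0 - (G000 * P0 * Q0 + G001 * (P0 * Q1 + P1 * Q0) + G011 * P1 * Q1) := by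
    linarith
  obtain rfl : S1 = Z1 - (G100 * P0 * Q0 + G101 * (P0 * Q1 + P1 * Q0) + G111 * P1 * Q1) := by
    linarith
  have z1 : (a * Z0 + b * Z1) * Q0 + (b * Z0 + c * Z1) * Q1 = 0 := by
    unfold bil at hCr
    linear_combination hCr / 2
  have z2 : (a * Z0 + b * Z1) * P0 + (b * Z0 + c * Z1) * P1 = 0 := by
    unfold bil at hAθ
    linear_combination hAθ / 2
  obtain rfl : Z0 = 0 := by
    linear_combination -Z0 * hD
      + (P0 * Q1 - P1 * Q0) * (c * (Q1 * z2 - P1 * z1) - b * (P0 * z1 - Q0 * z2))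
  obtain rfl : Z1 = 0 := by
    linear_combination -Z1 * hD
      + (P0 * Q1 - P1 * Q0) * (a * (P0 * z1 - Q0 * z2) - b * (Q1 * z2 - P1 * z1))
  obtain rfl : T0 = -(G000 * Q0 * Q0 + 2 * G001 * Q0 * Q1 + G011 * Q1 * Q1) := by linarith
  obtain rfl : T1 = -(G100 * Q0 * Q0 + 2 * G101 * Q0 * Q1 + G111 * Q1 * Q1) := by linarith
  clear hCr hBθ hA hB hC hAθ z1 z2 hT0 hT1 hZ0 hZ1
  -- the Gauss equation, in which the terms of `Y` are eliminated by means of `∂_θ² A = 0`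
  refine le_of_eq_of_le ?_ (add_le_add_left (neg_le_neg hk) _)
  unfold bil at *
  linear_combination -K * hD + (P0 * Q1 - P1 * Q0) ^ 2 * hK - hAθθ / 2

/-- The coefficient `⟨∂_a E, ∂_b E⟩` of the metric pulled back by `E`. -/
def pullback (g : SurfaceMetric M) (E : ℝ × ℝ → M) (a b p : ℝ × ℝ) : ℝ :=
  metricAt g (E p) (mfderiv 𝓘(ℝ, ℝ × ℝ) 𝓘(ℝ, Plane) E p a) (mfderiv 𝓘(ℝ, ℝ × ℝ) 𝓘(ℝ, Plane) E p b)

section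

variable {g : SurfaceMetric M} {E : ℝ × ℝ → M} {Ω : Set (ℝ × ℝ)}
  {e : OpenPartialHomeomorph M Plane}

omit [IsManifold 𝓘(ℝ, Plane) ∞ M] in
lemma isOpen_inter_preimage_source (hΩ : IsOpen Ω)
    (hE : ContMDiffOn 𝓘(ℝ, ℝ × ℝ) 𝓘(ℝ, Plane) ∞ E Ω) : IsOpen (Ω ∩ E ⁻¹' e.source) :=
  hE.continuousOn.isOpen_inter_preimage hΩ e.open_source

lemma contDiffOn_chart_comp (he : e ∈ atlas Plane M)
    (hE : ContMDiffOn 𝓘(ℝ, ℝ × ℝ) 𝓘(ℝ, Plane) ∞ E Ω) :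
    ContDiffOn ℝ ∞ (fun q => e (E q)) (Ω ∩ E ⁻¹' e.source) := by
  rw [← contMDiffOn_iff_contDiffOn]
  exact (contMDiffOn_of_mem_maximalAtlas (IsManifold.subset_maximalAtlas he)).comp
    (hE.mono inter_subset_left) (fun q hq => hq.2)

lemma pullback_eq_bil (hΩ : IsOpen Ω) (he : e ∈ atlas Plane M)
    (hE : ContMDiffOn 𝓘(ℝ, ℝ × ℝ) 𝓘(ℝ, Plane) ∞ E Ω) (a b : ℝ × ℝ) {p : ℝ × ℝ}
    (hp : p ∈ Ω ∩ E ⁻¹' e.source) :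
    pullback g E a b p = bil (metricMatrix g e (e (E p)) 0 0) (metricMatrix g e (e (E p)) 0 1)
      (metricMatrix g e (e (E p)) 1 1) (dirD a (fun q => e (E q) 0) p)
      (dirD a (fun q => e (E q) 1) p) (dirD b (fun q => e (E q) 0) p)
      (dirD b (fun q => e (E q) 1) p) := by
  have h1 : MDifferentiableAt 𝓘(ℝ, ℝ × ℝ) 𝓘(ℝ, Plane) E p :=
    ((hE p hp.1).contMDiffAt (hΩ.mem_nhds hp.1)).mdifferentiableAt (by simp)
  have h2 := (contDiffOn_chart_comp he hE).differentiableAt_of_isOpen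
    (isOpen_inter_preimage_source hΩ hE) hp
  rw [pullback, metricAt_mfderiv g he h1 hp.2]
  simp only [Fin.sum_univ_two, fderiv_coord h2, metricMatrix_symm g e _ 1 0]
  unfold bil dirD
  ring

lemma contDiffOn_metricMatrix_comp (he : e ∈ atlas Plane M)
    (hE : ContMDiffOn 𝓘(ℝ, ℝ × ℝ) 𝓘(ℝ, Plane) ∞ E Ω) (i j : Fin 2) :
    ContDiffOn ℝ ∞ (fun q => metricMatrix g e (e (E q)) i j) (Ω ∩ E ⁻¹' e.source) :=
  (contDiffOn_metricMatrix g he i j).comp (contDiffOn_chart_comp he hE)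
    (fun _ hq => e.map_source hq.2)

lemma contDiffOn_dirD_chart (hΩ : IsOpen Ω) (he : e ∈ atlas Plane M)
    (hE : ContMDiffOn 𝓘(ℝ, ℝ × ℝ) 𝓘(ℝ, Plane) ∞ E Ω) (a : ℝ × ℝ) (k : Fin 2) :
    ContDiffOn ℝ ∞ (dirD a fun q => e (E q) k) (Ω ∩ E ⁻¹' e.source) :=
  contDiffOn_dirD (isOpen_inter_preimage_source hΩ hE)
    (contDiffOn_coord (contDiffOn_chart_comp he hE) k) a

lemma contDiffOn_pullback (hΩ : IsOpen Ω) (hE : ContMDiffOn 𝓘(ℝ, ℝ × ℝ) 𝓘(ℝ, Plane) ∞ E Ω)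
    (a b : ℝ × ℝ) : ContDiffOn ℝ ∞ (pullback g E a b) Ω := by
  intro p hp
  have he := chart_mem_atlas Plane (E p)
  set e := chartAt Plane (E p)
  have hpW : p ∈ Ω ∩ E ⁻¹' e.source := ⟨hp, mem_chart_source Plane (E p)⟩
  have hW : IsOpen (Ω ∩ E ⁻¹' e.source) := isOpen_inter_preimage_source hΩ hE
  have h : ContDiffOn ℝ ∞ (pullback g E a b) (Ω ∩ E ⁻¹' e.source) :=
    (contDiffOn_bil (contDiffOn_metricMatrix_comp he hE 0 0)
      (contDiffOn_metricMatrix_comp he hE 0 1) (contDiffOn_metricMatrix_comp he hE 1 1)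
      (contDiffOn_dirD_chart hΩ he hE a 0) (contDiffOn_dirD_chart hΩ he hE a 1)
      (contDiffOn_dirD_chart hΩ he hE b 0) (contDiffOn_dirD_chart hΩ he hE b 1)).congr
      fun q hq => pullback_eq_bil hΩ he hE a b hq
  exact (h.contDiffAt (hW.mem_nhds hpW)).contDiffWithinAt

/-- Let `E` be a family of curves `E (r, ·)` such that `E (0, ·)` is a geodesic of unit speed and
`∂_r E (0, ·)` is a unit normal field. Then `C = ⟨∂_θ E, ∂_θ E⟩` is stationary at `r = 0`, and
`½ ∂_r² C = -K + ∂_θ ∂_r B` there, with `B = ⟨∂_r E, ∂_θ E⟩`. The last term is the derivative along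
the geodesic of the tangential part of `∇_r ∂_r E`. -/
lemma curvature_equation {k : ℝ} (hK : GaussCurvatureGE g k) (hΩ : IsOpen Ω)
    (hE : ContMDiffOn 𝓘(ℝ, ℝ × ℝ) 𝓘(ℝ, Plane) ∞ E Ω)
    (hgeo : ∀ e ∈ atlas Plane M, ∀ θ, (0, θ) ∈ Ω → E (0, θ) ∈ e.source →
      ∀ k, covAccel g e (fun θ => E (0, θ)) k θ = 0)
    (hA : ∀ θ, (0, θ) ∈ Ω → pullback g E (1, 0) (1, 0) (0, θ) = 1)
    (hB : ∀ θ, (0, θ) ∈ Ω → pullback g E (1, 0) (0, 1) (0, θ) = 0)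
    (hC : ∀ θ, (0, θ) ∈ Ω → pullback g E (0, 1) (0, 1) (0, θ) = 1) {θ : ℝ} (hθ : (0, θ) ∈ Ω) :
    dirD (1, 0) (pullback g E (0, 1) (0, 1)) (0, θ) = 0 ∧
    dirD (1, 0) (dirD (1, 0) (pullback g E (0, 1) (0, 1))) (0, θ) / 2
      ≤ -k + dirD (0, 1) (dirD (1, 0) (pullback g E (1, 0) (0, 1))) (0, θ) := by
  have he := chart_mem_atlas Plane (E (0, θ))
  set e := chartAt Plane (E (0, θ))
  set W := Ω ∩ E ⁻¹' e.source with hWdef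
  have hp : ((0 : ℝ), θ) ∈ W := ⟨hθ, mem_chart_source Plane (E (0, θ))⟩
  have hW : IsOpen W := isOpen_inter_preimage_source hΩ hE
  set p : ℝ × ℝ := (0, θ) with hpdef
  have hy : ContDiffOn ℝ ∞ (fun q => e (E q)) W := contDiffOn_chart_comp he hE
  have hyT : MapsTo (fun q => e (E q)) W e.target := fun q hq => e.map_source hq.2
  set y : ℝ × ℝ → Plane := fun q => e (E q) with hydef
  have hu : y p ∈ e.target := hyT hp
  have hm : ∀ i j, ContDiffOn ℝ ∞ (fun q => metricMatrix g e (y q) i j) W := fun i j =>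
    contDiffOn_metricMatrix_comp he hE i j
  have hyk : ∀ k, ContDiffOn ℝ ∞ (fun q => y q k) W := contDiffOn_coord hy
  have hyd : ∀ a k, ContDiffOn ℝ ∞ (dirD a fun q => y q k) W := fun a k =>
    contDiffOn_dirD hW (hyk k) a
  have d : ∀ {f : ℝ × ℝ → ℝ}, ContDiffOn ℝ ∞ f W → DifferentiableAt ℝ f p :=
    fun hf => hf.differentiableAt_of_isOpen hW hp
  have hΩW : W ⊆ Ω := inter_subset_left
  have hpb : ∀ a b, ContDiffOn ℝ ∞ (pullback g E a b) W := fun a b =>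
    (contDiffOn_pullback hΩ hE a b).mono hΩW
  have hchart : ∀ a b, EqOn (pullback g E a b) (fun q => bil (metricMatrix g e (y q) 0 0)
      (metricMatrix g e (y q) 0 1) (metricMatrix g e (y q) 1 1) (dirD a (fun q => y q 0) q)
      (dirD a (fun q => y q 1) q) (dirD b (fun q => y q 0) q) (dirD b (fun q => y q 1) q)) W :=
    fun a b q hq => pullback_eq_bil hΩ he hE a b hq
  -- first and second derivatives of the coefficients
  have D1 : ∀ a b c, dirD c (pullback g E a b) p = _ := fun a b c =>
    (dirD_congr hW (hchart a b) hp c).trans (dirD_bil (d (hm 0 0)) (d (hm 0 1)) (d (hm 1 1))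
      (d (hyd a 0)) (d (hyd a 1)) (d (hyd b 0)) (d (hyd b 1)) c)
  have D2 : ∀ a b c c', dirD c' (dirD c (pullback g E a b)) p = _ := fun a b c c' =>
    (dirD_congr hW (fun q hq => dirD_congr hW (hchart a b) hq c) hp c').trans
      (dirD_dirD_bil hW hp (hm 0 0) (hm 0 1) (hm 1 1)
      (hyd a 0) (hyd a 1) (hyd b 0) (hyd b 1) c c')
  have M1 : ∀ i j c, dirD c (fun q => metricMatrix g e (y q) i j) p = _ := fun i j c =>
    dirD_comp (m := fun u => metricMatrix g e u i j)
      ((contDiffOn_metricMatrix g he i j).differentiableAt_of_isOpen e.open_target hu)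
      (hy.differentiableAt_of_isOpen hW hp) c
  have M2 : ∀ i j c c', dirD c' (dirD c (fun q => metricMatrix g e (y q) i j)) p = _ :=
    fun i j c c' => dirD_dirD_comp hW e.open_target (contDiffOn_metricMatrix g he i j) hy
      hyT hp c c'
  -- mixed derivatives of the coordinates
  have S1 : ∀ k, EqOn (dirD (0, 1) (dirD (1, 0) fun q => y q k))
      (dirD (1, 0) (dirD (0, 1) fun q => y q k)) W := fun k q hq => dirD_comm hW (hyk k) hq _ _
  have S2 : ∀ k, dirD (0, 1) (dirD (1, 0) (dirD (1, 0) fun q => y q k)) p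
      = dirD (1, 0) (dirD (1, 0) (dirD (0, 1) fun q => y q k)) p := fun k =>
    (dirD_comm hW (hyd _ k) hp _ _).trans (dirD_congr hW (S1 k) hp _)
  have S3 : ∀ k, dirD (0, 1) (dirD (0, 1) (dirD (1, 0) fun q => y q k)) p
      = dirD (0, 1) (dirD (1, 0) (dirD (0, 1) fun q => y q k)) p := fun k =>
    dirD_congr hW (S1 k) hp _
  -- the relations along the geodesic
  have hAθ : ∀ θ', (0, θ') ∈ W → dirD (0, 1) (pullback g E (1, 0) (1, 0)) (0, θ') = 0 :=
    fun θ' h => dirD_eq_zero_of_const hW (hpb _ _) (fun τ hτ => hA τ (hΩW hτ)) h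
  have hAθθ : dirD (0, 1) (dirD (0, 1) (pullback g E (1, 0) (1, 0))) p = 0 :=
    dirD_eq_zero_of_const hW (contDiffOn_dirD hW (hpb _ _) _) (fun τ hτ => hAθ τ hτ) hp
  have hBθ : dirD (0, 1) (pullback g E (1, 0) (0, 1)) p = 0 :=
    dirD_eq_zero_of_const hW (hpb _ _) (fun τ hτ => hB τ (hΩW hτ)) hp
  have hgeo' : ∀ k, dirD (0, 1) (dirD (0, 1) fun q => y q k) p
      + ∑ i, ∑ j, christoffel g e k i j (y p) * dirD (0, 1) (fun q => y q i) p
        * dirD (0, 1) (fun q => y q j) p = 0 := by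
    intro k
    have h := hgeo e he θ hθ hp.2 k
    have h1 : ∀ i τ, (0, τ) ∈ W → deriv (fun τ => e (E (0, τ)) i) τ
        = dirD (0, 1) (fun q => y q i) (0, τ) := fun i τ hτ =>
      (hasDerivAt_vertical ((hyk i).differentiableAt_of_isOpen hW hτ)).deriv
    have h2 : deriv (deriv fun τ => e (E (0, τ)) k) θ
        = dirD (0, 1) (dirD (0, 1) fun q => y q k) p := by
      rw [← (hasDerivAt_vertical (d (hyd _ k))).deriv]
      apply Filter.EventuallyEq.deriv_eq
      have : ∀ᶠ τ in nhds θ, ((0 : ℝ), τ) ∈ W :=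
        (by fun_prop : Continuous fun τ : ℝ => ((0 : ℝ), τ)).continuousAt.eventually
          (hW.mem_nhds hp)
      filter_upwards [this] with τ hτ using h1 k τ hτ
    rw [covAccel, h2] at h
    simp only [h1 _ θ hp] at h
    exact h
  have G0 := hgeo' 0
  have G1 := hgeo' 1
  have hA' := hA θ hθ
  have hB' := hB θ hθ
  have hC' := hC θ hθ
  rw [hchart _ _ hp] at hA' hB' hC'
  dsimp only at hA' hB' hC'
  have hAθ' := hAθ θ hp
  have hKx := hK e he (E p) hp.2
  have hgd := gaussCurvature_mul_det g he hp.2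
  have c := fun k i j => partialD_metricMatrix g he hu k i j
  rw [D1] at hAθ' hBθ
  rw [D2] at hAθθ
  rw [D1, D2, D2]
  simp only [M1, M2, S2, S3, S1 _ hp] at hAθ' hBθ hAθθ ⊢
  simp only [Fin.sum_univ_two, christoffel_symm g e _ 1 0, Matrix.det_fin_two,
    metricMatrix_symm g e _ 1 0] at G0 G1 c hgd
  have he0 := c 0 0 0
  have he1 := c 1 0 0
  have hf0 := c 0 0 1
  have hf1 := c 1 0 1
  have hh0 := c 0 1 1
  have hh1 := c 1 1 1
  simp only [christoffel_symm g e _ 1 0, metricMatrix_symm g e _ 1 0] at he0 he1 hf0 hf1 hh0 hh1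
  have hyp : e (E p) = y p := rfl
  rw [hyp] at hgd
  exact curvature_algebra he0 he1 hf0 hf1 hh0 hh1 G0 G1 hA' hB' hC' hAθ' hBθ hAθθ hgd hKx

end

end CurvatureEquation

section Families

/-! ### Families of curves with prescribed initial velocity -/

/-- The strip `(-r, r) × ℝ`. -/
def strip (r : ℝ) : Set (ℝ × ℝ) := Ioo (-r) r ×ˢ univ

lemma isOpen_strip (r : ℝ) : IsOpen (strip r) := isOpen_Ioo.prod isOpen_univ

lemma mem_strip {r : ℝ} {p : ℝ × ℝ} : p ∈ strip r ↔ p.1 ∈ Ioo (-r) r := by simp [strip]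

lemma zero_mem_strip {r : ℝ} (hr : 0 < r) (θ : ℝ) : (0, θ) ∈ strip r :=
  mem_strip.2 ⟨by simpa using hr, hr⟩

lemma strip_mono {r s : ℝ} (h : r ≤ s) : strip r ⊆ strip s := fun p hp => by
  rw [mem_strip] at *
  exact ⟨by linarith [hp.1], by linarith [hp.2]⟩

/-- A neighbourhood of `{0} × Z`, with `Z` compact, contains `(-r, r) × Z` for some `r > 0`. -/
lemma exists_Ioo_prod_subset {X : Type*} [TopologicalSpace X] {O : Set (ℝ × X)} (hO : IsOpen O)
    {Z : Set X} (hZ : IsCompact Z) (h : ∀ x ∈ Z, (0, x) ∈ O) :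
    ∃ r > 0, Ioo (-r) r ×ˢ Z ⊆ O := by
  obtain ⟨u, v, hu, -, h0, hv, huv⟩ := generalized_tube_lemma (isCompact_singleton (x := (0 : ℝ)))
    hZ hO (by rintro ⟨r, x⟩ ⟨hr, hx⟩; obtain rfl : r = 0 := hr; exact h x hx)
  obtain ⟨r, hr, hru⟩ := Metric.isOpen_iff.1 hu 0 (h0 rfl)
  refine ⟨r, hr, fun p hp => huv ⟨hru ?_, hv hp.2⟩⟩
  rw [Real.ball_eq_Ioo]
  simpa using hp.1

/-- `E` is a smooth family `E (r, ·)`, `|r| < r₀`, of closed curves of period `L` that starts at the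
curve `c` with the velocity `∂_r E (0, ·) = σ ν`. -/
structure IsFamily (c : ℝ → M) (L : ℝ) (ν : ℝ → Plane) (σ : ℝ → ℝ) (E : ℝ × ℝ → M) (r₀ : ℝ) :
    Prop where
  pos : 0 < r₀
  smooth : ContMDiffOn 𝓘(ℝ, ℝ × ℝ) 𝓘(ℝ, Plane) ∞ E (strip r₀)
  periodic : ∀ r ∈ Ioo (-r₀) r₀, Function.Periodic (fun θ => E (r, θ)) L
  zero : ∀ θ, E (0, θ) = c θ
  velocity : ∀ θ, (mfderiv 𝓘(ℝ, ℝ) 𝓘(ℝ, Plane) (fun r => E (r, θ)) 0 (1 : ℝ) : Plane) = σ θ • ν θ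

variable {c : ℝ → M} {L : ℝ} {ν : ℝ → Plane} {σ : ℝ → ℝ} {E : ℝ × ℝ → M} {r₀ : ℝ}

omit [IsManifold 𝓘(ℝ, Plane) ∞ M] in
lemma isFamily_const (hc : ContMDiff 𝓘(ℝ, ℝ) 𝓘(ℝ, Plane) ∞ c) (hper : Function.Periodic c L) :
    IsFamily c L ν (fun _ => 0) (fun p => c p.2) 1 where
  pos := one_pos
  smooth := (hc.comp (contDiff_snd.contMDiff)).contMDiffOn
  periodic _ _ := hper
  zero _ := rfl
  velocity θ := by
    simp only [mfderiv_const, zero_smul]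
    rfl

/-- The coordinates in the chart `e` of the vector field `ν` along `c`. -/
def chartVec (e : OpenPartialHomeomorph M Plane) (c : ℝ → M) (ν : ℝ → Plane) (θ : ℝ) : Plane :=
  mfderiv 𝓘(ℝ, Plane) 𝓘(ℝ, Plane) e (c θ) (ν θ)

lemma contDiffOn_chartVec {e : OpenPartialHomeomorph M Plane} (he : e ∈ atlas Plane M)
    (hν : ContMDiff 𝓘(ℝ, ℝ) 𝓘(ℝ, Plane).tangent ∞
      (fun θ => (⟨c θ, ν θ⟩ : TangentBundle 𝓘(ℝ, Plane) M))) :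
    ContDiffOn ℝ ∞ (chartVec e c ν) (c ⁻¹' e.source) := by
  have h1 : ContMDiffOn 𝓘(ℝ, Plane) 𝓘(ℝ, Plane) ∞ e e.source :=
    contMDiffOn_of_mem_maximalAtlas (IsManifold.subset_maximalAtlas he)
  have h2 := h1.contMDiffOn_tangentMapWithin (m := ∞) (by simp) e.open_source.uniqueMDiffOn
  have h3 := (contMDiff_snd_tangentBundle_modelSpace Plane 𝓘(ℝ, Plane) (n := ∞)).comp_contMDiffOn
    (h2.comp hν.contMDiffOn (s := c ⁻¹' e.source) (fun θ hθ => hθ))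
  rw [← contMDiffOn_iff_contDiffOn]
  refine h3.congr fun θ hθ => ?_
  simp only [Function.comp, tangentMapWithin]
  rw [mfderivWithin_of_isOpen e.open_source hθ]
  rfl

omit [IsManifold 𝓘(ℝ, Plane) ∞ M] in
lemma periodic_chartVec (e : OpenPartialHomeomorph M Plane)
    (hν : ∀ θ, (⟨c (θ + L), ν (θ + L)⟩ : TangentBundle 𝓘(ℝ, Plane) M) = ⟨c θ, ν θ⟩) :
    Function.Periodic (chartVec e c ν) L := fun θ =>
  congrArg (fun z : TangentBundle 𝓘(ℝ, Plane) M =>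
    (mfderiv 𝓘(ℝ, Plane) 𝓘(ℝ, Plane) e z.1 z.2 : Plane)) (hν θ)

open Classical in
/-- Moving a family of curves inside a chart: the initial velocity changes by `h ν` if the function
`h` is supported where the curve `c` runs through the chart. -/
lemma IsFamily.exists_add (hL : 0 < L) (hE : IsFamily c L ν σ E r₀)
    (hc : ContMDiff 𝓘(ℝ, ℝ) 𝓘(ℝ, Plane) ∞ c)
    (hν : ContMDiff 𝓘(ℝ, ℝ) 𝓘(ℝ, Plane).tangent ∞
      (fun θ => (⟨c θ, ν θ⟩ : TangentBundle 𝓘(ℝ, Plane) M)))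
    (hνp : ∀ θ, (⟨c (θ + L), ν (θ + L)⟩ : TangentBundle 𝓘(ℝ, Plane) M) = ⟨c θ, ν θ⟩)
    {e : OpenPartialHomeomorph M Plane} (he : e ∈ atlas Plane M) {h : ℝ → ℝ}
    (hh : ContDiff ℝ ∞ h) (hhp : Function.Periodic h L) {Z Z' : Set ℝ} (hZ : IsClosed Z)
    (hZ' : IsClosed Z') (hZp : Function.Periodic (· ∈ Z') L) (hZZ' : Z ⊆ interior Z')
    (hZ0 : ∀ θ, θ ∉ Z → h θ = 0) (hZe : ∀ θ ∈ Z', c θ ∈ e.source) :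
    ∃ E' r', IsFamily c L ν (fun θ => σ θ + h θ) E' r' := by
  set w := chartVec e c ν with hw
  have hwp : Function.Periodic w L := periodic_chartVec e hνp
  have hws : ContDiffOn ℝ ∞ w (c ⁻¹' e.source) := contDiffOn_chartVec he hν
  -- the points where the move makes sense
  set Ω' := (strip r₀ ∩ E ⁻¹' e.source) ∩ Prod.snd ⁻¹' (c ⁻¹' e.source) with hΩ'
  have hΩ'o : IsOpen Ω' := (isOpen_inter_preimage_source (isOpen_strip r₀) hE.smooth).inter
    ((e.open_source.preimage hc.continuous).preimage continuous_snd)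
  set φ : ℝ × ℝ → Plane := fun p => e (E p) + (p.1 * h p.2) • w p.2 with hφ
  have hφs : ContDiffOn ℝ ∞ φ Ω' := by
    refine ((contDiffOn_chart_comp he hE.smooth).mono inter_subset_left).add
      (ContDiffOn.fun_smul ?_ ?_)
    · exact (contDiff_fst.mul (hh.comp contDiff_snd)).contDiffOn
    · exact hws.comp contDiff_snd.contDiffOn (fun p hp => hp.2)
  have hO : IsOpen (Ω' ∩ φ ⁻¹' e.target) :=
    hφs.continuousOn.isOpen_inter_preimage hΩ'o e.open_target
  have h0mem : ∀ θ ∈ Z', (0, θ) ∈ Ω' ∩ φ ⁻¹' e.target := by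
    intro θ hθ
    have : E (0, θ) ∈ e.source := by rw [hE.zero]; exact hZe θ hθ
    refine ⟨⟨⟨zero_mem_strip hE.pos θ, this⟩, hZe θ hθ⟩, ?_⟩
    simp only [hφ, mem_preimage, zero_mul, zero_smul, add_zero]
    exact e.map_source this
  obtain ⟨r₁, hr₁, hsub⟩ := exists_Ioo_prod_subset hO
    (isCompact_Icc.inter_left hZ' : IsCompact (Z' ∩ Icc 0 L)) (fun θ hθ => h0mem θ hθ.1)
  set r' := min r₀ r₁ with hr'
  have hr'0 : strip r' ⊆ strip r₀ := strip_mono (min_le_left _ _)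
  have hr'1 : strip r' ⊆ strip r₁ := strip_mono (min_le_right _ _)
  have hφp : ∀ r ∈ Ioo (-r₀) r₀, Function.Periodic (fun θ => φ (r, θ)) L := by
    intro r hr θ
    have h1 : E (r, θ + L) = E (r, θ) := hE.periodic r hr θ
    simp only [hφ, h1, hhp θ, hwp θ]
  have hmem : ∀ p ∈ strip r', p.2 ∈ Z' → E p ∈ e.source ∧ c p.2 ∈ e.source ∧ φ p ∈ e.target := by
    rintro ⟨r, θ⟩ hp hpZ
    have hr := mem_strip.1 (hr'0 hp)
    have hper : Function.Periodic (fun θ => (θ ∈ Z', E (r, θ), φ (r, θ))) L := fun θ =>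
      Prod.ext (hZp θ) (Prod.ext (hE.periodic r hr θ) (hφp r hr θ))
    obtain ⟨θ', hθ', heq⟩ := hper.exists_mem_Ico₀ hL θ
    simp only [Prod.mk.injEq] at heq
    have hZ'' : θ' ∈ Z' := heq.1 ▸ hpZ
    have := @hsub (r, θ') ⟨mem_strip.1 (hr'1 hp), hZ'', hθ'.1, hθ'.2.le⟩
    exact ⟨heq.2.1 ▸ this.1.1.2, hZe θ hpZ, heq.2.2 ▸ this.2⟩
  set E' : ℝ × ℝ → M := fun p => if p.2 ∈ Z' then e.symm (φ p) else E p with hE'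
  have hE'0 : ∀ p ∈ strip r', p.2 ∉ Z → E' p = E p := by
    intro p hp hpZ
    simp only [hE']
    split_ifs with hZ1
    · simp only [hφ, hZ0 _ hpZ, mul_zero, zero_smul, add_zero]
      exact e.left_inv (hmem p hp hZ1).1
    · rfl
  refine ⟨E', r', lt_min hE.pos hr₁, ?_, ?_, ?_, ?_⟩
  · intro p hp
    apply ContMDiffAt.contMDiffWithinAt
    by_cases hpZ : p.2 ∈ Z
    · have hU : IsOpen (strip r' ∩ Prod.snd ⁻¹' interior Z') :=
        (isOpen_strip r').inter (isOpen_interior.preimage continuous_snd)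
      have h1 : ContMDiffOn 𝓘(ℝ, ℝ × ℝ) 𝓘(ℝ, Plane) ∞ (fun p => e.symm (φ p))
          (strip r' ∩ Prod.snd ⁻¹' interior Z') := by
        refine (contMDiffOn_symm_of_mem_maximalAtlas (IsManifold.subset_maximalAtlas he)).comp
          (t := e.target) (f := φ) (contMDiffOn_iff_contDiffOn.2 (hφs.mono fun q hq => ?_))
          (fun q hq => (hmem q hq.1 (interior_subset hq.2)).2.2)
        have := hmem q hq.1 (interior_subset hq.2)
        exact ⟨⟨hr'0 hq.1, this.1⟩, this.2.1⟩
      refine (h1.congr fun q hq => ?_).contMDiffAt (hU.mem_nhds ⟨hp, hZZ' hpZ⟩)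
      simp only [hE', if_pos (interior_subset hq.2)]
    · have hU : IsOpen (strip r' ∩ Prod.snd ⁻¹' Zᶜ) :=
        (isOpen_strip r').inter (hZ.isOpen_compl.preimage continuous_snd)
      exact ((hE.smooth.mono (inter_subset_left.trans hr'0)).congr
        fun q hq => hE'0 q hq.1 hq.2).contMDiffAt (hU.mem_nhds ⟨hp, hpZ⟩)
  · intro r hr θ
    have hr0 := mem_strip.1 (hr'0 (mem_strip.2 hr : (r, θ) ∈ strip r'))
    have h1 : E (r, θ + L) = E (r, θ) := hE.periodic r hr0 θ
    have h2 : (θ + L ∈ Z') = (θ ∈ Z') := hZp θ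
    have h3 : φ (r, θ + L) = φ (r, θ) := hφp r hr0 θ
    simp only [hE', h1, h2, h3]
  · intro θ
    simp only [hE']
    split_ifs with hZ1
    · simp only [hφ, zero_mul, zero_smul, add_zero, hE.zero]
      exact e.left_inv (hZe θ hZ1)
    · exact hE.zero θ
  · intro θ
    by_cases hZ1 : θ ∈ Z'
    · have hsrc : E (0, θ) ∈ e.source := by rw [hE.zero]; exact hZe θ hZ1
      have hEd : MDifferentiableAt 𝓘(ℝ, ℝ) 𝓘(ℝ, Plane) (fun r => E (r, θ)) 0 := by
        have h1 : ContMDiffAt 𝓘(ℝ, ℝ × ℝ) 𝓘(ℝ, Plane) ∞ E (0, θ) :=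
          hE.smooth.contMDiffAt ((isOpen_strip r₀).mem_nhds (zero_mem_strip hE.pos θ))
        have h2 : ContMDiffAt 𝓘(ℝ, ℝ) 𝓘(ℝ, ℝ × ℝ) ∞ (fun r : ℝ => (r, θ)) 0 :=
          (contDiff_id.prodMk contDiff_const).contMDiff.contMDiffAt
        exact (ContMDiffAt.comp (0 : ℝ) h1 h2).mdifferentiableAt (by simp)
      have hd1 : HasMFDerivAt 𝓘(ℝ, ℝ) 𝓘(ℝ, Plane) (fun r => e (E (r, θ))) 0 _ :=
        HasMFDerivAt.comp (0 : ℝ) (mdifferentiableAt_atlas he hsrc).hasMFDerivAt hEd.hasMFDerivAt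
      have hd2 : HasDerivAt (fun r => e (E (r, θ))) (σ θ • w θ) 0 := by
        have hd1' : DifferentiableAt ℝ (fun r => e (E (r, θ))) 0 :=
          hd1.mdifferentiableAt.differentiableAt
        suffices hv : fderiv ℝ (fun r => e (E (r, θ))) 0 1 = σ θ • w θ from
          hv ▸ hd1'.hasFDerivAt.hasDerivAt
        rw [← mfderiv_eq_fderiv, hd1.mfderiv]
        symm
        change _ = mfderiv 𝓘(ℝ, Plane) 𝓘(ℝ, Plane) e (E (0, θ))
          (mfderiv 𝓘(ℝ, ℝ) 𝓘(ℝ, Plane) (fun r => E (r, θ)) 0 (1 : ℝ))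
        erw [hE.velocity θ]
        rw [hE.zero θ]
        exact ((mfderiv 𝓘(ℝ, Plane) 𝓘(ℝ, Plane) e (c θ)).map_smul (σ θ) (ν θ)).symm
      have hd3 : HasDerivAt (fun r => φ (r, θ)) ((σ θ + h θ) • w θ) 0 := by
        have : HasDerivAt (fun r : ℝ => (r * h θ) • w θ) (h θ • w θ) 0 := by
          have h1 : HasDerivAt (fun r : ℝ => r * h θ) (h θ) 0 := by
            simpa using (hasDerivAt_id (0 : ℝ)).mul_const (h θ)
          exact ((ContinuousLinearMap.id ℝ ℝ).smulRight (w θ)).hasFDerivAt.comp_hasDerivAt 0 h1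
        rw [add_smul]
        exact hd2.add this
      have hφ0 : φ (0, θ) = e (c θ) := by simp [hφ, hE.zero]
      have hcs := hZe θ hZ1
      have hd4 : HasMFDerivAt 𝓘(ℝ, ℝ) 𝓘(ℝ, Plane) (fun r => e.symm (φ (r, θ))) 0 _ :=
        HasMFDerivAt.comp (0 : ℝ) (mdifferentiableAt_atlas_symm he
          (by rw [hφ0]; exact e.map_source hcs)).hasMFDerivAt hd3.hasFDerivAt.hasMFDerivAt
      have hfun : (fun r => E' (r, θ)) = fun r => e.symm (φ (r, θ)) := by
        funext r; simp only [hE', if_pos hZ1]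
      rw [hfun, hd4.mfderiv]
      change (mfderiv 𝓘(ℝ, Plane) 𝓘(ℝ, Plane) e.symm (φ (0, θ))
        ((1 : ℝ) • (σ θ + h θ) • w θ) : Plane) = _
      rw [one_smul, hφ0, ← mfderiv_symm_mfderiv he hcs ((σ θ + h θ) • ν θ)]
      congr 1
      exact ((mfderiv 𝓘(ℝ, Plane) 𝓘(ℝ, Plane) e (c θ)).map_smul (σ θ + h θ) (ν θ)).symm
    · have hθZ : θ ∉ Z := fun h => hZ1 (interior_subset (hZZ' h))
      have hfun : (fun r => E' (r, θ)) = fun r => E (r, θ) := by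
        funext r; simp only [hE', if_neg hZ1]
      rw [hfun]
      exact (hE.velocity θ).trans (by rw [hZ0 θ hθZ, add_zero])

end Families

section NormalFamilies

/-! ### Normal families around closed curves -/

variable {c : ℝ → M} {L : ℝ} {ν : ℝ → Plane} {σ : ℝ → ℝ} {E : ℝ × ℝ → M} {r₀ : ℝ}

lemma periodic_cos_sub (hL : 0 < L) (θ₀ : ℝ) :
    Function.Periodic (fun θ => Real.cos (2 * Real.pi * (θ - θ₀) / L)) L := by
  intro θ
  have : 2 * Real.pi * (θ + L - θ₀) / L = 2 * Real.pi * (θ - θ₀) / L + 2 * Real.pi := by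
    field_simp; ring
  simp only [this, Real.cos_add_two_pi]

/-- The superlevel sets of `cos (2π (θ - θ₀) / L)` are arbitrarily small neighbourhoods of `θ₀`
modulo `L`. -/
lemma exists_cos_subset (hL : 0 < L) {U : Set ℝ} (hU : IsOpen U)
    (hUp : Function.Periodic (· ∈ U) L) {θ₀ : ℝ} (h0 : θ₀ ∈ U) :
    ∃ η > 0, ∀ θ, 1 - η ≤ Real.cos (2 * Real.pi * (θ - θ₀) / L) → θ ∈ U := by
  obtain ⟨ε, hε, hεU⟩ := Metric.isOpen_iff.1 hU θ₀ h0
  refine ⟨4 * ε ^ 2 / L ^ 2, by positivity, fun θ hθ => ?_⟩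
  have hper : Function.Periodic (fun θ => (θ ∈ U, Real.cos (2 * Real.pi * (θ - θ₀) / L))) L :=
    fun θ => Prod.ext (hUp θ) (periodic_cos_sub hL θ₀ θ)
  obtain ⟨τ, hτ, heq⟩ := hper.exists_mem_Ico hL θ (θ₀ - L / 2)
  simp only [Prod.mk.injEq] at heq
  rw [heq.2] at hθ
  rw [heq.1]
  apply hεU
  rw [Metric.mem_ball, Real.dist_eq]
  have habs : |τ - θ₀| ≤ L / 2 := abs_le.2 ⟨by linarith [hτ.1], by linarith [hτ.2]⟩
  have hx : |2 * Real.pi * (τ - θ₀) / L| ≤ Real.pi := by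
    rw [abs_div, abs_mul, abs_of_pos (by positivity : 0 < 2 * Real.pi), abs_of_pos hL,
      div_le_iff₀ hL]
    nlinarith [Real.pi_pos]
  have h := Real.cos_le_one_sub_mul_cos_sq hx
  have h2 : 2 / Real.pi ^ 2 * (2 * Real.pi * (τ - θ₀) / L) ^ 2 = 8 * (τ - θ₀) ^ 2 / L ^ 2 := by
    field_simp; ring
  rw [h2] at h
  have h3 : 8 * (τ - θ₀) ^ 2 / L ^ 2 ≤ 4 * ε ^ 2 / L ^ 2 := by linarith
  rw [div_le_div_iff_of_pos_right (by positivity)] at h3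
  apply abs_lt_of_sq_lt_sq _ hε.le
  nlinarith [pow_pos hε 2]

/-- A smooth periodic bump function at `θ₀`, with the sets that control its support. -/
lemma exists_periodic_bump (hL : 0 < L) {U : Set ℝ} (hU : IsOpen U)
    (hUp : Function.Periodic (· ∈ U) L) {θ₀ : ℝ} (h0 : θ₀ ∈ U) :
    ∃ χ : ℝ → ℝ, ∃ Z Z' : Set ℝ, ContDiff ℝ ∞ χ ∧ Function.Periodic χ L ∧ (∀ θ, 0 ≤ χ θ) ∧
      0 < χ θ₀ ∧ IsClosed Z ∧ IsClosed Z' ∧ Function.Periodic (· ∈ Z') L ∧ Z ⊆ interior Z' ∧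
      (∀ θ, θ ∉ Z → χ θ = 0) ∧ Z' ⊆ U := by
  obtain ⟨η, hη, hηU⟩ := exists_cos_subset hL hU hUp h0
  set k : ℝ → ℝ := fun θ => Real.cos (2 * Real.pi * (θ - θ₀) / L) with hk
  have hkp : Function.Periodic k L := periodic_cos_sub hL θ₀
  have hks : ContDiff ℝ ∞ k := by fun_prop
  refine ⟨fun θ => Real.smoothTransition (k θ - (1 - η / 2)), {θ | 1 - η / 2 ≤ k θ},
    {θ | 1 - η ≤ k θ}, Real.smoothTransition.contDiff.comp (hks.sub contDiff_const),
    fun θ => by simp only [hkp θ], fun θ => Real.smoothTransition.nonneg _, ?_,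
    isClosed_le continuous_const hks.continuous, isClosed_le continuous_const hks.continuous,
    fun θ => by simp only [mem_ofPred_eq, hkp θ], ?_, ?_, hηU⟩
  · apply Real.smoothTransition.pos_of_pos
    simp [hk]; linarith
  · refine Subset.trans ?_ (interior_maximal (t := {θ | 1 - η < k θ}) ?_ ?_)
    · intro θ hθ
      simp only [mem_ofPred_eq] at *; linarith
    · intro θ hθ; simp only [mem_ofPred_eq] at *; linarith
    · exact isOpen_lt continuous_const hks.continuous
  · intro θ hθ
    apply Real.smoothTransition.zero_of_nonpos
    simp only [mem_ofPred_eq, not_le] at hθ; linarith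

/-- Every smooth vector field along a smooth closed curve is the initial velocity of a smooth family
of closed curves. The family is composed of moves in single charts, weighted by a partition of
unity on the circle; this replaces the exponential map. -/
lemma exists_isFamily (hL : 0 < L) (hc : ContMDiff 𝓘(ℝ, ℝ) 𝓘(ℝ, Plane) ∞ c)
    (hcp : Function.Periodic c L)
    (hν : ContMDiff 𝓘(ℝ, ℝ) 𝓘(ℝ, Plane).tangent ∞
      (fun θ => (⟨c θ, ν θ⟩ : TangentBundle 𝓘(ℝ, Plane) M)))
    (hνp : ∀ θ, (⟨c (θ + L), ν (θ + L)⟩ : TangentBundle 𝓘(ℝ, Plane) M) = ⟨c θ, ν θ⟩) :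
    ∃ E r₀, IsFamily c L ν (fun _ => 1) E r₀ := by
  have hbump := fun θ₀ => exists_periodic_bump hL
    ((chartAt Plane (c θ₀)).open_source.preimage hc.continuous)
    (fun θ => by simp only [mem_preimage, hcp θ]) (mem_chart_source Plane (c θ₀))
  choose χ Z Z' hχ hχp hχ0 hχpos hZ hZ' hZp hZZ' hχZ hZU using hbump
  obtain ⟨s, -, hs⟩ := (isCompact_Icc : IsCompact (Icc 0 L)).elim_nhds_subcover
    (fun θ₀ => {θ | 0 < χ θ₀ θ})
    (fun θ₀ _ => (isOpen_lt continuous_const (hχ θ₀).continuous).mem_nhds (hχpos θ₀))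
  set τ : ℝ → ℝ := fun θ => ∑ i ∈ s, χ i θ with hτ
  have hτs : ContDiff ℝ ∞ τ := ContDiff.sum fun i _ => hχ i
  have hτp : Function.Periodic τ L := fun θ => Finset.sum_congr rfl fun i _ => hχp i θ
  have hτpos : ∀ θ, 0 < τ θ := by
    intro θ
    obtain ⟨θ', hθ', heq⟩ := hτp.exists_mem_Ico₀ hL θ
    rw [heq]
    obtain ⟨i, hi⟩ := mem_iUnion₂.1 (hs ⟨hθ'.1, hθ'.2.le⟩)
    obtain ⟨his, hi⟩ := hi
    exact Finset.sum_pos' (fun i _ => hχ0 i θ') ⟨i, his, hi⟩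
  have key : ∀ t : Finset ℝ, ∃ E r₀, IsFamily c L ν (fun θ => ∑ i ∈ t, χ i θ / τ θ) E r₀ := by
    intro t
    induction t using Finset.induction_on with
    | empty => simpa using ⟨_, _, isFamily_const hc hcp⟩
    | insert i t hi ih =>
      obtain ⟨E, r₀, hE⟩ := ih
      obtain ⟨E', r', hE'⟩ := hE.exists_add hL hc hν hνp (chart_mem_atlas Plane (c i))
        (h := fun θ => χ i θ / τ θ) ((hχ i).div hτs fun θ => (hτpos θ).ne')
        (fun θ => by simp only [hχp i θ, hτp θ]) (hZ i) (hZ' i) (hZp i) (hZZ' i)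
        (fun θ hθ => by simp only [hχZ i θ hθ, zero_div]) (hZU i)
      refine ⟨E', r', ?_⟩
      simp only [Finset.sum_insert hi]
      simpa only [add_comm] using hE'
  obtain ⟨E, r₀, hE⟩ := key s
  refine ⟨E, r₀, ?_⟩
  convert hE using 2
  rw [← Finset.sum_div]
  exact (div_self (hτpos _).ne').symm

/-- A closed two-sided minimal curve belongs to a family of closed curves with unit normal initial
velocity, and `curvature_equation` applies to it. -/
lemma exists_normal_family {g : SurfaceMetric M} {m : ℕ} {k : ℝ} (hK : GaussCurvatureGE g k)
    (S : ClosedCurves g m) (hmin : S.IsMinimal) (hside : S.IsTwoSided) (j : Fin m) :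
    ∃ E r₀, 0 < r₀ ∧ ContMDiffOn 𝓘(ℝ, ℝ × ℝ) 𝓘(ℝ, Plane) ∞ E (strip r₀) ∧
      (∀ r ∈ Ioo (-r₀) r₀, Function.Periodic (fun θ => E (r, θ)) (S.len j)) ∧
      (∀ θ, E (0, θ) = S.curve j θ) ∧
      (∀ θ, pullback g E (1, 0) (1, 0) (0, θ) = 1) ∧
      (∀ θ, pullback g E (1, 0) (0, 1) (0, θ) = 0) ∧
      (∀ θ, pullback g E (0, 1) (0, 1) (0, θ) = 1) ∧
      ∀ θ, dirD (1, 0) (pullback g E (0, 1) (0, 1)) (0, θ) = 0 ∧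
        dirD (1, 0) (dirD (1, 0) (pullback g E (0, 1) (0, 1))) (0, θ) / 2
          ≤ -k + dirD (0, 1) (dirD (1, 0) (pullback g E (1, 0) (0, 1))) (0, θ) := by
  obtain ⟨ν, hν, hνp, hνn⟩ := hside j
  obtain ⟨E, r₀, hE⟩ := exists_isFamily (ν := ν) (S.len_pos j) (S.smooth j) (S.periodic j) hν hνp
  have hd : ∀ θ, MDifferentiableAt 𝓘(ℝ, ℝ × ℝ) 𝓘(ℝ, Plane) E (0, θ) := fun θ =>
    (hE.smooth.contMDiffAt ((isOpen_strip r₀).mem_nhds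
      (zero_mem_strip hE.pos θ))).mdifferentiableAt (by simp)
  have h1 : ∀ θ, (mfderiv 𝓘(ℝ, ℝ × ℝ) 𝓘(ℝ, Plane) E (0, θ) ((1 : ℝ), (0 : ℝ)) : Plane) = ν θ := by
    intro θ
    refine Eq.trans ?_ ((hE.velocity θ).trans (one_smul ℝ (show Plane from ν θ)))
    have hl : HasDerivAt (fun r : ℝ => (r, θ)) ((1 : ℝ), (0 : ℝ)) 0 :=
      (hasDerivAt_id (0 : ℝ)).prodMk (hasDerivAt_const 0 θ)
    have hc := HasMFDerivAt.comp (0 : ℝ) (hd θ).hasMFDerivAt hl.hasFDerivAt.hasMFDerivAt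
    have h2 := DFunLike.congr_fun hc.mfderiv (1 : ℝ)
    refine Eq.trans ?_ h2.symm
    change _ = mfderiv 𝓘(ℝ, ℝ × ℝ) 𝓘(ℝ, Plane) E (0, θ) ((1 : ℝ) • ((1 : ℝ), (0 : ℝ)))
    rw [one_smul]
  have hfun : (fun θ => E (0, θ)) = S.curve j := funext hE.zero
  have h2 : ∀ θ, (mfderiv 𝓘(ℝ, ℝ × ℝ) 𝓘(ℝ, Plane) E (0, θ) ((0 : ℝ), (1 : ℝ)) : Plane)
      = velocity (S.curve j) θ := by
    intro θ
    have hl : HasDerivAt (fun τ : ℝ => ((0 : ℝ), τ)) ((0 : ℝ), (1 : ℝ)) θ :=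
      (hasDerivAt_const θ 0).prodMk (hasDerivAt_id θ)
    have hc := HasMFDerivAt.comp θ (hd θ).hasMFDerivAt hl.hasFDerivAt.hasMFDerivAt
    have hc' : mfderiv 𝓘(ℝ, ℝ) 𝓘(ℝ, Plane) (fun θ => E (0, θ)) θ = _ := hc.mfderiv
    have h2 := DFunLike.congr_fun hc' (1 : ℝ)
    rw [velocity, ← hfun]
    refine Eq.trans ?_ h2.symm
    change _ = mfderiv 𝓘(ℝ, ℝ × ℝ) 𝓘(ℝ, Plane) E (0, θ) ((1 : ℝ) • ((0 : ℝ), (1 : ℝ)))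
    rw [one_smul]
  have hA : ∀ θ, pullback g E (1, 0) (1, 0) (0, θ) = 1 := fun θ => by
    rw [pullback, h1, hE.zero]; exact (hνn θ).1
  have hB : ∀ θ, pullback g E (1, 0) (0, 1) (0, θ) = 0 := fun θ => by
    rw [pullback, h1, h2, hE.zero]; exact (hνn θ).2
  have hC : ∀ θ, pullback g E (0, 1) (0, 1) (0, θ) = 1 := fun θ => by
    rw [pullback, h2, hE.zero]; exact S.unit_speed j θ
  refine ⟨E, r₀, hE.pos, hE.smooth, hE.periodic, hE.zero, hA, hB, hC, fun θ => ?_⟩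
  refine curvature_equation hK (isOpen_strip r₀) hE.smooth ?_ (fun θ _ => hA θ)
    (fun θ _ => hB θ) (fun θ _ => hC θ) (zero_mem_strip hE.pos θ)
  intro e he θ _ hθ k
  rw [hfun]
  exact hmin j e he θ (by rwa [← hE.zero θ]) k

end NormalFamilies

section RadialCutoff

/-! ### The radial cutoff -/

/-- A smooth bump function, positive on `(-2, 2)` and zero elsewhere. -/
def bumpFun (x : ℝ) : ℝ := Real.smoothTransition (4 - x ^ 2)

lemma contDiff_bumpFun : ContDiff ℝ ∞ bumpFun :=
  Real.smoothTransition.contDiff.comp (contDiff_const.sub (contDiff_id.pow 2))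

lemma bumpFun_eq_zero {x : ℝ} (hx : 2 ≤ |x|) : bumpFun x = 0 := by
  apply Real.smoothTransition.zero_of_nonpos
  nlinarith [sq_abs x]

/-- The Hardy inequality on the half line is not valid with a constant larger than `1`: this is the
one-dimensional source of the instability. The cutoff is `ψ (ε log t) / t` with a bump function `ψ`
and small `ε`. -/
lemma exists_radial_cutoff {κ : ℝ} (hκ : 1 < κ) :
    ∃ (φ : ℝ → ℝ) (a b : ℝ), 0 < a ∧ a < b ∧ ContDiffOn ℝ ∞ φ (Ioi 0) ∧
      (∀ t, 0 < t → t ∉ Ioo a b → φ t = 0) ∧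
      ∫ t in Icc a b, (t ^ 3 * deriv φ t ^ 2 - κ * (t * φ t ^ 2)) < 0 := by
  set ψ := bumpFun with hψ
  have hψs : ContDiff ℝ ∞ ψ := contDiff_bumpFun
  have hψd : ∀ x, HasDerivAt ψ (deriv ψ x) x := fun x =>
    (hψs.differentiable (by simp) x).hasDerivAt
  have hψ'c : Continuous (deriv ψ) := hψs.continuous_deriv (by simp)
  have hψc : Continuous ψ := hψs.continuous
  set I₀ := ∫ x in (-2 : ℝ)..2, ψ x ^ 2 with hI₀
  set I₁ := ∫ x in (-2 : ℝ)..2, deriv ψ x ^ 2 with hI₁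
  have hI₀pos : 0 < I₀ := by
    refine intervalIntegral.intervalIntegral_pos_of_pos_on ((hψc.pow 2).intervalIntegrable _ _)
      (fun x hx => pow_pos (Real.smoothTransition.pos_of_pos ?_) 2) (by norm_num)
    nlinarith [hx.1, hx.2]
  have hI₁nn : 0 ≤ I₁ := intervalIntegral.integral_nonneg (by norm_num) fun x _ => sq_nonneg _
  -- `ε` is chosen such that `ε² ∫ ψ'² < (κ - 1) ∫ ψ²`
  set ε := Real.sqrt ((κ - 1) * I₀ / (2 * (I₁ + 1))) with hε
  have hεpos : 0 < ε := Real.sqrt_pos.2 (div_pos (mul_pos (by linarith) hI₀pos) (by linarith))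
  have hε2 : ε ^ 2 * I₁ < (κ - 1) * I₀ := by
    rw [hε, Real.sq_sqrt (div_pos (mul_pos (by linarith) hI₀pos) (by linarith)).le,
      div_mul_eq_mul_div, div_lt_iff₀ (by linarith)]
    have : 0 < (κ - 1) * I₀ := mul_pos (by linarith) hI₀pos
    nlinarith
  set φ : ℝ → ℝ := fun t => ψ (ε * Real.log t) / t with hφ
  set a := Real.exp (-2 / ε) with ha
  set b := Real.exp (2 / ε) with hb
  have hab : a < b := Real.exp_lt_exp.2 (by gcongr; norm_num)
  have ha0 : 0 < a := Real.exp_pos _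
  refine ⟨φ, a, b, ha0, hab, ?_, ?_, ?_⟩
  · refine ContDiffOn.div (hψs.comp_contDiffOn ?_) contDiffOn_id fun t ht => ht.ne'
    exact contDiffOn_const.mul (Real.contDiffOn_log.mono fun t ht => ht.ne')
  · intro t ht htab
    simp only [hφ]
    rw [hψ, bumpFun_eq_zero, zero_div]
    rw [le_abs]
    simp only [mem_Ioo, not_and_or, not_lt] at htab
    rcases htab with h | h
    · right
      have := Real.log_le_log ht h
      rw [ha, Real.log_exp, le_div_iff₀ hεpos] at this
      linarith
    · left
      have := Real.log_le_log (Real.exp_pos _) h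
      rw [Real.log_exp, div_le_iff₀ hεpos] at this
      linarith
  · -- the substitution `x = ε log t` turns the integrand into `ε⁻¹ F`, whose cross term is exact
    set F : ℝ → ℝ := fun x => ε ^ 2 * deriv ψ x ^ 2 - ε * (2 * ψ x * deriv ψ x) - (κ - 1) * ψ x ^ 2
      with hF
    have hFc : Continuous F := by fun_prop
    have hFi : ∫ x in (-2 : ℝ)..2, F x = ε ^ 2 * I₁ - (κ - 1) * I₀ := by
      have h2 : ∫ x in (-2 : ℝ)..2, 2 * ψ x * deriv ψ x = 0 := by
        have := intervalIntegral.integral_eq_sub_of_hasDerivAt (a := -2) (b := 2)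
          (f := fun x => ψ x ^ 2) (f' := fun x => 2 * ψ x * deriv ψ x)
          (fun x _ => by simpa using (hψd x).fun_pow 2)
          (Continuous.intervalIntegrable (by fun_prop) _ _)
        rw [this, hψ, bumpFun_eq_zero (by norm_num), bumpFun_eq_zero (by norm_num)]
        simp
      simp only [hF]
      rw [intervalIntegral.integral_sub, intervalIntegral.integral_sub,
        intervalIntegral.integral_const_mul, intervalIntegral.integral_const_mul,
        intervalIntegral.integral_const_mul, h2]
      · ring
      all_goals exact Continuous.intervalIntegrable (by fun_prop) _ _
    have hder : ∀ t ∈ Icc a b, HasDerivAt (fun t => ε * Real.log t) (ε * t⁻¹) t := fun t ht =>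
      (Real.hasDerivAt_log (ha0.trans_le ht.1).ne').const_mul ε
    have hchange : ∫ t in a..b, F (ε * Real.log t) * (ε * t⁻¹) = ∫ x in (-2 : ℝ)..2, F x := by
      have := intervalIntegral.integral_comp_mul_deriv (a := a) (b := b)
        (f := fun t => ε * Real.log t) (f' := fun t => ε * t⁻¹) (g := F)
        (fun t ht => hder t (by rwa [uIcc_of_le hab.le] at ht))
        (continuousOn_const.mul (continuousOn_inv₀.mono fun t ht => by
          rw [uIcc_of_le hab.le] at ht; exact (ha0.trans_le ht.1).ne')) hFc
      simp only [Function.comp] at this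
      rw [this, ha, hb, Real.log_exp, Real.log_exp, mul_div_cancel₀ _ hεpos.ne',
        mul_div_cancel₀ _ hεpos.ne']
    have hpt : ∀ t ∈ Icc a b, t ^ 3 * deriv φ t ^ 2 - κ * (t * φ t ^ 2)
        = ε⁻¹ * (F (ε * Real.log t) * (ε * t⁻¹)) := by
      intro t ht
      have ht0 : 0 < t := ha0.trans_le ht.1
      have h1 : HasDerivAt φ _ t := ((hψd _).comp t (hder t ht)).div (hasDerivAt_id t) ht0.ne'
      rw [h1.deriv]
      simp only [hφ, hF, Function.comp]
      field_simp
      ring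
    rw [setIntegral_congr_fun measurableSet_Icc hpt, integral_const_mul,
      integral_Icc_eq_integral_Ioc, ← intervalIntegral.integral_of_le hab.le, hchange, hFi]
    exact mul_neg_of_pos_of_neg (inv_pos.2 hεpos) (by linarith)

end RadialCutoff

section ParametricIntegrals

/-! ### Differentiation of parametric integrals -/

section

variable {H : ℝ × (ℝ × ℝ) → ℝ} {D : Set (ℝ × (ℝ × ℝ))}

/-- The derivative in the first variable. -/
def paramD (H : ℝ × (ℝ × ℝ) → ℝ) (z : ℝ × (ℝ × ℝ)) : ℝ := fderiv ℝ H z (1, 0)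

lemma contDiffOn_paramD (hD : IsOpen D) (hH : ContDiffOn ℝ ∞ H D) : ContDiffOn ℝ ∞ (paramD H) D :=
  (hH.fderiv_of_isOpen hD (m := ∞) (by simp)).clm_apply contDiffOn_const

lemma hasDerivAt_paramD (hD : IsOpen D) (hH : ContDiffOn ℝ ∞ H D) {s : ℝ} {q : ℝ × ℝ}
    (h : (s, q) ∈ D) : HasDerivAt (fun s => H (s, q)) (paramD H (s, q)) s := by
  have hl : HasDerivAt (fun s : ℝ => (s, q)) ((1 : ℝ), (0 : ℝ × ℝ)) s :=
    (hasDerivAt_id s).prodMk (hasDerivAt_const s q)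
  exact (hH.differentiableAt_of_isOpen hD h).hasFDerivAt.comp_hasDerivAt s hl

lemma hasDerivAt_setIntegral (hD : IsOpen D) (hH : ContDiffOn ℝ ∞ H D) {K : Set (ℝ × ℝ)}
    (hK : IsCompact K) (hKm : MeasurableSet K) {δ : ℝ} (hsub : Ioo (-δ) δ ×ˢ K ⊆ D) {s : ℝ}
    (hs : s ∈ Ioo (-δ) δ) :
    HasDerivAt (fun s => ∫ q in K, H (s, q)) (∫ q in K, paramD H (s, q)) s := by
  obtain ⟨ρ, hρ, hρs⟩ := Metric.nhds_basis_closedBall.mem_iff.1 (isOpen_Ioo.mem_nhds hs)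
  have hcomp : IsCompact (Metric.closedBall s ρ ×ˢ K) := (isCompact_closedBall s ρ).prod hK
  have hsubD : Metric.closedBall s ρ ×ˢ K ⊆ D := (prod_mono_left hρs).trans hsub
  obtain ⟨B, hB⟩ := hcomp.exists_bound_of_continuousOn
    ((contDiffOn_paramD hD hH).continuousOn.mono hsubD)
  have hcont : ∀ {G : ℝ × (ℝ × ℝ) → ℝ}, ContDiffOn ℝ ∞ G D → ∀ s' ∈ Ioo (-δ) δ,
      ContinuousOn (fun q => G (s', q)) K := fun hG s' hs' =>
    hG.continuousOn.comp (by fun_prop) fun q hq => hsub ⟨hs', hq⟩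
  refine (hasDerivAt_integral_of_dominated_loc_of_deriv_le (bound := fun _ => B)
    (F := fun s q => H (s, q)) (F' := fun s q => paramD H (s, q))
    (Metric.ball_mem_nhds s hρ) ?_ ?_ ?_ ?_ ?_ ?_).2
  · filter_upwards [isOpen_Ioo.mem_nhds hs] with s' hs'
    exact (hcont hH s' hs').aestronglyMeasurable hKm
  · exact (hcont hH s hs).integrableOn_compact hK
  · exact (hcont (contDiffOn_paramD hD hH) s hs).aestronglyMeasurable hKm
  · filter_upwards [ae_restrict_mem hKm] with q hq s' hs'
    exact hB (s', q) ⟨Metric.ball_subset_closedBall hs', hq⟩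
  · exact integrableOn_const hK.measure_lt_top.ne
  · filter_upwards [ae_restrict_mem hKm] with q hq s' hs'
    exact hasDerivAt_paramD hD hH (hsubD ⟨Metric.ball_subset_closedBall hs', hq⟩)

lemma deriv_deriv_eq_paramD (hD : IsOpen D) (hH : ContDiffOn ℝ ∞ H D) {s : ℝ} {q : ℝ × ℝ}
    (h : (s, q) ∈ D) : deriv (deriv fun s => H (s, q)) s = paramD (paramD H) (s, q) := by
  rw [← (hasDerivAt_paramD hD (contDiffOn_paramD hD hH) h).deriv]
  apply Filter.EventuallyEq.deriv_eq
  have : ∀ᶠ t in nhds s, (t, q) ∈ D :=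
    (by fun_prop : Continuous fun t : ℝ => (t, q)).continuousAt.eventually (hD.mem_nhds h)
  filter_upwards [this] with t ht using (hasDerivAt_paramD hD hH ht).deriv

end

/-! ### Second derivatives at a critical point -/

lemma _root_.ContDiffAt.hasDerivAt_deriv {n : ℝ → ℝ} {x : ℝ} (hn : ContDiffAt ℝ ∞ n x) :
    HasDerivAt (deriv n) (deriv (deriv n) x) x := by
  have : ContDiffAt ℝ 1 (deriv n) x := by
    have h := hn.fderiv_right (m := 1) (by norm_cast)
    exact (h.clm_apply contDiffAt_const : ContDiffAt ℝ 1 (fun y => fderiv ℝ n y 1) x)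
  exact (this.differentiableAt (by simp)).hasDerivAt

lemma eventually_hasDerivAt {n : ℝ → ℝ} {x : ℝ} (hn : ContDiffAt ℝ ∞ n x) :
    ∀ᶠ y in nhds x, HasDerivAt n (deriv n y) y := by
  filter_upwards [(hn.of_le (m := 1) (by norm_cast)).eventually (by simp)] with y hy
  exact (hy.differentiableAt (by simp)).hasDerivAt

lemma deriv_deriv_sqrt {n : ℝ → ℝ} {x : ℝ} (hn : ContDiffAt ℝ ∞ n x) (h0 : 0 < n x)
    (h1 : deriv n x = 0) :
    deriv (deriv fun y => Real.sqrt (n y)) x = deriv (deriv n) x / (2 * Real.sqrt (n x)) := by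
  have hpos : ∀ᶠ y in nhds x, 0 < n y := hn.continuousAt.eventually (lt_mem_nhds h0)
  have h2 : deriv (fun y => Real.sqrt (n y)) =ᶠ[nhds x]
      fun y => deriv n y / (2 * Real.sqrt (n y)) := by
    filter_upwards [hpos, eventually_hasDerivAt hn] with y hy hd
    exact (hd.sqrt hy.ne').deriv
  rw [h2.deriv_eq]
  have hd := hn.hasDerivAt_deriv.div
    (((hn.differentiableAt (by simp)).hasDerivAt.sqrt h0.ne').const_mul 2)
    (mul_pos two_pos (Real.sqrt_pos.2 h0)).ne'
  have h3 := hd.deriv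
  rw [h1] at h3
  simp only [zero_div, mul_zero, sub_zero] at h3
  refine h3.trans ?_
  have := (Real.sqrt_pos.2 h0).ne'
  field_simp

lemma deriv_deriv_add_sq_mul {n k : ℝ → ℝ} (hn : ContDiffAt ℝ ∞ n 0) (hk : ContDiffAt ℝ ∞ k 0) :
    deriv (fun s => n s + s ^ 2 * k s) 0 = deriv n 0 ∧
    deriv (deriv fun s => n s + s ^ 2 * k s) 0 = deriv (deriv n) 0 + 2 * k 0 := by
  have h1 : ∀ᶠ s in nhds (0 : ℝ), HasDerivAt (fun s => n s + s ^ 2 * k s)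
      (deriv n s + (2 * s * k s + s ^ 2 * deriv k s)) s := by
    filter_upwards [eventually_hasDerivAt hn, eventually_hasDerivAt hk] with s hs hs'
    refine hs.add ?_
    simpa using (hasDerivAt_pow 2 s).fun_mul hs'
  refine ⟨by simpa using h1.self_of_nhds.deriv, ?_⟩
  have h2 : deriv (fun s => n s + s ^ 2 * k s) =ᶠ[nhds 0]
      fun s => deriv n s + (2 * s * k s + s ^ 2 * deriv k s) := by
    filter_upwards [h1] with s hs using hs.deriv
  rw [h2.deriv_eq]
  have hkd := (hk.differentiableAt (by simp)).hasDerivAt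
  have h3 := hn.hasDerivAt_deriv.add (((((hasDerivAt_id (0 : ℝ)).const_mul 2).mul hkd)).add
    ((hasDerivAt_pow 2 (0 : ℝ)).mul hk.hasDerivAt_deriv))
  have h4 := h3.deriv
  simp at h4
  exact h4

end ParametricIntegrals

section SecondVariation

/-! ### The second variation of area -/

/-- The coefficients `A = ⟨∂_r E, ∂_r E⟩`, `B = ⟨∂_r E, ∂_θ E⟩` and `C = ⟨∂_θ E, ∂_θ E⟩` of a normal
family of curves around a geodesic of length `L`, on a surface of curvature at least `κ`. -/
structure IsNormalProfile (A B C : ℝ × ℝ → ℝ) (r₀ L κ : ℝ) : Prop where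
  pos : 0 < r₀
  len_pos : 0 < L
  smooth_A : ContDiffOn ℝ ∞ A (strip r₀)
  smooth_B : ContDiffOn ℝ ∞ B (strip r₀)
  smooth_C : ContDiffOn ℝ ∞ C (strip r₀)
  A_zero : ∀ θ, A (0, θ) = 1
  B_zero : ∀ θ, B (0, θ) = 0
  C_zero : ∀ θ, C (0, θ) = 1
  stationary : ∀ θ, dirD (1, 0) C (0, θ) = 0
  second_le : ∫ θ in Icc 0 L, dirD (1, 0) (dirD (1, 0) C) (0, θ) / 2 ≤ -κ * L

/-- The square of the area element of `(t, θ) ↦ (t, E (s φ(t), θ))`, at `z = (s, (t, θ))`, in terms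
of the coefficients `A`, `B`, `C` of the metric pulled back by `E`. -/
def radicand (A B C : ℝ × ℝ → ℝ) (φ : ℝ → ℝ) (z : ℝ × (ℝ × ℝ)) : ℝ :=
  (1 + z.2.1 ^ 2 * (z.1 * deriv φ z.2.1) ^ 2 * A (z.1 * φ z.2.1, z.2.2))
      * (z.2.1 ^ 2 * C (z.1 * φ z.2.1, z.2.2))
    - (z.2.1 ^ 2 * (z.1 * deriv φ z.2.1) * B (z.1 * φ z.2.1, z.2.2)) ^ 2

/-- The parameters for which the variation is defined. -/
def varDomain (φ : ℝ → ℝ) (r₀ : ℝ) : Set (ℝ × (ℝ × ℝ)) :=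
  (univ ×ˢ (Ioi 0 ×ˢ univ)) ∩ (fun z => (z.1 * φ z.2.1, z.2.2)) ⁻¹' strip r₀

variable {A B C : ℝ × ℝ → ℝ} {φ : ℝ → ℝ} {r₀ L κ a b : ℝ}

lemma mem_varDomain {s t θ : ℝ} :
    (s, (t, θ)) ∈ varDomain φ r₀ ↔ 0 < t ∧ s * φ t ∈ Ioo (-r₀) r₀ := by
  simp [varDomain, strip]

lemma contDiffOn_shift (hφ : ContDiffOn ℝ ∞ φ (Ioi 0)) :
    ContDiffOn ℝ ∞ (fun z : ℝ × (ℝ × ℝ) => (z.1 * φ z.2.1, z.2.2)) (univ ×ˢ (Ioi 0 ×ˢ univ)) := by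
  refine ContDiffOn.prodMk (contDiffOn_fst.mul (hφ.comp ?_ fun z hz => hz.2.1)) ?_
  · exact (contDiff_fst.comp contDiff_snd).contDiffOn
  · exact (contDiff_snd.comp contDiff_snd).contDiffOn

lemma isOpen_varDomain (hφ : ContDiffOn ℝ ∞ φ (Ioi 0)) : IsOpen (varDomain φ r₀) :=
  (contDiffOn_shift hφ).continuousOn.isOpen_inter_preimage
    (isOpen_univ.prod (isOpen_Ioi.prod isOpen_univ)) (isOpen_strip r₀)

lemma contDiffOn_radicand (hφ : ContDiffOn ℝ ∞ φ (Ioi 0)) (h : IsNormalProfile A B C r₀ L κ) :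
    ContDiffOn ℝ ∞ (radicand A B C φ) (varDomain φ r₀) := by
  have hm : ContDiffOn ℝ ∞ (fun z : ℝ × (ℝ × ℝ) => (z.1 * φ z.2.1, z.2.2)) (varDomain φ r₀) :=
    (contDiffOn_shift hφ).mono inter_subset_left
  have hA := h.smooth_A.comp hm fun z hz => hz.2
  have hB := h.smooth_B.comp hm fun z hz => hz.2
  have hC := h.smooth_C.comp hm fun z hz => hz.2
  have ht : ContDiffOn ℝ ∞ (fun z : ℝ × (ℝ × ℝ) => z.2.1) (varDomain φ r₀) :=
    (contDiff_fst.comp contDiff_snd).contDiffOn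
  have hφ' : ContDiffOn ℝ ∞ (fun z : ℝ × (ℝ × ℝ) => z.1 * deriv φ z.2.1) (varDomain φ r₀) :=
    contDiffOn_fst.mul ((hφ.deriv_of_isOpen isOpen_Ioi (m := ∞) (by simp)).comp ht
      fun z hz => hz.1.2.1)
  exact ((contDiffOn_const.add (((ht.pow 2).mul (hφ'.pow 2)).mul hA)).mul
    ((ht.pow 2).mul hC)).sub ((((ht.pow 2).mul hφ').mul hB).pow 2)

lemma radicand_zero (h : IsNormalProfile A B C r₀ L κ) (t θ : ℝ) :
    radicand A B C φ (0, (t, θ)) = t ^ 2 := by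
  simp [radicand, h.C_zero]

lemma deriv_radicand (h : IsNormalProfile A B C r₀ L κ) (t θ : ℝ) :
    deriv (fun s => radicand A B C φ (s, (t, θ))) 0 = 0 ∧
    deriv (deriv fun s => radicand A B C φ (s, (t, θ))) 0
      = t ^ 2 * φ t ^ 2 * dirD (1, 0) (dirD (1, 0) C) (0, θ) + 2 * (t ^ 4 * deriv φ t ^ 2) := by
  have hΩ := isOpen_strip r₀
  have h0 : ((0 : ℝ), θ) ∈ strip r₀ := zero_mem_strip h.pos θ
  set l : ℝ → ℝ × ℝ := fun s => (s * φ t, θ) with hl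
  have hls : ContDiff ℝ ∞ l := by fun_prop
  have hl0 : l 0 = (0, θ) := by simp [hl]
  have hcomp : ∀ {F : ℝ × ℝ → ℝ}, ContDiffOn ℝ ∞ F (strip r₀) →
      ContDiffAt ℝ ∞ (fun s => F (l s)) 0 := fun hF =>
    ContDiffAt.comp 0 (hF.contDiffAt (by rw [hl0]; exact hΩ.mem_nhds h0)) hls.contDiffAt
  have hd : ∀ {F : ℝ × ℝ → ℝ}, ContDiffOn ℝ ∞ F (strip r₀) → ∀ s, l s ∈ strip r₀ →
      HasDerivAt (fun s => F (l s)) (φ t * dirD (1, 0) F (l s)) s := by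
    intro F hF s hs
    have h1 := hasDerivAt_horizontal (hF.differentiableAt_of_isOpen hΩ hs)
    simpa [Function.comp_def, mul_comm] using h1.comp s ((hasDerivAt_id s).mul_const (φ t))
  have hnear : ∀ᶠ s in nhds (0 : ℝ), l s ∈ strip r₀ :=
    hls.continuous.continuousAt.eventually (by rw [hl0]; exact hΩ.mem_nhds h0)
  have hfun : (fun s => radicand A B C φ (s, (t, θ)))
      = fun s => t ^ 2 * C (l s) + s ^ 2 * (t ^ 4 * deriv φ t ^ 2
        * (A (l s) * C (l s) - B (l s) ^ 2)) := by
    funext s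
    simp only [radicand, hl]
    ring
  have hn : ContDiffAt ℝ ∞ (fun s => t ^ 2 * C (l s)) 0 := contDiffAt_const.mul (hcomp h.smooth_C)
  have hk : ContDiffAt ℝ ∞ (fun s => t ^ 4 * deriv φ t ^ 2
      * (A (l s) * C (l s) - B (l s) ^ 2)) 0 :=
    contDiffAt_const.mul (((hcomp h.smooth_A).mul (hcomp h.smooth_C)).sub
      ((hcomp h.smooth_B).pow 2))
  obtain ⟨e1, e2⟩ := deriv_deriv_add_sq_mul hn hk
  have hn1 : ∀ᶠ s in nhds (0 : ℝ), deriv (fun s => t ^ 2 * C (l s)) s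
      = t ^ 2 * (φ t * dirD (1, 0) C (l s)) := by
    filter_upwards [hnear] with s hs using ((hd h.smooth_C s hs).const_mul _).deriv
  rw [hfun, e1, e2, hn1.self_of_nhds, Filter.EventuallyEq.deriv_eq hn1,
    (((hd (contDiffOn_dirD hΩ h.smooth_C _) 0 hnear.self_of_nhds).const_mul
      (φ t)).const_mul (t ^ 2)).deriv, hl0, h.stationary, h.A_zero, h.B_zero, h.C_zero]
  constructor <;> ring

/-- The area of the variation is stationary at `s = 0`, and its second derivative is at most
`L ∫ (t³ φ'² - κ t φ²)`, hence negative. -/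
lemma second_variation (hφ : ContDiffOn ℝ ∞ φ (Ioi 0)) (ha : 0 < a)
    (hneg : ∫ t in Icc a b, (t ^ 3 * deriv φ t ^ 2 - κ * (t * φ t ^ 2)) < 0)
    (h : IsNormalProfile A B C r₀ L κ) :
    ∃ δ > 0, ∃ J₁ : ℝ → ℝ, ∃ J₂ < 0,
      (∀ s ∈ Ioo (-δ) δ, ContinuousOn (fun q => Real.sqrt (radicand A B C φ (s, q)))
        (Icc a b ×ˢ Icc 0 L)) ∧
      (∀ s ∈ Ioo (-δ) δ, HasDerivAt
        (fun s => ∫ q in Icc a b ×ˢ Icc 0 L, Real.sqrt (radicand A B C φ (s, q))) (J₁ s) s) ∧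
      J₁ 0 = 0 ∧ HasDerivAt J₁ J₂ 0 := by
  set K : Set (ℝ × ℝ) := Icc a b ×ˢ Icc 0 L with hK
  have hKc : IsCompact K := isCompact_Icc.prod isCompact_Icc
  have hKm : MeasurableSet K := measurableSet_Icc.prod measurableSet_Icc
  set D := varDomain φ r₀ ∩ radicand A B C φ ⁻¹' Ioi 0 with hD
  have hDo : IsOpen D := (contDiffOn_radicand hφ h).continuousOn.isOpen_inter_preimage
    (isOpen_varDomain hφ) isOpen_Ioi
  have h0D : ∀ q : ℝ × ℝ, 0 < q.1 → (0, q) ∈ D := by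
    rintro ⟨t, θ⟩ ht
    refine ⟨mem_varDomain.2 ⟨ht, by simpa using h.pos⟩, ?_⟩
    rw [mem_preimage, radicand_zero h]
    exact pow_pos ht 2
  have hK0 : ∀ q ∈ K, 0 < q.1 := fun q hq => ha.trans_le hq.1.1
  obtain ⟨δ, hδ, hsub⟩ := exists_Ioo_prod_subset hDo hKc fun q hq => h0D q (hK0 q hq)
  have h0δ : (0 : ℝ) ∈ Ioo (-δ) δ := ⟨by linarith, hδ⟩
  set H : ℝ × (ℝ × ℝ) → ℝ := fun z => Real.sqrt (radicand A B C φ z) with hH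
  have hHs : ContDiffOn ℝ ∞ H D :=
    ((contDiffOn_radicand hφ h).mono inter_subset_left).sqrt fun z hz => (ne_of_gt hz.2)
  have hcrit : ∀ q ∈ K, paramD H (0, q) = 0 := by
    rintro ⟨t, θ⟩ hq
    have hmem := h0D _ (hK0 _ hq)
    rw [← (hasDerivAt_paramD hDo hHs hmem).deriv]
    have hd := hasDerivAt_paramD (isOpen_varDomain hφ) (contDiffOn_radicand hφ h) hmem.1
    rw [← hd.deriv, (deriv_radicand h t θ).1] at hd
    rw [(hd.sqrt (ne_of_gt hmem.2)).deriv, zero_div]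
  have hsecond : ∀ q ∈ K, paramD (paramD H) (0, q) = q.1 ^ 3 * deriv φ q.1 ^ 2
      + q.1 * φ q.1 ^ 2 * (dirD (1, 0) (dirD (1, 0) C) (0, q.2) / 2) := by
    rintro ⟨t, θ⟩ hq
    have ht : 0 < t := hK0 _ hq
    have hmem := h0D (t, θ) ht
    have hns : ContDiffAt ℝ ∞ (fun s => radicand A B C φ (s, (t, θ))) 0 :=
      ContDiffAt.comp (0 : ℝ) ((contDiffOn_radicand hφ h).contDiffAt
        ((isOpen_varDomain hφ).mem_nhds hmem.1)) (by fun_prop)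
    rw [← deriv_deriv_eq_paramD hDo hHs hmem, hH,
      deriv_deriv_sqrt hns hmem.2 (deriv_radicand h t θ).1, (deriv_radicand h t θ).2,
      radicand_zero h, Real.sqrt_sq ht.le]
    field_simp
    ring
  refine ⟨δ, hδ, fun s => ∫ q in K, paramD H (s, q), ∫ q in K, paramD (paramD H) (0, q), ?_,
    fun s hs => hHs.continuousOn.comp (by fun_prop)
      fun q hq => hsub ⟨hs, hq⟩, fun s hs => hasDerivAt_setIntegral hDo hHs hKc hKm hsub hs, ?_,
    hasDerivAt_setIntegral hDo (contDiffOn_paramD hDo hHs) hKc hKm hsub h0δ⟩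
  · rw [setIntegral_congr_fun hKm hsecond]
    have hφc : ContinuousOn φ (Icc a b) := hφ.continuousOn.mono fun t ht => ha.trans_le ht.1
    have hφ'c : ContinuousOn (deriv φ) (Icc a b) :=
      (hφ.deriv_of_isOpen isOpen_Ioi (m := ∞) (by simp)).continuousOn.mono
        fun t ht => ha.trans_le ht.1
    have hCc : ContinuousOn (fun θ => dirD (1, 0) (dirD (1, 0) C) (0, θ) / 2) (Icc 0 L) :=
      ((contDiffOn_dirD (isOpen_strip r₀) (contDiffOn_dirD (isOpen_strip r₀) h.smooth_C _)
        _).continuousOn.comp (by fun_prop) fun θ _ => zero_mem_strip h.pos θ).div_const 2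
    have h1c : ContinuousOn (fun t => t ^ 3 * deriv φ t ^ 2) (Icc a b) := by fun_prop
    have h2c : ContinuousOn (fun t => t * φ t ^ 2) (Icc a b) := by fun_prop
    have hint : ∀ {f k : ℝ → ℝ}, ContinuousOn f (Icc a b) → ContinuousOn k (Icc 0 L) →
        IntegrableOn (fun q : ℝ × ℝ => f q.1 * k q.2) K := fun hf hk =>
      ((hf.comp continuousOn_fst fun q hq => hq.1).mul
        (hk.comp continuousOn_snd fun q hq => hq.2)).integrableOn_compact hKc
    have hprod : ∀ f k : ℝ → ℝ, ∫ q in K, f q.1 * k q.2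
        = (∫ t in Icc a b, f t) * ∫ θ in Icc 0 L, k θ := fun f k =>
      setIntegral_prod_mul f k (Icc a b) (Icc 0 L)
    have e1 : ∫ q in K, q.1 ^ 3 * deriv φ q.1 ^ 2
        = (∫ t in Icc a b, t ^ 3 * deriv φ t ^ 2) * L := by
      have := hprod (fun t => t ^ 3 * deriv φ t ^ 2) (fun _ => 1)
      simpa [h.len_pos.le] using this
    have i1 : IntegrableOn (fun q : ℝ × ℝ => q.1 ^ 3 * deriv φ q.1 ^ 2) K := by
      simpa using hint h1c (continuousOn_const (c := (1 : ℝ)))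
    rw [integral_add i1 (hint h2c hCc), e1,
      hprod (fun t => t * φ t ^ 2) (fun θ => dirD (1, 0) (dirD (1, 0) C) (0, θ) / 2)]
    rw [integral_sub h1c.integrableOn_Icc (h2c.integrableOn_Icc.const_mul κ),
      integral_const_mul] at hneg
    have hnn : 0 ≤ ∫ t in Icc a b, t * φ t ^ 2 :=
      setIntegral_nonneg measurableSet_Icc fun t ht =>
        mul_nonneg (ha.le.trans ht.1) (sq_nonneg _)
    nlinarith [mul_le_mul_of_nonneg_left h.second_le hnn, mul_neg_of_neg_of_pos hneg h.len_pos]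
  · simpa using setIntegral_congr_fun (g := fun _ => (0 : ℝ)) hKm hcrit

end SecondVariation

section AreaElement

/-! ### The variation of the cone -/

/-- The map `(t, θ) ↦ (t, E (s φ(t), θ))` at time `s` of the variation of the cone. -/
def variation (E : ℝ × ℝ → M) (φ : ℝ → ℝ) (s : ℝ) (q : ℝ × ℝ) : ℝ × M :=
  (q.1, E (s * φ q.1, q.2))

variable {g : SurfaceMetric M} {E : ℝ × ℝ → M} {φ : ℝ → ℝ} {r₀ L κ a b : ℝ}

omit [IsManifold 𝓘(ℝ, Plane) ∞ M] in
lemma contMDiffOn_variation (hφ : ContDiffOn ℝ ∞ φ (Ioi 0))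
    (hE : ContMDiffOn 𝓘(ℝ, ℝ × ℝ) 𝓘(ℝ, Plane) ∞ E (strip r₀)) :
    ContMDiffOn 𝓘(ℝ, ℝ × (ℝ × ℝ)) coneModel ∞
      (fun z : ℝ × (ℝ × ℝ) => variation E φ z.1 z.2) (varDomain φ r₀) := by
  refine ContMDiffOn.prodMk ?_ ?_
  · exact (contDiff_fst.comp contDiff_snd).contMDiff.contMDiffOn
  · exact hE.comp (contMDiffOn_iff_contDiffOn.2 ((contDiffOn_shift hφ).mono inter_subset_left))
      fun z hz => hz.2

lemma metricAt_smul_left (x : M) (k : ℝ) (v w : Plane) :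
    metricAt g x (k • v) w = k * metricAt g x v w := by
  have : g.inner x (k • (show TangentSpace 𝓘(ℝ, Plane) x from v)) = k • g.inner x v :=
    (g.inner x).map_smul k v
  exact DFunLike.congr_fun this w

lemma metricAt_symm (x : M) (v w : Plane) : metricAt g x v w = metricAt g x w v := g.symm x v w

lemma areaElement_variation (hφ : ContDiffOn ℝ ∞ φ (Ioi 0))
    (hE : ContMDiffOn 𝓘(ℝ, ℝ × ℝ) 𝓘(ℝ, Plane) ∞ E (strip r₀)) {s : ℝ} {q : ℝ × ℝ}
    (hq : (s, q) ∈ varDomain φ r₀) :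
    areaElement g (variation E φ s) q = Real.sqrt (radicand (pullback g E (1, 0) (1, 0))
      (pullback g E (1, 0) (0, 1)) (pullback g E (0, 1) (0, 1)) φ (s, q)) := by
  obtain ⟨t, θ⟩ := q
  obtain ⟨ht, hst⟩ := mem_varDomain.1 hq
  have hφt : HasDerivAt φ (deriv φ t) t :=
    (hφ.differentiableAt_of_isOpen isOpen_Ioi ht).hasDerivAt
  have hEd : MDifferentiableAt 𝓘(ℝ, ℝ × ℝ) 𝓘(ℝ, Plane) E (s * φ t, θ) :=
    (hE.contMDiffAt ((isOpen_strip r₀).mem_nhds (mem_strip.2 hst))).mdifferentiableAt (by simp)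
  have hγ : HasFDerivAt (fun q : ℝ × ℝ => (s * φ q.1, q.2))
      (((s * deriv φ t) • ContinuousLinearMap.fst ℝ ℝ ℝ).prod (ContinuousLinearMap.snd ℝ ℝ ℝ))
      (t, θ) := by
    refine HasFDerivAt.prodMk ?_ hasFDerivAt_snd
    exact HasDerivAt.comp_hasFDerivAt (h₂ := fun y => s * φ y) (f := Prod.fst) ((t, θ) : ℝ × ℝ)
      (hφt.const_mul s) hasFDerivAt_fst
  have hX : HasMFDerivAt 𝓘(ℝ, ℝ × ℝ) coneModel (variation E φ s) (t, θ) _ :=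
    HasMFDerivAt.prodMk (hasFDerivAt_fst (𝕜 := ℝ) (p := ((t, θ) : ℝ × ℝ))).hasMFDerivAt
      (HasMFDerivAt.comp ((t, θ) : ℝ × ℝ) (g := E) (f := fun q : ℝ × ℝ => (s * φ q.1, q.2))
        hEd.hasMFDerivAt hγ.hasMFDerivAt)
  have hin : ∀ v w : ℝ × ℝ, coneInner g (variation E φ s (t, θ))
      (tangentVec (variation E φ s) (t, θ) v) (tangentVec (variation E φ s) (t, θ) w)
      = v.1 * w.1 + t ^ 2 * pullback g E (s * deriv φ t * v.1, v.2) (s * deriv φ t * w.1, w.2)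
        (s * φ t, θ) := by
    intro v w
    unfold tangentVec
    rw [hX.mfderiv]
    rfl
  have e1 : (mfderiv 𝓘(ℝ, ℝ × ℝ) 𝓘(ℝ, Plane) E (s * φ t, θ) (s * deriv φ t, (0 : ℝ)) : Plane)
      = (s * deriv φ t) • (show Plane from
        mfderiv 𝓘(ℝ, ℝ × ℝ) 𝓘(ℝ, Plane) E (s * φ t, θ) ((1 : ℝ), (0 : ℝ))) := by
    refine Eq.trans ?_ ((mfderiv 𝓘(ℝ, ℝ × ℝ) 𝓘(ℝ, Plane) E (s * φ t, θ)).map_smul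
      (s * deriv φ t) ((1 : ℝ), (0 : ℝ)))
    congr 1
    change _ = (s * deriv φ t) • ((1 : ℝ), (0 : ℝ))
    simp
  have e2 : ∀ w : ℝ × ℝ, pullback g E (s * deriv φ t, 0) w (s * φ t, θ)
      = s * deriv φ t * pullback g E (1, 0) w (s * φ t, θ) := fun w =>
    (congrArg (fun v => metricAt g (E (s * φ t, θ)) v _) e1).trans (metricAt_smul_left _ _ _ _)
  have e3 : ∀ v w : ℝ × ℝ, pullback g E v w (s * φ t, θ) = pullback g E w v (s * φ t, θ) :=
    fun v w => metricAt_symm _ _ _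
  rw [areaElement, hin, hin, hin]
  simp only [mul_one, mul_zero, zero_add]
  rw [e2, e2, e3 (1, 0) (s * deriv φ t, 0), e2]
  congr 1
  unfold radicand
  ring

/-- The pointwise inequality of `curvature_equation` is integrated over the closed curve, where the
term `∂_θ ∂_r B` drops out by periodicity. -/
lemma isNormalProfile_of_family (hr₀ : 0 < r₀) (hL : 0 < L)
    (hE : ContMDiffOn 𝓘(ℝ, ℝ × ℝ) 𝓘(ℝ, Plane) ∞ E (strip r₀))
    (hp : ∀ r ∈ Ioo (-r₀) r₀, Function.Periodic (fun θ => E (r, θ)) L)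
    (hA : ∀ θ, pullback g E (1, 0) (1, 0) (0, θ) = 1)
    (hB : ∀ θ, pullback g E (1, 0) (0, 1) (0, θ) = 0)
    (hC : ∀ θ, pullback g E (0, 1) (0, 1) (0, θ) = 1)
    (hcurv : ∀ θ, dirD (1, 0) (pullback g E (0, 1) (0, 1)) (0, θ) = 0 ∧
        dirD (1, 0) (dirD (1, 0) (pullback g E (0, 1) (0, 1))) (0, θ) / 2
          ≤ -κ + dirD (0, 1) (dirD (1, 0) (pullback g E (1, 0) (0, 1))) (0, θ)) :
    IsNormalProfile (pullback g E (1, 0) (1, 0)) (pullback g E (1, 0) (0, 1))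
      (pullback g E (0, 1) (0, 1)) r₀ L κ where
  pos := hr₀
  len_pos := hL
  smooth_A := contDiffOn_pullback (isOpen_strip r₀) hE _ _
  smooth_B := contDiffOn_pullback (isOpen_strip r₀) hE _ _
  smooth_C := contDiffOn_pullback (isOpen_strip r₀) hE _ _
  A_zero := hA
  B_zero := hB
  C_zero := hC
  stationary θ := (hcurv θ).1
  second_le := by
    have hΩ := isOpen_strip r₀
    have hd : ∀ {F : ℝ × ℝ → ℝ}, ContDiffOn ℝ ∞ F (strip r₀) →
        Continuous fun θ => F (0, θ) := fun hF =>
      hF.continuousOn.comp_continuous (by fun_prop) fun θ => zero_mem_strip hr₀ θ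
    have hCs := contDiffOn_pullback (g := g) hΩ hE (0, 1) (0, 1)
    have hBs := contDiffOn_pullback (g := g) hΩ hE (1, 0) (0, 1)
    have hBr := contDiffOn_dirD hΩ hBs (1, 0)
    have hperB : ∀ r ∈ Ioo (-r₀) r₀, pullback g E (1, 0) (0, 1) (r, L)
        = pullback g E (1, 0) (0, 1) (r, 0) := by
      intro r hr
      have hmem : ∀ θ, (r, θ) ∈ strip r₀ := fun θ => mem_strip.2 hr
      have hdE : MDifferentiableAt 𝓘(ℝ, ℝ × ℝ) 𝓘(ℝ, Plane) E (r, L) :=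
        (hE.contMDiffAt (hΩ.mem_nhds (hmem L))).mdifferentiableAt (by simp)
      have htr : HasFDerivAt (fun q : ℝ × ℝ => (q.1, q.2 + L))
          (ContinuousLinearMap.id ℝ (ℝ × ℝ)) ((r, 0) : ℝ × ℝ) := by
        have := (hasFDerivAt_id (𝕜 := ℝ) ((r, 0) : ℝ × ℝ)).add_const ((0 : ℝ), L)
        refine this.congr_of_eventuallyEq (Filter.Eventually.of_forall fun q => ?_)
        ext <;> simp
      have hdE' : MDifferentiableAt 𝓘(ℝ, ℝ × ℝ) 𝓘(ℝ, Plane) E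
        ((fun q : ℝ × ℝ => (q.1, q.2 + L)) (r, 0)) := by simpa using hdE
      have hc := HasMFDerivAt.comp ((r, 0) : ℝ × ℝ) (g := E)
        (f := fun q : ℝ × ℝ => (q.1, q.2 + L)) hdE'.hasMFDerivAt htr.hasMFDerivAt
      have hev : E =ᶠ[nhds ((r, 0) : ℝ × ℝ)] E ∘ fun q : ℝ × ℝ => (q.1, q.2 + L) := by
        filter_upwards [hΩ.mem_nhds (hmem 0)] with q hq
        exact (hp q.1 (mem_strip.1 hq) q.2).symm
      have h1 := hc.congr_of_eventuallyEq hev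
      have h2 : ∀ v : ℝ × ℝ, (mfderiv 𝓘(ℝ, ℝ × ℝ) 𝓘(ℝ, Plane) E (r, 0) v : Plane)
          = mfderiv 𝓘(ℝ, ℝ × ℝ) 𝓘(ℝ, Plane) E (r, L) v := by
        intro v
        rw [h1.mfderiv]
        have : ((r, (0 : ℝ) + L) : ℝ × ℝ) = (r, L) := by simp
        rw [← this]
        rfl
      have h3 : E (r, L) = E (r, 0) := by simpa using hp r hr 0
      unfold pullback
      rw [h2, h2, h3]
    have hper : dirD (1, 0) (pullback g E (1, 0) (0, 1)) (0, L)
        = dirD (1, 0) (pullback g E (1, 0) (0, 1)) (0, 0) := by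
      have h1 := fun θ => hasDerivAt_horizontal
        (hBs.differentiableAt_of_isOpen hΩ (zero_mem_strip hr₀ θ))
      rw [← (h1 L).deriv, ← (h1 0).deriv]
      apply Filter.EventuallyEq.deriv_eq
      filter_upwards [isOpen_Ioo.mem_nhds (show (0 : ℝ) ∈ Ioo (-r₀) r₀ by simpa using hr₀)]
        with r hr using hperB r hr
    have hle : ∀ θ, dirD (1, 0) (dirD (1, 0) (pullback g E (0, 1) (0, 1))) (0, θ) / 2
          ≤ -κ + dirD (0, 1) (dirD (1, 0) (pullback g E (1, 0) (0, 1))) (0, θ) :=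
      fun θ => (hcurv θ).2
    have hc1 : Continuous fun θ =>
        dirD (1, 0) (dirD (1, 0) (pullback g E (0, 1) (0, 1))) (0, θ) / 2 :=
      (hd (contDiffOn_dirD hΩ (contDiffOn_dirD hΩ hCs _) _)).div_const 2
    have hc2 : Continuous fun θ =>
        dirD (0, 1) (dirD (1, 0) (pullback g E (1, 0) (0, 1))) (0, θ) :=
      hd (contDiffOn_dirD hΩ hBr _)
    have hc3 : Continuous fun θ =>
        -κ + dirD (0, 1) (dirD (1, 0) (pullback g E (1, 0) (0, 1))) (0, θ) :=
      continuous_const.add hc2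
    rw [integral_Icc_eq_integral_Ioc, ← intervalIntegral.integral_of_le hL.le]
    refine (intervalIntegral.integral_mono hL.le (hc1.intervalIntegrable _ _)
      (hc3.intervalIntegrable _ _) hle).trans ?_
    rw [intervalIntegral.integral_add (by simp) (hc2.intervalIntegrable _ _),
      intervalIntegral.integral_eq_sub_of_hasDerivAt
        (fun θ _ => hasDerivAt_vertical (hBr.differentiableAt_of_isOpen hΩ (zero_mem_strip hr₀ θ)))
        (hc2.intervalIntegrable _ _), hper]
    simp [mul_comm]

end AreaElement

section Instability

/-! ### Instability -/

lemma exists_pos_forall_le {m : ℕ} {f : Fin m → ℝ} (hf : ∀ j, 0 < f j) :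
    ∃ δ > 0, ∀ j, δ ≤ f j := by
  rcases isEmpty_or_nonempty (Fin m) with h | h
  · exact ⟨1, one_pos, fun j => h.elim j⟩
  · obtain ⟨i, hi⟩ := Finite.exists_min f
    exact ⟨f i, hf i, hi⟩

lemma exists_abs_le_of_eq_zero_off {φ : ℝ → ℝ} {a b : ℝ} (ha : 0 < a) (hab : a < b)
    (hφ : ContinuousOn φ (Ioi 0)) (hφ0 : ∀ t, 0 < t → t ∉ Ioo a b → φ t = 0) :
    ∃ B, ∀ t, 0 < t → |φ t| ≤ B := by
  obtain ⟨B, hB⟩ := isCompact_Icc.exists_bound_of_continuousOn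
    (hφ.mono fun t (ht : t ∈ Icc a b) => ha.trans_le ht.1)
  refine ⟨B, fun t ht => ?_⟩
  by_cases htab : t ∈ Ioo a b
  · exact hB t (Ioo_subset_Icc_self htab)
  · rw [hφ0 t ht htab, abs_zero]
    exact (norm_nonneg _).trans (hB a (left_mem_Icc.2 hab.le))

/-- A deformation of the cone over `Σ` by the maps `(t, θ) ↦ (t, E_j (s φ(t), θ))`, `|s| < δ`, whose
total area is stationary and has a negative second derivative at `s = 0`. -/
structure Deformation {g : SurfaceMetric M} {m : ℕ} (S : ClosedCurves g m) where
  /-- the family of curves around each component of `Σ` -/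
  E : Fin m → ℝ × ℝ → M
  /-- the half width of the strip on which the family is defined -/
  r₀ : Fin m → ℝ
  /-- the radial cutoff -/
  φ : ℝ → ℝ
  /-- lower bound of the support of the cutoff -/
  a : ℝ
  /-- upper bound of the support of the cutoff -/
  b : ℝ
  /-- the range of the time parameter -/
  δ : ℝ
  r₀_pos : ∀ j, 0 < r₀ j
  smooth_E : ∀ j, ContMDiffOn 𝓘(ℝ, ℝ × ℝ) 𝓘(ℝ, Plane) ∞ (E j) (strip (r₀ j))
  periodic : ∀ j, ∀ r ∈ Ioo (-r₀ j) (r₀ j), Function.Periodic (fun θ => E j (r, θ)) (S.len j)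
  E_zero : ∀ j θ, E j (0, θ) = S.curve j θ
  immersion : ∀ j θ, pullback g (E j) (0, 1) (0, 1) (0, θ) = 1
  a_pos : 0 < a
  a_lt_b : a < b
  smooth_φ : ContDiffOn ℝ ∞ φ (Ioi 0)
  φ_eq_zero : ∀ t, 0 < t → t ∉ Ioo a b → φ t = 0
  δ_pos : 0 < δ
  mem_varDomain : ∀ s ∈ Ioo (-δ) δ, ∀ j (q : ℝ × ℝ), 0 < q.1 → (s, q) ∈ varDomain φ (r₀ j)
  continuousOn_area : ∀ s ∈ Ioo (-δ) δ, ∀ j, ContinuousOn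
    (areaElement g (variation (E j) φ s)) (Icc a b ×ˢ Icc 0 (S.len j))
  second_variation : ∃ (J₁ : ℝ → ℝ) (J₂ : ℝ), J₂ < 0 ∧ J₁ 0 = 0 ∧ HasDerivAt J₁ J₂ 0 ∧
    ∀ s ∈ Ioo (-δ) δ, HasDerivAt (fun s => ∑ j, ∫ q in Icc a b ×ˢ Icc 0 (S.len j),
      areaElement g (variation (E j) φ s) q) (J₁ s) s

lemma exists_deformation {g : SurfaceMetric M} {κ : ℝ} (hκ : 1 < κ) (hK : GaussCurvatureGE g κ)
    {m : ℕ} (hm : 0 < m) (S : ClosedCurves g m) (hmin : S.IsMinimal) (hside : S.IsTwoSided) :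
    Nonempty (Deformation S) := by
  obtain ⟨φ, a, b, ha, hab, hφ, hφ0, hneg⟩ := exists_radial_cutoff hκ
  choose E r₀ hr₀ hE hp hE0 hA hB hC hcurv using exists_normal_family hK S hmin hside
  have hprof := fun j => isNormalProfile_of_family (hr₀ j) (S.len_pos j) (hE j) (hp j) (hA j)
    (hB j) (hC j) (hcurv j)
  choose δ₁ hδ₁ J₁ J₂ hJ₂ hcont hder hJ₁0 hder2 using
    fun j => second_variation hφ ha hneg (hprof j)
  obtain ⟨Bφ, hBφ⟩ := exists_abs_le_of_eq_zero_off ha hab hφ.continuousOn hφ0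
  have hBφ0 : 0 ≤ Bφ := (abs_nonneg _).trans (hBφ 1 one_pos)
  obtain ⟨δ, hδ, hδle⟩ := exists_pos_forall_le (f := fun j => min (δ₁ j) (r₀ j / (Bφ + 1)))
    fun j => lt_min (hδ₁ j) (div_pos (hr₀ j) (by linarith))
  have hδ1 : ∀ j, ∀ s ∈ Ioo (-δ) δ, s ∈ Ioo (-δ₁ j) (δ₁ j) := fun j s hs => by
    have := (hδle j).trans (min_le_left _ _)
    exact ⟨by linarith [hs.1], by linarith [hs.2]⟩
  have hdom : ∀ s ∈ Ioo (-δ) δ, ∀ j (q : ℝ × ℝ), 0 < q.1 → (s, q) ∈ varDomain φ (r₀ j) := by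
    rintro s hs j ⟨t, θ⟩ ht
    refine mem_varDomain.2 ⟨ht, abs_lt.1 ?_⟩
    have h1 : δ ≤ r₀ j / (Bφ + 1) := (hδle j).trans (min_le_right _ _)
    rw [le_div_iff₀ (by linarith)] at h1
    rw [abs_mul]
    calc |s| * |φ t| ≤ |s| * (Bφ + 1) := by
          gcongr
          linarith [hBφ t ht]
      _ < δ * (Bφ + 1) := by
          gcongr
          exact abs_lt.2 hs
      _ ≤ r₀ j := h1
  have harea : ∀ s ∈ Ioo (-δ) δ, ∀ j, EqOn (areaElement g (variation (E j) φ s))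
      (fun q => Real.sqrt (radicand (pullback g (E j) (1, 0) (1, 0))
        (pullback g (E j) (1, 0) (0, 1)) (pullback g (E j) (0, 1) (0, 1)) φ (s, q)))
      (Icc a b ×ˢ Icc 0 (S.len j)) := fun s hs j q hq =>
    areaElement_variation hφ (hE j) (hdom s hs j q (ha.trans_le hq.1.1))
  refine ⟨⟨E, r₀, φ, a, b, δ, hr₀, hE, hp, hE0, hC, ha, hab, hφ, hφ0, hδ, hdom,
    fun s hs j => (hcont j s (hδ1 j s hs)).congr (harea s hs j),
    fun s => ∑ j, J₁ j s, ∑ j, J₂ j, ?_, ?_, ?_, ?_⟩⟩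
  · have : Nonempty (Fin m) := ⟨⟨0, hm⟩⟩
    exact Finset.sum_neg (fun j _ => hJ₂ j) Finset.univ_nonempty
  · exact Finset.sum_eq_zero fun j _ => hJ₁0 j
  · exact HasDerivAt.fun_sum fun j _ => hder2 j
  · intro s hs
    refine HasDerivAt.fun_sum fun j _ => ?_
    refine (hder j s (hδ1 j s hs)).congr_of_eventuallyEq ?_
    filter_upwards [isOpen_Ioo.mem_nhds hs] with s' hs'
    exact setIntegral_congr_fun (measurableSet_Icc.prod measurableSet_Icc) (harea s' hs' j)

namespace Deformation

variable {g : SurfaceMetric M} {m : ℕ} {S : ClosedCurves g m} (Δ : Deformation S)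

lemma variation_of_φ_eq_zero {s t : ℝ} (j : Fin m) (ht : Δ.φ t = 0) (θ : ℝ) :
    variation (Δ.E j) Δ.φ s (t, θ) = coneMap (S.curve j) (t, θ) := by
  simp [variation, coneMap, ht, Δ.E_zero]

lemma variation_zero (j : Fin m) : variation (Δ.E j) Δ.φ 0 = coneMap (S.curve j) := by
  funext q
  simp [variation, coneMap, Δ.E_zero]

/-- The deformation as a variation of the cone with compact support. -/
def toConeVariation : ConeVariation S where
  δ := Δ.δ
  a := Δ.a
  b := Δ.b
  X s j := variation (Δ.E j) Δ.φ s
  δ_pos := Δ.δ_pos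
  a_pos := Δ.a_pos
  a_le_b := Δ.a_lt_b.le
  smooth j := (contMDiffOn_variation Δ.smooth_φ (Δ.smooth_E j)).mono
    fun z hz => Δ.mem_varDomain z.1 hz.1 j z.2 hz.2.1
  mem_regularPart _ _ _ _ _ ht := ht
  periodic s hs j t θ ht := Prod.ext rfl
    (Δ.periodic j _ (MinCone.mem_varDomain.1 (Δ.mem_varDomain s hs j (t, θ) ht)).2 θ)
  at_zero j t θ _ := congrFun (Δ.variation_zero j) (t, θ)
  fixed _ _ j t θ ht htab := Δ.variation_of_φ_eq_zero j
    (Δ.φ_eq_zero t ht fun h => htab (Ioo_subset_Icc_self h)) θ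

lemma zero_mem : (0 : ℝ) ∈ Ioo (-Δ.δ) Δ.δ := ⟨by linarith [Δ.δ_pos], Δ.δ_pos⟩

lemma not_isStableCone (Δ : Deformation S) : ¬ IsStableCone S := by
  intro hstable
  obtain ⟨J₁, J₂, hJ₂, -, hder2, hder⟩ := Δ.second_variation
  have h1 : deriv Δ.toConeVariation.area =ᶠ[nhds 0] J₁ := by
    filter_upwards [isOpen_Ioo.mem_nhds Δ.zero_mem] with s hs using (hder s hs).deriv
  have h2 := hstable Δ.toConeVariation
  rw [h1.deriv_eq, hder2.deriv] at h2
  linarith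

/-- The area is smaller than that of the cone at arbitrarily small times. -/
lemma exists_area_lt {ε : ℝ} (hε : 0 < ε) : ∃ s ∈ Ioo (-Δ.δ) Δ.δ, |s| < ε ∧
    ∑ j, ∫ q in Icc Δ.a Δ.b ×ˢ Icc 0 (S.len j), areaElement g (variation (Δ.E j) Δ.φ s) q
      < ∑ j, ∫ q in Icc Δ.a Δ.b ×ˢ Icc 0 (S.len j), areaElement g (variation (Δ.E j) Δ.φ 0) q := by
  obtain ⟨J₁, J₂, hJ₂, hJ₁, hder2, hder⟩ := Δ.second_variation
  -- the first derivative is negative just to the right of `0`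
  have hslope := (hasDerivAt_iff_tendsto_slope.1 hder2).eventually (gt_mem_nhds hJ₂)
  rw [eventually_nhdsWithin_iff] at hslope
  obtain ⟨ρ, hρ, hneg⟩ := Metric.eventually_nhds_iff.1 hslope
  set s := min (min ρ ε) Δ.δ / 2 with hs
  have hs0 : 0 < s := half_pos (lt_min (lt_min hρ hε) Δ.δ_pos)
  have hsρ : s < ρ := by
    have := (min_le_left (min ρ ε) Δ.δ).trans (min_le_left _ _)
    linarith
  have hsε : s < ε := by
    have := (min_le_left (min ρ ε) Δ.δ).trans (min_le_right _ _)
    linarith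
  have hsδ : s < Δ.δ := by
    have := min_le_right (min ρ ε) Δ.δ
    linarith
  have hmem : ∀ τ ∈ Icc 0 s, τ ∈ Ioo (-Δ.δ) Δ.δ := fun τ hτ =>
    ⟨by linarith [hτ.1, Δ.δ_pos], by linarith [hτ.2]⟩
  refine ⟨s, hmem s ⟨hs0.le, le_rfl⟩, by rwa [abs_of_pos hs0], ?_⟩
  refine strictAntiOn_of_deriv_neg (convex_Icc 0 s)
    (fun τ hτ => (hder τ (hmem τ hτ)).continuousAt.continuousWithinAt) ?_
    (left_mem_Icc.2 hs0.le) (right_mem_Icc.2 hs0.le) hs0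
  intro τ hτ
  rw [interior_Icc] at hτ
  rw [(hder τ (hmem τ (Ioo_subset_Icc_self hτ))).deriv]
  have h := hneg (y := τ) (by
    rw [Real.dist_eq, sub_zero, abs_of_pos hτ.1]
    exact hτ.2.trans hsρ) hτ.1.ne'
  rw [slope_def_field, hJ₁, sub_zero, sub_zero, div_neg_iff] at h
  rcases h with h | h
  · linarith [hτ.1, h.2]
  · exact h.1

end Deformation

end Instability

section Embeddedness

/-! ### Embeddedness of the deformed surfaces -/

/-- A family of immersed curves is locally injective in the parameter of the curve. -/
lemma exists_local_injective {g : SurfaceMetric M} {E : ℝ × ℝ → M} {r₀ : ℝ} (hr₀ : 0 < r₀)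
    (hE : ContMDiffOn 𝓘(ℝ, ℝ × ℝ) 𝓘(ℝ, Plane) ∞ E (strip r₀)) {θ : ℝ}
    (hC : pullback g E (0, 1) (0, 1) (0, θ) ≠ 0) :
    ∃ ε > 0, ∀ r τ τ', |r| < ε → |τ - θ| < ε → |τ' - θ| < ε → E (r, τ) = E (r, τ') → τ = τ' := by
  have he := chart_mem_atlas Plane (E (0, θ))
  set e := chartAt Plane (E (0, θ))
  have hp : ((0 : ℝ), θ) ∈ strip r₀ ∩ E ⁻¹' e.source :=
    ⟨zero_mem_strip hr₀ θ, mem_chart_source Plane (E (0, θ))⟩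
  have hΩ := isOpen_strip r₀
  have hW := isOpen_inter_preimage_source (e := e) hΩ hE
  rw [pullback_eq_bil hΩ he hE _ _ hp] at hC
  obtain ⟨k, hk⟩ : ∃ k, dirD (0, 1) (fun q => e (E q) k) (0, θ) ≠ 0 := by
    by_contra! h
    simp [h, bil] at hC
  have hO := (contDiffOn_dirD_chart hΩ he hE (0, 1) k).continuousOn.isOpen_inter_preimage hW
    (isOpen_ne (x := (0 : ℝ)))
  obtain ⟨ε, hε, hsub⟩ := Metric.isOpen_iff.1 hO (0, θ) ⟨hp, hk⟩
  have hmem : ∀ r τ, |r| < ε → |τ - θ| < ε → (r, τ) ∈ (strip r₀ ∩ E ⁻¹' e.source) ∩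
      dirD (0, 1) (fun q => e (E q) k) ⁻¹' {x | x ≠ 0} := fun r τ hr hτ => hsub (by
    rw [Metric.mem_ball, Prod.dist_eq, max_lt_iff]
    simpa [Real.dist_eq] using ⟨hr, hτ⟩)
  have hlt : ∀ r τ τ', |r| < ε → |τ - θ| < ε → |τ' - θ| < ε → E (r, τ) = E (r, τ') → ¬ τ < τ' := by
    intro r τ τ' hr hτ hτ' heq hlt
    have hseg : ∀ x ∈ Icc τ τ', |x - θ| < ε := fun x hx => abs_lt.2
      ⟨by linarith [hx.1, (abs_lt.1 hτ).1], by linarith [hx.2, (abs_lt.1 hτ').2]⟩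
    have hd : ∀ x ∈ Icc τ τ', HasDerivAt (fun x => e (E (r, x)) k)
        (dirD (0, 1) (fun q => e (E q) k) (r, x)) x := fun x hx =>
      hasDerivAt_vertical ((contDiffOn_coord (contDiffOn_chart_comp he hE)
        k).differentiableAt_of_isOpen hW (hmem r x hr (hseg x hx)).1)
    obtain ⟨x, hx, hx0⟩ := exists_hasDerivAt_eq_zero hlt
      (fun x hx => (hd x hx).continuousAt.continuousWithinAt) (by simp only [heq])
      fun x hx => hd x (Ioo_subset_Icc_self hx)
    exact (hmem r x hr (hseg x (Ioo_subset_Icc_self hx))).2 hx0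
  refine ⟨ε, hε, fun r τ τ' hr hτ hτ' heq => ?_⟩
  rcases lt_trichotomy τ τ' with h | h | h
  · exact absurd h (hlt r τ τ' hr hτ hτ' heq)
  · exact h
  · exact absurd h (hlt r τ' τ hr hτ' hτ heq.symm)

namespace Deformation

variable {g : SurfaceMetric M} {m : ℕ} {S : ClosedCurves g m} (Δ : Deformation S)

/-- The curves `E_j (r, ·)` are embedded and disjoint for small `r`. -/
lemma exists_embedded [T2Space M] : ∃ ρ > 0, ∀ r, |r| < ρ → ∀ i j θ θ',
    Δ.E i (r, θ) = Δ.E j (r, θ') → i = j ∧ ∃ k : ℤ, θ' = θ + k * S.len j := by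
  have key : ∀ i j, ∃ ρ > 0, ∀ r, |r| < ρ → ∀ θ θ',
      Δ.E i (r, θ) = Δ.E j (r, θ') → i = j ∧ ∃ k : ℤ, θ' = θ + k * S.len j := by
    intro i j
    set G : Set (ℝ × (ℝ × ℝ)) := {z | Δ.E i (z.1, z.2.1) = Δ.E j (z.1, z.2.2) →
      i = j ∧ ∃ k : ℤ, z.2.2 = z.2.1 + k * S.len j} with hG
    have hcont : ∀ j θ, ContinuousAt (Δ.E j) (0, θ) := fun j θ =>
      (Δ.smooth_E j).continuousOn.continuousAt
        ((isOpen_strip _).mem_nhds (zero_mem_strip (Δ.r₀_pos j) θ))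
    have hint : ∀ q : ℝ × ℝ, (0, q) ∈ interior G := by
      rintro ⟨θ, θ'⟩
      rw [mem_interior_iff_mem_nhds]
      -- coinciding points are handled by local injectivity, distinct ones by the Hausdorff property
      by_cases heq : Δ.E i (0, θ) = Δ.E j (0, θ')
      · have heq' := heq
        rw [Δ.E_zero, Δ.E_zero] at heq'
        obtain ⟨rfl, k, hk⟩ := S.embedded i j θ θ' heq'
        obtain ⟨ε, hε, hinj⟩ := exists_local_injective (Δ.r₀_pos i) (Δ.smooth_E i) (θ := θ)
          (by rw [Δ.immersion]; exact one_ne_zero)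
        filter_upwards [Metric.ball_mem_nhds ((0 : ℝ), (θ, θ'))
          (lt_min hε (Δ.r₀_pos i))] with ⟨r, τ, τ'⟩ hz hE
        simp only [Metric.mem_ball, Prod.dist_eq, max_lt_iff, Real.dist_eq, sub_zero,
          lt_min_iff] at hz
        obtain ⟨⟨z1, z2, z3⟩, z4, -⟩ := hz
        have hper : Δ.E i (r, τ' - k * S.len i) = Δ.E i (r, τ') :=
          (Δ.periodic i r (abs_lt.1 z4)).sub_int_mul_eq k
        have := hinj r τ (τ' - k * S.len i) z1 z2
          (by rw [hk] at z3; convert! z3 using 2; ring) (hE.trans hper.symm)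
        exact ⟨rfl, k, by linarith⟩
      · have h1 : ContinuousAt (fun z : ℝ × (ℝ × ℝ) => Δ.E i (z.1, z.2.1)) (0, (θ, θ')) :=
          ContinuousAt.comp (f := fun z : ℝ × (ℝ × ℝ) => (z.1, z.2.1)) (hcont i θ) (by fun_prop)
        have h2 : ContinuousAt (fun z : ℝ × (ℝ × ℝ) => Δ.E j (z.1, z.2.2)) (0, (θ, θ')) :=
          ContinuousAt.comp (f := fun z : ℝ × (ℝ × ℝ) => (z.1, z.2.2)) (hcont j θ') (by fun_prop)
        filter_upwards [(h1.prodMk h2).preimage_mem_nhds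
          (isClosed_diagonal.isOpen_compl.mem_nhds heq)] with z hz hE using absurd hE hz
    obtain ⟨ρ, hρ, hsub⟩ := exists_Ioo_prod_subset isOpen_interior
      (isCompact_Icc.prod isCompact_Icc : IsCompact (Icc 0 (S.len i) ×ˢ Icc 0 (S.len j)))
      fun q _ => hint q
    refine ⟨min ρ (min (Δ.r₀ i) (Δ.r₀ j)), lt_min hρ (lt_min (Δ.r₀_pos i) (Δ.r₀_pos j)), ?_⟩
    intro r hr θ θ' hE
    simp only [lt_min_iff] at hr
    have hpi := Δ.periodic i r (abs_lt.1 hr.2.1)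
    have hpj := Δ.periodic j r (abs_lt.1 hr.2.2)
    obtain ⟨n, hn, -⟩ := existsUnique_sub_zsmul_mem_Ico (S.len_pos i) θ 0
    obtain ⟨n', hn', -⟩ := existsUnique_sub_zsmul_mem_Ico (S.len_pos j) θ' 0
    simp only [zero_add, zsmul_eq_mul] at hn hn'
    have hE' : Δ.E i (r, θ - n * S.len i) = Δ.E j (r, θ' - n' * S.len j) :=
      (hpi.sub_int_mul_eq n).trans (hE.trans (hpj.sub_int_mul_eq n').symm)
    obtain ⟨rfl, k, hk⟩ := interior_subset (hsub (a := (r, (θ - n * S.len i, θ' - n' * S.len j)))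
      ⟨abs_lt.1 hr.1, Ico_subset_Icc_self hn, Ico_subset_Icc_self hn'⟩) hE'
    refine ⟨rfl, k + n' - n, ?_⟩
    push_cast
    linear_combination hk
  choose ρ hρ hinj using key
  choose ρ' hρ' hle using fun i => exists_pos_forall_le (hρ i)
  obtain ⟨ρ'', hρ'', hle'⟩ := exists_pos_forall_le hρ'
  exact ⟨ρ'', hρ'', fun r hr i j => hinj i j r (hr.trans_le ((hle' i).trans (hle i j)))⟩

end Deformation

end Embeddedness

section Competitor

/-! ### Stokes' theorem on a rectangle -/

/-- The half plane of the parameters `(t, θ)` with `0 < t`. -/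
def halfPlane : Set (ℝ × ℝ) := Ioi 0 ×ˢ univ

lemma isOpen_halfPlane : IsOpen halfPlane := isOpen_Ioi.prod isOpen_univ

/-- Green's formula for `du ∧ dv`, with `u` and `v` periodic in the second variable. -/
lemma setIntegral_wedge {u v : ℝ × ℝ → ℝ} {a b L : ℝ} (ha : 0 < a) (hab : a ≤ b) (hL : 0 ≤ L)
    (hu : ContDiffOn ℝ ∞ u halfPlane) (hv : ContDiffOn ℝ ∞ v halfPlane)
    (hup : ∀ t, 0 < t → u (t, L) = u (t, 0)) (hvp : ∀ t, 0 < t → v (t, L) = v (t, 0)) :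
    ∫ q in Icc a b ×ˢ Icc 0 L,
        (dirD (1, 0) u q * dirD (0, 1) v q - dirD (0, 1) u q * dirD (1, 0) v q)
      = (∫ θ in (0 : ℝ)..L, u (b, θ) * dirD (0, 1) v (b, θ))
        - ∫ θ in (0 : ℝ)..L, u (a, θ) * dirD (0, 1) v (a, θ) := by
  have hP := isOpen_halfPlane
  have hsub : Icc a b ×ˢ Icc 0 L ⊆ halfPlane := fun q hq => ⟨ha.trans_le hq.1.1, mem_univ _⟩
  have hv' := fun c => contDiffOn_dirD hP hv c
  have hu' := fun c => contDiffOn_dirD hP hu c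
  have hd : ∀ {f : ℝ × ℝ → ℝ}, ContDiffOn ℝ ∞ f halfPlane → ∀ q ∈ halfPlane,
      DifferentiableAt ℝ f q := fun hf q hq => hf.differentiableAt_of_isOpen hP hq
  have hf : ContDiffOn ℝ ∞ (fun q => u q * dirD (0, 1) v q) halfPlane := hu.mul (hv' _)
  have hg : ContDiffOn ℝ ∞ (fun q => -(u q * dirD (1, 0) v q)) halfPlane := (hu.mul (hv' _)).neg
  have hdiv : ∀ q ∈ halfPlane, fderiv ℝ (fun q => u q * dirD (0, 1) v q) q (1, 0)
      + fderiv ℝ (fun q => -(u q * dirD (1, 0) v q)) q (0, 1)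
      = dirD (1, 0) u q * dirD (0, 1) v q - dirD (0, 1) u q * dirD (1, 0) v q := by
    intro q hq
    have h1 := dirD_mul (hd hu q hq) (hd (hv' (0, 1)) q hq) (1, 0)
    have h2 := dirD_mul (hd hu q hq) (hd (hv' (1, 0)) q hq) (0, 1)
    rw [dirD] at h1 h2
    rw [fderiv_fun_neg, neg_apply, h1, h2, dirD_comm hP hv hq (0, 1) (1, 0)]
    ring
  have hwc : ContinuousOn (fun q => dirD (1, 0) u q * dirD (0, 1) v q
      - dirD (0, 1) u q * dirD (1, 0) v q) (Icc a b ×ˢ Icc 0 L) :=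
    ((((hu' _).mul (hv' _)).sub ((hu' _).mul (hv' _))).continuousOn).mono hsub
  have hint := hwc.integrableOn_compact (isCompact_Icc.prod isCompact_Icc) (μ := volume)
  have hgreen := integral2_divergence_prod_of_hasFDerivAt (fun q => u q * dirD (0, 1) v q)
    (fun q => -(u q * dirD (1, 0) v q)) (fderiv ℝ fun q => u q * dirD (0, 1) v q)
    (fderiv ℝ fun q => -(u q * dirD (1, 0) v q)) a 0 b L
    (by rw [uIcc_of_le hab, uIcc_of_le hL]; exact hf.continuousOn.mono hsub)
    (by rw [uIcc_of_le hab, uIcc_of_le hL]; exact hg.continuousOn.mono hsub)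
    (by
      rw [min_eq_left hab, min_eq_left hL, max_eq_right hab, max_eq_right hL]
      exact fun q hq => (hd hf q (hsub ⟨Ioo_subset_Icc_self hq.1,
        Ioo_subset_Icc_self hq.2⟩)).hasFDerivAt)
    (by
      rw [min_eq_left hab, min_eq_left hL, max_eq_right hab, max_eq_right hL]
      exact fun q hq => (hd hg q (hsub ⟨Ioo_subset_Icc_self hq.1,
        Ioo_subset_Icc_self hq.2⟩)).hasFDerivAt)
    (by
      rw [uIcc_of_le hab, uIcc_of_le hL]
      exact hint.congr_fun (fun q hq => (hdiv q (hsub hq)).symm)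
        (measurableSet_Icc.prod measurableSet_Icc))
  -- by periodicity the two horizontal sides cancel
  have hper : ∀ t ∈ uIcc a b, -(u (t, L) * dirD (1, 0) v (t, L))
      = -(u (t, 0) * dirD (1, 0) v (t, 0)) := by
    intro t ht
    rw [uIcc_of_le hab] at ht
    have ht0 : 0 < t := ha.trans_le ht.1
    have h1 := fun θ => hasDerivAt_horizontal (hd hv (t, θ) ⟨ht0, mem_univ _⟩)
    have h2 : dirD (1, 0) v (t, L) = dirD (1, 0) v (t, 0) := by
      rw [← (h1 L).deriv, ← (h1 0).deriv]
      apply Filter.EventuallyEq.deriv_eq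
      filter_upwards [isOpen_Ioi.mem_nhds ht0] with τ hτ using hvp τ hτ
    rw [hup t ht0, h2]
  rw [intervalIntegral.integral_congr hper, sub_self, zero_add] at hgreen
  rw [← hgreen, Measure.volume_eq_prod, setIntegral_prod _ hint, integral_Icc_eq_integral_Ioc,
    ← intervalIntegral.integral_of_le hab]
  refine intervalIntegral.integral_congr fun t ht => ?_
  rw [uIcc_of_le hab] at ht
  rw [integral_Icc_eq_integral_Ioc, ← intervalIntegral.integral_of_le hL]
  refine intervalIntegral.integral_congr fun θ hθ => ?_
  exact (hdiv (t, θ) ⟨ha.trans_le ht.1, mem_univ _⟩).symm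

/-- If two functions differ only on a subset where the difference is integrable with integral zero,
then they have the same integral. -/
lemma setIntegral_eq_of_eq_off {w w' : ℝ × ℝ → ℝ} {D K : Set (ℝ × ℝ)} (hD : MeasurableSet D)
    (hKD : K ⊆ D) (hoff : ∀ q ∈ D \ K, w q = w' q) (hw : IntegrableOn w K)
    (hw' : IntegrableOn w' K) (heq : ∫ q in K, w q = ∫ q in K, w' q) :
    ∫ q in D, w q = ∫ q in D, w' q := by
  have hd0 : ∀ q ∈ D \ K, w q - w' q = 0 := fun q hq => sub_eq_zero.2 (hoff q hq)
  have hd : IntegrableOn (fun q => w q - w' q) D :=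
    IntegrableOn.of_forall_sdiff_eq_zero (hw.sub hw') hD hd0
  have hdi : ∫ q in D, (w q - w' q) = 0 := by
    rw [setIntegral_eq_of_subset_of_forall_sdiff_eq_zero hD hKD hd0, integral_sub hw hw', heq,
      sub_self]
  by_cases h : IntegrableOn w' D
  · have hsum := integral_add hd h
    simp only [sub_add_cancel] at hsum
    rw [hsum, hdi, zero_add]
  · rw [integral_undef h, integral_undef]
    intro h'
    exact h ((h'.sub hd).congr (Filter.Eventually.of_forall fun q => by simp))

namespace Deformation

variable {g : SurfaceMetric M} {m : ℕ} {S : ClosedCurves g m} (Δ : Deformation S)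

/-! ### The competitor -/

/-- The deformed cone at time `s`, as a current. -/
def chain (s : ℝ) : ChainData M where
  ι := Fin m
  map j := variation (Δ.E j) Δ.φ s
  dom j := Ioi 0 ×ˢ Ico 0 (S.len j)
  mult _ := 1

/-- The rectangle of the parameters of the `j`-th component that the deformation moves. -/
def box (j : Fin m) : Set (ℝ × ℝ) := Icc Δ.a Δ.b ×ˢ Icc 0 (S.len j)

/-- The part of the rectangle `box` that belongs to the fundamental domain of the parametrization
of the cone. -/
def halfOpenBox (j : Fin m) : Set (ℝ × ℝ) := Icc Δ.a Δ.b ×ˢ Ico 0 (S.len j)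

/-- The compact set swept by the moving parts of the cone and of the deformed cone. -/
def swept (s : ℝ) : Set (ℝ × M) :=
  ⋃ j, variation (Δ.E j) Δ.φ 0 '' Δ.box j ∪ variation (Δ.E j) Δ.φ s '' Δ.box j

lemma chain_zero : Δ.chain 0 = coneCurrent S := by
  simp only [chain, coneCurrent, Δ.variation_zero]

lemma isCompact_box (j : Fin m) : IsCompact (Δ.box j) := isCompact_Icc.prod isCompact_Icc

lemma box_subset (j : Fin m) : Δ.box j ⊆ halfPlane := fun _ hq =>
  ⟨Δ.a_pos.trans_le hq.1.1, mem_univ _⟩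

lemma halfOpenBox_subset_box (j : Fin m) : Δ.halfOpenBox j ⊆ Δ.box j :=
  prod_mono_right Ico_subset_Icc_self

lemma halfOpenBox_subset (j : Fin m) : Δ.halfOpenBox j ⊆ Ioi 0 ×ˢ Ico 0 (S.len j) := fun _ hq =>
  ⟨Δ.a_pos.trans_le hq.1.1, hq.2⟩

lemma halfOpenBox_ae_eq (j : Fin m) : Δ.halfOpenBox j =ᵐ[volume] Δ.box j :=
  Measure.set_prod_ae_eq (Filter.EventuallyEq.refl _ _) Ico_ae_eq_Icc

variable {s : ℝ}

lemma contMDiffOn_variation_halfPlane (hs : s ∈ Ioo (-Δ.δ) Δ.δ) (j : Fin m) :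
    ContMDiffOn 𝓘(ℝ, ℝ × ℝ) coneModel ∞ (variation (Δ.E j) Δ.φ s) halfPlane :=
  (contMDiffOn_variation Δ.smooth_φ (Δ.smooth_E j)).comp
    (f := fun q : ℝ × ℝ => (s, q)) (contDiff_const.prodMk contDiff_id).contMDiff.contMDiffOn
    fun q hq => Δ.mem_varDomain s hs j q hq.1

lemma contDiffOn_comp_variation (hs : s ∈ Ioo (-Δ.δ) Δ.δ) (j : Fin m) {f : ℝ × M → ℝ}
    (hf : IsConeSmooth g f) : ContDiffOn ℝ ∞ (f ∘ variation (Δ.E j) Δ.φ s) halfPlane := by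
  rw [← contMDiffOn_iff_contDiffOn]
  exact hf.1.comp (Δ.contMDiffOn_variation_halfPlane hs j) fun q hq => hq.1

lemma variation_periodic (hs : s ∈ Ioo (-Δ.δ) Δ.δ) (j : Fin m) {t : ℝ} (ht : 0 < t) :
    variation (Δ.E j) Δ.φ s (t, S.len j) = variation (Δ.E j) Δ.φ s (t, 0) := by
  have h := Δ.toConeVariation.periodic s hs j t 0 ht
  rw [zero_add] at h
  exact h

lemma variation_eq_of_notMem (s : ℝ) (j : Fin m) {q : ℝ × ℝ} (hq : 0 < q.1)
    (hq' : q.1 ∉ Ioo Δ.a Δ.b) : variation (Δ.E j) Δ.φ s q = variation (Δ.E j) Δ.φ 0 q := by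
  simp [variation, Δ.φ_eq_zero _ hq hq']

lemma variation_eventuallyEq (s : ℝ) (j : Fin m) {q : ℝ × ℝ} (hq : 0 < q.1)
    (hq' : q.1 ∉ Icc Δ.a Δ.b) :
    variation (Δ.E j) Δ.φ s =ᶠ[nhds q] variation (Δ.E j) Δ.φ 0 := by
  have h1 : IsOpen ((Prod.fst : ℝ × ℝ → ℝ) ⁻¹' (Ioi 0 ∩ (Icc Δ.a Δ.b)ᶜ)) :=
    (isOpen_Ioi.inter isClosed_Icc.isOpen_compl).preimage continuous_fst
  filter_upwards [h1.mem_nhds ⟨hq, hq'⟩] with p hp using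
    Δ.variation_eq_of_notMem s j hp.1 fun h => hp.2 (Ioo_subset_Icc_self h)

lemma wedge_eq_of_notMem (s : ℝ) (j : Fin m) {q : ℝ × ℝ} (hq : 0 < q.1)
    (hq' : q.1 ∉ Icc Δ.a Δ.b) (f h : ℝ × M → ℝ) :
    wedge (variation (Δ.E j) Δ.φ s) f h q = wedge (variation (Δ.E j) Δ.φ 0) f h q := by
  have hev := Δ.variation_eventuallyEq s j hq hq'
  unfold wedge
  rw [(hev.fun_comp f).fderiv_eq, (hev.fun_comp h).fderiv_eq]

lemma sameBoundary (hs : s ∈ Ioo (-Δ.δ) Δ.δ) : SameBoundary g (Δ.chain s) (Δ.chain 0) := by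
  intro f h hf hh _
  have h0 := Δ.zero_mem
  refine tsum_congr fun j : Fin m => ?_
  change (1 : ℤ) * ∫ q in Ioi 0 ×ˢ Ico 0 (S.len j), 1 * wedge (variation (Δ.E j) Δ.φ s) f h q
    = (1 : ℤ) * ∫ q in Ioi 0 ×ˢ Ico 0 (S.len j), 1 * wedge (variation (Δ.E j) Δ.φ 0) f h q
  simp only [one_mul]
  congr 1
  have hwc : ∀ σ ∈ Ioo (-Δ.δ) Δ.δ,
      ContinuousOn (wedge (variation (Δ.E j) Δ.φ σ) f h) halfPlane := fun σ hσ => by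
    have hu := fun c => contDiffOn_dirD isOpen_halfPlane (Δ.contDiffOn_comp_variation hσ j hf) c
    have hv := fun c => contDiffOn_dirD isOpen_halfPlane (Δ.contDiffOn_comp_variation hσ j hh) c
    exact (((hu _).mul (hv _)).sub ((hu _).mul (hv _))).continuousOn
  have hint : ∀ σ ∈ Ioo (-Δ.δ) Δ.δ,
      IntegrableOn (wedge (variation (Δ.E j) Δ.φ σ) f h) (Δ.halfOpenBox j) := fun σ hσ =>
    (((hwc σ hσ).mono (Δ.box_subset j)).integrableOn_compact (Δ.isCompact_box j)).mono_set
      (Δ.halfOpenBox_subset_box j)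
  have hgreen : ∀ σ ∈ Ioo (-Δ.δ) Δ.δ,
      ∫ q in Δ.halfOpenBox j, wedge (variation (Δ.E j) Δ.φ σ) f h q = _ := fun σ hσ =>
    (setIntegral_congr_set (Δ.halfOpenBox_ae_eq j)).trans
      (setIntegral_wedge Δ.a_pos Δ.a_lt_b.le (S.len_pos j).le
        (Δ.contDiffOn_comp_variation hσ j hf) (Δ.contDiffOn_comp_variation hσ j hh)
        (fun t ht => congrArg f (Δ.variation_periodic hσ j ht))
        (fun t ht => congrArg h (Δ.variation_periodic hσ j ht)))
  refine setIntegral_eq_of_eq_off (measurableSet_Ioi.prod measurableSet_Ico)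
    (Δ.halfOpenBox_subset j) ?_ (hint s hs) (hint 0 h0) ?_
  · rintro q ⟨hq, hq'⟩
    exact Δ.wedge_eq_of_notMem s j hq.1 (fun h => hq' ⟨h, hq.2⟩) f h
  · -- the boundary terms agree, as the deformation fixes the circles `t = a` and `t = b`
    have hbd : ∀ t, 0 < t → t ∉ Ioo Δ.a Δ.b → ∀ θ,
        (f ∘ variation (Δ.E j) Δ.φ s) (t, θ)
          * dirD (0, 1) (h ∘ variation (Δ.E j) Δ.φ s) (t, θ)
        = (f ∘ variation (Δ.E j) Δ.φ 0) (t, θ)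
          * dirD (0, 1) (h ∘ variation (Δ.E j) Δ.φ 0) (t, θ) := by
      intro t ht ht' θ
      have heq := fun θ => Δ.variation_eq_of_notMem s j (q := (t, θ)) ht ht'
      have hd := fun σ hσ => (hasDerivAt_vertical ((Δ.contDiffOn_comp_variation (s := σ) hσ j
        hh).differentiableAt_of_isOpen isOpen_halfPlane (u := (t, θ)) ⟨ht, mem_univ _⟩)).deriv
      rw [← hd s hs, ← hd 0 h0]
      simp only [Function.comp, heq]
    rw [hgreen s hs, hgreen 0 h0]
    simp only [hbd Δ.a Δ.a_pos (fun h => lt_irrefl _ h.1),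
      hbd Δ.b (Δ.a_pos.trans Δ.a_lt_b) (fun h => lt_irrefl _ h.2)]

lemma coneCompact_swept (hs : s ∈ Ioo (-Δ.δ) Δ.δ) : ConeCompact (Δ.swept s) := by
  have hfst : ∀ p ∈ Δ.swept s, p.1 ∈ Icc Δ.a Δ.b := by
    intro p hp
    obtain ⟨j, hp⟩ := mem_iUnion.1 hp
    rcases hp with ⟨q, hq, rfl⟩ | ⟨q, hq, rfl⟩ <;> exact hq.1
  have himg : ∀ σ ∈ Ioo (-Δ.δ) Δ.δ, ∀ j, IsCompact (variation (Δ.E j) Δ.φ σ '' Δ.box j) :=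
    fun σ hσ j => (Δ.isCompact_box j).image_of_continuousOn
      ((Δ.contMDiffOn_variation_halfPlane hσ j).continuousOn.mono (Δ.box_subset j))
  have hK : IsCompact (Δ.swept s) :=
    isCompact_iUnion fun j => (himg 0 Δ.zero_mem j).union (himg s hs j)
  exact ⟨fun p hp => Δ.a_pos.trans_le (hfst p hp).1, ⟨Δ.b, fun p hp => (hfst p hp).2⟩,
    fun ε _ => hK.inter_right (isClosed_le continuous_const continuous_fst)⟩

lemma agreeOff (s : ℝ) : AgreeOff g (Δ.chain s) (Δ.chain 0) (Δ.swept s) := by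
  rintro ψ f h - - - ⟨K', -, hdisj, hψ⟩
  refine tsum_congr fun j : Fin m => ?_
  change (1 : ℤ) * ∫ q in Ioi 0 ×ˢ Ico 0 (S.len j),
      ψ (variation (Δ.E j) Δ.φ s q) * wedge (variation (Δ.E j) Δ.φ s) f h q
    = (1 : ℤ) * ∫ q in Ioi 0 ×ˢ Ico 0 (S.len j),
      ψ (variation (Δ.E j) Δ.φ 0 q) * wedge (variation (Δ.E j) Δ.φ 0) f h q
  congr 1
  refine setIntegral_congr_fun (measurableSet_Ioi.prod measurableSet_Ico) fun q hq => ?_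
  by_cases hq1 : q.1 ∈ Icc Δ.a Δ.b
  · have hbox : q ∈ Δ.box j := ⟨hq1, Ico_subset_Icc_self hq.2⟩
    have hzero : ∀ p : ℝ × M, 0 < p.1 → p ∈ Δ.swept s → ψ p = 0 := fun p hp hps =>
      hψ p hp fun hpK => disjoint_left.1 hdisj hpK hps
    rw [hzero (variation (Δ.E j) Δ.φ s q) hq.1 (mem_iUnion.2 ⟨j, Or.inr ⟨q, hbox, rfl⟩⟩),
      hzero (variation (Δ.E j) Δ.φ 0 q) hq.1 (mem_iUnion.2 ⟨j, Or.inl ⟨q, hbox, rfl⟩⟩)]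
    simp
  · rw [(Δ.variation_eventuallyEq s j hq.1 hq1).eq_of_nhds,
      Δ.wedge_eq_of_notMem s j hq.1 hq1]

/-- The variation preserves the distance `t` from the vertex, so that the swept set is met exactly
by the points whose parameters lie in the rectangles. -/
lemma mass_swept {s σ : ℝ} (hσ : σ ∈ Ioo (-Δ.δ) Δ.δ) (h : σ = 0 ∨ σ = s) :
    (Δ.chain σ).mass g (Δ.swept s) = ENNReal.ofReal
      (∑ j, ∫ q in Icc Δ.a Δ.b ×ˢ Icc 0 (S.len j), areaElement g (variation (Δ.E j) Δ.φ σ) q) := by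
  have hpre : ∀ j : Fin m, (Ioi (0 : ℝ) ×ˢ Ico 0 (S.len j)) ∩
      variation (Δ.E j) Δ.φ σ ⁻¹' Δ.swept s = Δ.halfOpenBox j := by
    intro j
    ext q
    constructor
    · rintro ⟨hq, hqs⟩
      obtain ⟨i, hp⟩ := mem_iUnion.1 hqs
      refine ⟨?_, hq.2⟩
      rcases hp with ⟨q', hq', heq⟩ | ⟨q', hq', heq⟩ <;>
      · have : q'.1 = q.1 := congrArg (Prod.fst : ℝ × M → ℝ) heq
        exact this ▸ hq'.1
    · intro hq
      refine ⟨Δ.halfOpenBox_subset j hq, mem_iUnion.2 ⟨j, ?_⟩⟩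
      rcases h with rfl | rfl
      · exact Or.inl ⟨q, Δ.halfOpenBox_subset_box j hq, rfl⟩
      · exact Or.inr ⟨q, Δ.halfOpenBox_subset_box j hq, rfl⟩
  have hnonneg : ∀ j ∈ Finset.univ, 0 ≤ ∫ q in Icc Δ.a Δ.b ×ˢ Icc 0 (S.len j),
      areaElement g (variation (Δ.E j) Δ.φ σ) q := fun j _ =>
    setIntegral_nonneg (measurableSet_Icc.prod measurableSet_Icc) fun q _ => Real.sqrt_nonneg _
  rw [ENNReal.ofReal_sum_of_nonneg hnonneg]
  rw [ChainData.mass, ← tsum_fintype (L := SummationFilter.unconditional (Fin m))]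
  refine tsum_congr fun j : Fin m => ?_
  change ((1 : ℤ).natAbs : ENNReal) * ∫⁻ q in (Ioi (0 : ℝ) ×ˢ Ico 0 (S.len j)) ∩
    variation (Δ.E j) Δ.φ σ ⁻¹' Δ.swept s,
      ENNReal.ofReal (areaElement g (variation (Δ.E j) Δ.φ σ) q) = _
  rw [hpre, setLIntegral_congr (Δ.halfOpenBox_ae_eq j), ← ofReal_integral_eq_lintegral_ofReal
    ((Δ.continuousOn_area σ hσ j).integrableOn_compact (Δ.isCompact_box j))
    (Filter.Eventually.of_forall fun q => Real.sqrt_nonneg _)]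
  simp [box]

lemma isIntegerRectifiable (hs : s ∈ Ioo (-Δ.δ) Δ.δ)
    (hinj : ∀ t, 0 < t → ∀ i j θ θ', Δ.E i (s * Δ.φ t, θ) = Δ.E j (s * Δ.φ t, θ') →
      i = j ∧ ∃ k : ℤ, θ' = θ + k * S.len j) :
    (Δ.chain s).IsIntegerRectifiable g where
  countable := inferInstanceAs (Countable (Fin m))
  measurable _ := measurableSet_Ioi.prod measurableSet_Ico
  c1 j := ⟨halfPlane, isOpen_halfPlane, prod_mono_right (subset_univ _),
    (Δ.contMDiffOn_variation_halfPlane hs j).of_le (by norm_cast)⟩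
  mem_regularPart _ _ hq := hq.1
  injective := by
    rintro j ⟨t, θ⟩ hq ⟨t', θ'⟩ hq' heq
    obtain rfl : t = t' := congrArg Prod.fst heq
    obtain ⟨-, k, hk⟩ := hinj t hq.1 j j θ θ' (congrArg Prod.snd heq)
    have h1 : 0 ≤ θ ∧ θ < S.len j := hq.2
    have h2 : 0 ≤ θ' ∧ θ' < S.len j := hq'.2
    have hL := S.len_pos j
    have hk1 : (k : ℝ) < 1 := by
      by_contra! hc
      nlinarith
    have hk2 : (-1 : ℝ) < k := by
      by_contra! hc
      nlinarith
    obtain rfl : k = 0 := by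
      have h1 : k < 1 := by exact_mod_cast hk1
      have h2 : -1 < k := by exact_mod_cast hk2
      omega
    simp [hk]
  disjoint := by
    intro i j hij
    rw [disjoint_left]
    rintro p ⟨⟨t, θ⟩, hq, rfl⟩ ⟨⟨t', θ'⟩, hq', heq⟩
    obtain rfl : t' = t := congrArg Prod.fst heq
    exact hij (hinj t' hq.1 i j θ θ' (congrArg Prod.snd heq).symm).1
  finite_mass := by
    rintro K ⟨hK, ⟨R, hR⟩, -⟩
    rw [ChainData.mass]
    refine (tsum_fintype (L := SummationFilter.unconditional (Fin m)) _).trans_lt ?_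
    refine ENNReal.sum_lt_top.2 fun j _ => ENNReal.mul_lt_top (ENNReal.natCast_lt_top _) ?_
    obtain ⟨B, hB⟩ := (Δ.isCompact_box j).exists_bound_of_continuousOn (Δ.continuousOn_area s hs j)
    have hsub : (Ioi (0 : ℝ) ×ˢ Ico 0 (S.len j)) ∩ variation (Δ.E j) Δ.φ s ⁻¹' K
        ⊆ Ioc 0 R ×ˢ Ico 0 (S.len j) := fun q hq => ⟨⟨hq.1.1, hR _ hq.2⟩, hq.1.2⟩
    refine (lintegral_mono_set hsub).trans_lt ?_
    refine setLIntegral_lt_top_of_le_nnreal ?_ ⟨(max B R).toNNReal, fun q hq => ?_⟩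
    · rw [Measure.volume_eq_prod, Measure.prod_prod]
      exact ENNReal.mul_lt_top measure_Ioc_lt_top measure_Ico_lt_top |>.ne
    · refine ENNReal.ofReal_le_ofReal ?_
      -- off the rectangle the area element is that of the cone, namely `t`
      by_cases hq1 : q.1 ∈ Icc Δ.a Δ.b
      · exact (le_abs_self _).trans ((hB q ⟨hq1, Ico_subset_Icc_self hq.2⟩).trans (le_max_left _ _))
      · refine le_trans ?_ (le_max_right _ _)
        have hq0 : 0 < q.1 := hq.1.1
        have hev : Δ.φ =ᶠ[nhds q.1] fun _ => 0 := by
          filter_upwards [(isOpen_Ioi.inter isClosed_Icc.isOpen_compl).mem_nhds ⟨hq0, hq1⟩]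
            with t ht using Δ.φ_eq_zero t ht.1 fun h => ht.2 (Ioo_subset_Icc_self h)
        change areaElement g (variation (Δ.E j) Δ.φ s) q ≤ R
        rw [areaElement_variation Δ.smooth_φ (Δ.smooth_E j) (Δ.mem_varDomain s hs j q hq0)]
        simp only [radicand, hev.eq_of_nhds, hev.deriv_eq, deriv_const, mul_zero, Δ.immersion]
        simpa [Real.sqrt_sq hq0.le] using hq.1.2

/-- At a suitable small time the deformed cone is embedded and has less area than the cone. -/
lemma not_isAreaMinimizing [T2Space M] (Δ : Deformation S) :
    ¬ (coneCurrent S).IsAreaMinimizing g := by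
  intro hmin
  obtain ⟨ρ, hρ, hinj⟩ := Δ.exists_embedded
  obtain ⟨B, hB⟩ := exists_abs_le_of_eq_zero_off Δ.a_pos Δ.a_lt_b Δ.smooth_φ.continuousOn
    Δ.φ_eq_zero
  have hB0 : 0 < B + 1 := by linarith [(abs_nonneg _).trans (hB 1 one_pos)]
  obtain ⟨s, hs, hsρ, hlt⟩ := Δ.exists_area_lt (div_pos hρ hB0)
  have hsmall : ∀ t, 0 < t → |s * Δ.φ t| < ρ := fun t ht => by
    rw [lt_div_iff₀ hB0] at hsρ
    rw [abs_mul]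
    calc |s| * |Δ.φ t| ≤ |s| * (B + 1) := by
          gcongr
          linarith [hB t ht]
      _ < ρ := hsρ
  rw [← Δ.chain_zero] at hmin
  have hle := hmin (Δ.swept s) (Δ.coneCompact_swept hs) (Δ.chain s)
    (Δ.isIntegerRectifiable hs fun t ht => hinj _ (hsmall t ht)) (Δ.sameBoundary hs) (Δ.agreeOff s)
  rw [Δ.mass_swept Δ.zero_mem (Or.inl rfl), Δ.mass_swept hs (Or.inr rfl)] at hle
  refine hle.not_gt ((ENNReal.ofReal_lt_ofReal_iff ?_).2 hlt)
  refine lt_of_le_of_lt (Finset.sum_nonneg fun j _ => ?_) hlt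
  exact setIntegral_nonneg (measurableSet_Icc.prod measurableSet_Icc) fun q _ => Real.sqrt_nonneg _

end Deformation

end Competitor

end MinCone

end

open MinCone in
/-- If the Gauss curvature of the surface `(M, g)` is at least `lam⁻² > 1`, then the cone over a
closed embedded two-sided minimal curve in `M` is neither stable nor area-minimizing in the cone
over `M`. -/
theorem theorem3p1 {M : Type*} [TopologicalSpace M] [T2Space M] [ChartedSpace Plane M]
    [IsManifold 𝓘(ℝ, Plane) ∞ M] (g : SurfaceMetric M)
    (lam : ℝ) (hlam0 : 0 < lam) (hlam1 : lam < 1) (hK : GaussCurvatureGE g (lam ^ (-2 : ℤ)))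
    (m : ℕ) (hm : 0 < m) (S : ClosedCurves g m) (hmin : S.IsMinimal) (hside : S.IsTwoSided) :
    ¬ IsStableCone S ∧ ¬ (coneCurrent S).IsAreaMinimizing g := by
  have hκ : 1 < lam ^ (-2 : ℤ) := one_lt_zpow_of_neg₀ hlam0 hlam1 (by norm_num)
  obtain ⟨Δ⟩ := exists_deformation hκ hK hm S hmin hside
  exact ⟨Δ.not_isStableCone, Δ.not_isAreaMinimizing⟩
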